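/- Let $R$ be a commutative ring with identity. All groups and all $G$-sets are finite. For groups $G,H$ let $RB(G)=R\otimes_{\mathbb Z}B(G)$, where $B(G)$ is the Grothendieck group of finite $G$-sets for disjoint union, and let $RB(H,G)$ be the same construction for $(H,G)$-bisets, identified with $RB(H\times G)$. A biset functor is an $R$-linear functor to $R$-modules from the category with objects the finite groups, $\mathrm{Hom}(G,H)=RB(H,G)$, and composition induced by $V\times_H U$. Let $C$ be a group of prime order. The Yoneda–Dress construction $A=RB_C$ is the biset functor $A(G)=RB(G\times C)$, on which $\varphi\in RB(H,G)$ acts as $\varphi\times C$, with the products $A(G)\times A(H)\to A(G\times H)$ that send the classes of $X$ and $Y$ to the class of $X\times Y$ with $(g,h,c)(x,y)=((g,c)x,(h,c)y)$, and with identity element $\varepsilon\in A(1)$ the class of the one-point set. An $A$-module is a biset functor $M$ with bilinear products $A(G)\times M(H)\to M(G\times H)$ that are associative, unital, and functorial with respect to bisets; it is simple if it is nonzero and its only submodules (families of submodules of the $M(G)$ stable under bisets and under products with $A$) are $0$ and $M$. Let $\overleftarrow{G}$ be the $(1,G\times G)$-biset $G$ with $x\cdot(g,h)=g^{-1}xh$.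 For $\beta\in A(H\times G)$ and $\alpha\in A(G\times K)$ let $\beta\circ\alpha=A(H\times\overleftarrow{G}\times K)(\beta\times\alpha)\in A(H\times K)$; this makes $A(H\times H)$ an $R$-algebra, and $M(H)$ is an $A(H\times H)$-module for every $A$-module $M$ by $a\cdot m=M(H\times\overleftarrow{H})(a\times m)$. Let $\hat A(H)$ be the quotient of $A(H\times H)$ by the two-sided ideal generated as an $R$-submodule by all $a\circ b$ with $a\in A(H\times K)$, $b\in A(K\times H)$ and $|K|<|H|$. For a group isomorphism $\varphi:H\to G$ let $\alpha_1\in A(G\times H)$ and $\alpha_2\in A(H\times G)$ be the images of $\varepsilon$ under the bisets $\mathrm{Iso}(\varphi)$ and $\mathrm{Iso}(\varphi^{-1})$, viewed as a $(G\times H,1)$-biset and an $(H\times G,1)$-biset; for an $A(G\times G)$-module $W$ let ${}^{\varphi}W$ be the $A(H\times H)$-module $W$ with $a\cdot w=(\alpha_1\circ a\circ\alpha_2)w$. Consider the couples $(H,V)$ where $H$ is a group and $V$ is a simple $\hat A(H)$-module, with $(H,V)\sim(G,W)$ if there is a group isomorphism $\varphi:H\to G$ such that $V\cong{}^{\varphi}W$.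 Then the isomorphism classes of simple $RB_C$-modules are in one-to-one correspondence with the equivalence classes of couples $(H,V)$. In this correspondence the class of $S$ corresponds to the class of $(H,V)$ if and only if $H$ is minimal for $S$ (that is, $S(H)\neq0$, and $S(K)=0$ whenever $|K|<|H|$) and $S(H)\cong V$ as $A(H\times H)$-modules. Moreover, if $R\neq0$, then $\hat A(H)\neq0$ for every group $H$, so that every group $H$ occurs. -/

import Mathlib

open scoped TensorProduct

universe u w

/-- A finite `G`-set. -/
structure GSet (G : Type) [Group G] : Type 1 where
  carrier : Type
  [action : MulAction G carrier]
  [finite : Finite carrier]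

attribute [instance] GSet.action GSet.finite

namespace GSet

variable {G H K L G' H' : Type} [Group G] [Group H] [Group K] [Group L] [Group G'] [Group H']

/-- Two `G`-sets are isomorphic when there is a `G`-equivariant bijection between them. -/
def Iso (X Y : GSet G) : Prop :=
  ∃ e : X.carrier ≃ Y.carrier, ∀ (g : G) (x : X.carrier), e (g • x) = g • e x

theorem Iso.refl (X : GSet G) : Iso X X := ⟨Equiv.refl _, fun _ _ => rfl⟩

theorem Iso.symm {X Y : GSet G} : Iso X Y → Iso Y X := by
  rintro ⟨e, he⟩
  refine ⟨e.symm, fun g y => ?_⟩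
  rw [Equiv.symm_apply_eq, he, Equiv.apply_symm_apply]

theorem Iso.trans {X Y Z : GSet G} : Iso X Y → Iso Y Z → Iso X Z := by
  rintro ⟨e, he⟩ ⟨f, hf⟩
  exact ⟨e.trans f, fun g x => by simp [he, hf]⟩

/-- Disjoint union. -/
def sum (X Y : GSet G) : GSet G where
  carrier := X.carrier ⊕ Y.carrier

/-- The empty `G`-set. -/
def empty (G : Type) [Group G] : GSet G where
  carrier := Empty
  action := { smul := fun _ x => x, one_smul := fun _ => rfl, mul_smul := fun _ _ _ => rfl }

/-- The `G`-set with one point. -/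
def point (G : Type) [Group G] : GSet G where
  carrier := Unit
  action := { smul := fun _ x => x, one_smul := fun _ => rfl, mul_smul := fun _ _ _ => rfl }

/-- The `G`-set obtained from the `H`-set `X` by letting `G` act through `f : G → H`. -/
def res (f : G →* H) (X : GSet H) : GSet G where
  carrier := X.carrier
  action := MulAction.compHom X.carrier f

/-- The `(G × H)`-set `X × Y`, for a `G`-set `X` and an `H`-set `Y`. -/
def prod (X : GSet G) (Y : GSet H) : GSet (G × H) where
  carrier := X.carrier × Y.carrier
  action :=
    { smul := fun g x => (g.1 • x.1, g.2 • x.2)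
      one_smul := fun x => Prod.ext (one_smul G x.1) (one_smul H x.2)
      mul_smul := fun g h x => Prod.ext (mul_smul g.1 h.1 x.1) (mul_smul g.2 h.2 x.2) }

/-- Transport of a `G`-set to the set `Fin n`, where `n` is its cardinality. -/
noncomputable def skeleton (X : GSet G) : Σ n : ℕ, MulAction G (Fin n) :=
  ⟨Nat.card X.carrier, (Finite.equivFin X.carrier).symm.mulAction G⟩

/-- The `G`-set given by an action of `G` on `Fin n`. -/
def ofSkeleton (s : Σ n : ℕ, MulAction G (Fin n)) : GSet G where
  carrier := Fin s.1
  action := s.2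

theorem ofSkeleton_skeleton (X : GSet G) : Iso (ofSkeleton X.skeleton) X := by
  refine ⟨(Finite.equivFin X.carrier).symm, fun g x => ?_⟩
  exact (Finite.equivFin X.carrier).symm_apply_apply _

/-- Isomorphism of finite `G`-sets, on the `G`-sets whose underlying set is some `Fin n`. -/
instance isoSetoid (G : Type) [Group G] : Setoid (Σ n : ℕ, MulAction G (Fin n)) where
  r s t := Iso (ofSkeleton s) (ofSkeleton t)
  iseqv := ⟨fun _ => Iso.refl _, Iso.symm, Iso.trans⟩

end GSet

/-- The set of isomorphism classes of finite `G`-sets. Every finite `G`-set is isomorphic to one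
whose underlying set is some `Fin n`, so the latter are enough. -/
def IsoClass (G : Type) [Group G] : Type := Quotient (GSet.isoSetoid G)

namespace IsoClass

variable {G H K : Type} [Group G] [Group H] [Group K]

/-- The isomorphism class of a finite `G`-set. -/
noncomputable def mk (X : GSet G) : IsoClass G := Quotient.mk _ X.skeleton

/-- A `G`-set in a given isomorphism class. -/
noncomputable def rep (a : IsoClass G) : GSet G := GSet.ofSkeleton (Quotient.out a)

theorem mk_eq_mk {X Y : GSet G} : mk X = mk Y ↔ X.Iso Y := by
  constructor
  · intro h
    have h' : (GSet.ofSkeleton X.skeleton).Iso (GSet.ofSkeleton Y.skeleton) := Quotient.exact h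
    exact (X.ofSkeleton_skeleton.symm.trans h').trans Y.ofSkeleton_skeleton
  · intro h
    apply Quotient.sound
    exact (X.ofSkeleton_skeleton.trans h).trans Y.ofSkeleton_skeleton.symm

theorem mk_rep (a : IsoClass G) : mk a.rep = a := by
  conv_rhs => rw [← Quotient.out_eq a]
  apply Quotient.sound
  exact GSet.ofSkeleton_skeleton _

theorem rep_mk (X : GSet G) : (mk X).rep.Iso X := mk_eq_mk.1 (mk_rep _)

theorem ind {p : IsoClass G → Prop} (h : ∀ X, p (mk X)) (a : IsoClass G) : p a := by
  rw [← mk_rep a]; exact h _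

theorem sum_congr {X X' Y Y' : GSet G} : X.Iso X' → Y.Iso Y' → (X.sum Y).Iso (X'.sum Y') := by
  rintro ⟨e, he⟩ ⟨f, hf⟩
  refine ⟨Equiv.sumCongr e f, ?_⟩
  rintro g (x | y)
  · exact congrArg Sum.inl (he g x)
  · exact congrArg Sum.inr (hf g y)

/-- Addition of isomorphism classes is induced by disjoint union. -/
noncomputable instance : Add (IsoClass G) := ⟨fun a b => mk (a.rep.sum b.rep)⟩

noncomputable instance : Zero (IsoClass G) := ⟨mk (GSet.empty G)⟩

theorem mk_add_mk (X Y : GSet G) : mk X + mk Y = mk (X.sum Y) :=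
  mk_eq_mk.2 (sum_congr (rep_mk X) (rep_mk Y))

theorem zero_def : (0 : IsoClass G) = mk (GSet.empty G) := rfl

noncomputable instance : AddCommMonoid (IsoClass G) where
  add_assoc a b c := by
    induction a using ind with | h X => ?_
    induction b using ind with | h Y => ?_
    induction c using ind with | h Z => ?_
    simp only [mk_add_mk, mk_eq_mk]
    refine ⟨Equiv.sumAssoc _ _ _, ?_⟩
    rintro g ((x | y) | z) <;> rfl
  zero_add a := by
    induction a using ind with | h X => ?_
    simp only [zero_def, mk_add_mk, mk_eq_mk]
    refine ⟨Equiv.emptySum Empty _, ?_⟩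
    rintro g (x | x)
    · exact x.elim
    · rfl
  add_zero a := by
    induction a using ind with | h X => ?_
    simp only [zero_def, mk_add_mk, mk_eq_mk]
    refine ⟨Equiv.sumEmpty _ Empty, ?_⟩
    rintro g (x | x)
    · rfl
    · exact x.elim
  add_comm a b := by
    induction a using ind with | h X => ?_
    induction b using ind with | h Y => ?_
    simp only [mk_add_mk, mk_eq_mk]
    refine ⟨Equiv.sumComm _ _, ?_⟩
    rintro g (x | x) <;> rfl
  nsmul := nsmulRec

/-- The additive map on isomorphism classes induced by a construction on `G`-sets that preserves
isomorphisms and finite disjoint unions. -/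
noncomputable def map (F : GSet G → GSet H) (hF : ∀ X X', X.Iso X' → (F X).Iso (F X'))
    (h0 : (F (GSet.empty G)).Iso (GSet.empty H))
    (hs : ∀ X Y, (F (X.sum Y)).Iso ((F X).sum (F Y))) : IsoClass G →+ IsoClass H where
  toFun a := mk (F a.rep)
  map_zero' := mk_eq_mk.2 ((hF _ _ (rep_mk _)).trans h0)
  map_add' a b := by
    rw [mk_add_mk, mk_eq_mk]
    exact (hF _ _ (rep_mk _)).trans (hs _ _)

theorem map_mk (F : GSet G → GSet H) (hF h0 hs) (X : GSet G) :
    map F hF h0 hs (mk X) = mk (F X) := mk_eq_mk.2 (hF _ _ (rep_mk X))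

/-- The biadditive map on isomorphism classes induced by a construction that preserves isomorphisms
and finite disjoint unions in each of its two arguments. -/
noncomputable def map₂ (F : GSet G → GSet H → GSet K)
    (hF : ∀ X X' Y Y', X.Iso X' → Y.Iso Y' → (F X Y).Iso (F X' Y'))
    (h0 : ∀ Y, (F (GSet.empty G) Y).Iso (GSet.empty K))
    (hs : ∀ X X' Y, (F (X.sum X') Y).Iso ((F X Y).sum (F X' Y)))
    (h0' : ∀ X, (F X (GSet.empty H)).Iso (GSet.empty K))
    (hs' : ∀ X Y Y', (F X (Y.sum Y')).Iso ((F X Y).sum (F X Y'))) :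
    IsoClass G →+ IsoClass H →+ IsoClass K where
  toFun a := map (F a.rep) (fun _ _ h => hF _ _ _ _ (GSet.Iso.refl _) h) (h0' _) (hs' _)
  map_zero' := by
    ext b
    induction b using ind with | h Y => ?_
    rw [map_mk]
    exact mk_eq_mk.2 ((hF _ _ _ _ (rep_mk _) (GSet.Iso.refl _)).trans (h0 _))
  map_add' a b := by
    ext c
    induction c using ind with | h Y => ?_
    rw [AddMonoidHom.add_apply, map_mk, map_mk, map_mk, mk_add_mk]
    exact mk_eq_mk.2 ((hF _ _ _ _ (rep_mk _) (GSet.Iso.refl _)).trans (hs _ _ _))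

theorem map₂_mk (F : GSet G → GSet H → GSet K) (hF h0 hs h0' hs') (X : GSet G) (Y : GSet H) :
    map₂ F hF h0 hs h0' hs' (mk X) (mk Y) = mk (F X Y) :=
  mk_eq_mk.2 (hF _ _ _ _ (rep_mk X) (rep_mk Y))

end IsoClass

/-- The Burnside group of `G` with coefficients in `R`: the tensor product over `ℤ` of `R` with the
Grothendieck group of the category of finite `G`-sets, for disjoint union. -/
def RB (R : Type u) [CommRing R] (G : Type) [Group G] : Type u :=
  R ⊗[ℤ] Algebra.GrothendieckAddGroup (IsoClass G)

namespace RB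

variable {R : Type u} [CommRing R]

noncomputable instance (G : Type) [Group G] : AddCommGroup (RB R G) :=
  inferInstanceAs (AddCommGroup (R ⊗[ℤ] Algebra.GrothendieckAddGroup (IsoClass G)))

noncomputable instance (G : Type) [Group G] : Module R (RB R G) :=
  inferInstanceAs (Module R (R ⊗[ℤ] Algebra.GrothendieckAddGroup (IsoClass G)))

variable {G H K : Type} [Group G] [Group H] [Group K]

/-- The map from isomorphism classes of `G`-sets to the Burnside group. -/
noncomputable def ofClass (R : Type u) [CommRing R] (G : Type) [Group G] : IsoClass G →+ RB R G :=
  AddMonoidHom.comp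
    (TensorProduct.mk ℤ R (Algebra.GrothendieckAddGroup (IsoClass G)) 1).toAddMonoidHom
    Algebra.GrothendieckAddGroup.of

/-- The class of a finite `G`-set in the Burnside group. -/
noncomputable def cls (R : Type u) [CommRing R] (X : GSet G) : RB R G :=
  ofClass R G (IsoClass.mk X)

theorem cls_congr {X Y : GSet G} (h : X.Iso Y) : cls R X = cls R Y := by
  rw [cls, cls, IsoClass.mk_eq_mk.2 h]

/-- The linear map on the Burnside group that extends an additive map on isomorphism classes. -/
noncomputable def lift {P : Type*} [AddCommGroup P] [Module R P] (f : IsoClass G →+ P) :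
    RB R G →ₗ[R] P :=
  LinearMap.liftBaseChange R (Algebra.GrothendieckAddGroup.lift f).toIntLinearMap

theorem lift_ofClass {P : Type*} [AddCommGroup P] [Module R P] (f : IsoClass G →+ P)
    (a : IsoClass G) : lift f (ofClass R G a) = f a := by
  have h : lift f (ofClass R G a)
      = (1 : R) • Algebra.GrothendieckAddGroup.lift f (Algebra.GrothendieckAddGroup.of a) :=
    LinearMap.liftBaseChange_tmul _ _ _ _
  rw [h, one_smul]
  exact DFunLike.congr_fun (Algebra.GrothendieckAddGroup.lift.symm_apply_apply f) a

/-- Linear maps out of the Burnside group are determined by their values on classes of sets. -/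
theorem hom_ext {P : Type*} [AddCommGroup P] [Module R P] {f g : RB R G →ₗ[R] P}
    (h : ∀ X : GSet G, f (cls R X) = g (cls R X)) : f = g := by
  have key : ∀ b : Algebra.GrothendieckAddGroup (IsoClass G),
      f (TensorProduct.mk ℤ R _ 1 b) = g (TensorProduct.mk ℤ R _ 1 b) := by
    let f' : Algebra.GrothendieckAddGroup (IsoClass G) →+ P :=
      f.toAddMonoidHom.comp (TensorProduct.mk ℤ R _ 1).toAddMonoidHom
    let g' : Algebra.GrothendieckAddGroup (IsoClass G) →+ P :=
      g.toAddMonoidHom.comp (TensorProduct.mk ℤ R _ 1).toAddMonoidHom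
    have hfg : f' = g' := by
      apply Algebra.GrothendieckAddGroup.lift.symm.injective
      ext a
      induction a using IsoClass.ind with | h X => ?_
      exact h X
    exact fun b => DFunLike.congr_fun hfg b
  ext x
  refine TensorProduct.induction_on x ?_ ?_ ?_
  · exact (map_zero f).trans (map_zero g).symm
  · intro r b
    have hr : (r ⊗ₜ[ℤ] b : R ⊗[ℤ] Algebra.GrothendieckAddGroup (IsoClass G))
        = r • (TensorProduct.mk ℤ R _ 1 b) := by
      rw [TensorProduct.mk_apply, TensorProduct.smul_tmul', smul_eq_mul, mul_one]
    rw [hr]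
    exact (map_smul f r _).trans ((congrArg (r • ·) (key b)).trans (map_smul g r _).symm)
  · intro a b ha hb
    exact (map_add f a b).trans ((congrArg₂ (· + ·) ha hb).trans (map_add g a b).symm)

theorem hom_ext₂ {P : Type*} [AddCommGroup P] [Module R P] {f g : RB R G →ₗ[R] RB R H →ₗ[R] P}
    (h : ∀ (X : GSet G) (Y : GSet H), f (cls R X) (cls R Y) = g (cls R X) (cls R Y)) : f = g :=
  hom_ext fun X => hom_ext fun Y => h X Y

/-- The linear map of Burnside groups that extends an additive map on isomorphism classes. -/
noncomputable def lift₁ (f : IsoClass G →+ IsoClass H) : RB R G →ₗ[R] RB R H :=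
  lift ((ofClass R H).comp f)

/-- The bilinear map of Burnside groups that extends a biadditive map on isomorphism classes. -/
noncomputable def lift₂ (f : IsoClass G →+ IsoClass H →+ IsoClass K) :
    RB R G →ₗ[R] RB R H →ₗ[R] RB R K :=
  lift
    { toFun := fun a => lift₁ (f a)
      map_zero' := hom_ext fun Y => by
        rw [lift₁, cls, lift_ofClass]
        simp
      map_add' := fun a b => hom_ext fun Y => by
        rw [LinearMap.add_apply, lift₁, lift₁, lift₁, cls, lift_ofClass, lift_ofClass, lift_ofClass]
        simp }

theorem lift₁_cls (f : IsoClass G →+ IsoClass H) (X : GSet G) :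
    lift₁ f (cls R X) = ofClass R H (f (IsoClass.mk X)) := lift_ofClass _ _

theorem lift₂_cls (f : IsoClass G →+ IsoClass H →+ IsoClass K) (X : GSet G) (Y : GSet H) :
    lift₂ f (cls R X) (cls R Y) = ofClass R K (f (IsoClass.mk X) (IsoClass.mk Y)) := by
  have h : lift₂ (R := R) f (cls R X) = lift₁ (f (IsoClass.mk X)) := lift_ofClass _ _
  rw [h, lift₁_cls]

end RB

namespace GSet

variable {G H K L G' H' : Type} [Group G] [Group H] [Group K] [Group L] [Group G'] [Group H']

/-- Two `G`-sets covered by the same set, with the same fibres and compatible actions, are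
isomorphic. -/
theorem iso_of_span {X Y : GSet G} {W : Type*} (p : W → X.carrier) (q : W → Y.carrier)
    (hp : Function.Surjective p) (hq : Function.Surjective q)
    (h : ∀ w w', p w = p w' ↔ q w = q w')
    (hg : ∀ (g : G) (w : W), ∃ w', p w' = g • p w ∧ q w' = g • q w) : X.Iso Y := by
  have key : ∀ w, q (Function.surjInv hp (p w)) = q w := fun w =>
    (h _ _).1 (Function.surjInv_eq hp _)
  refine ⟨Equiv.ofBijective (fun x => q (Function.surjInv hp x)) ⟨?_, ?_⟩, ?_⟩
  · intro x y hxy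
    have := (h _ _).2 hxy
    rwa [Function.surjInv_eq hp, Function.surjInv_eq hp] at this
  · intro y
    obtain ⟨w, rfl⟩ := hq y
    exact ⟨p w, key w⟩
  · intro g x
    obtain ⟨w, rfl⟩ := hp x
    obtain ⟨w', hw, hw'⟩ := hg g w
    change q (Function.surjInv hp (g • p w)) = g • q (Function.surjInv hp (p w))
    rw [← hw, key, key, hw']

end GSet

/-- A finite `(H, G)`-biset, that is, a finite set with commuting actions of `H` on the left and
of `G` on the right, given as the `(H × G)`-set on which `(h, g) • x` is `h x g⁻¹`. -/
abbrev Biset (H G : Type) [Group H] [Group G] : Type 1 := GSet (H × G)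

namespace Biset

variable {G H K L G' H' : Type} [Group G] [Group H] [Group K] [Group L] [Group G'] [Group H']

/-- The orbit relation on `V × U` of the right action `(v, u) · h = (v h, h⁻¹ u)` of `H`. Here
`v h⁻¹` is `(1, h) • v` and `h u` is `(h, 1) • u`. -/
def compSetoid (V : Biset K H) (U : Biset H G) : Setoid (V.carrier × U.carrier) where
  r p q := ∃ h : H, q.1 = ((1, h) : K × H) • p.1 ∧ q.2 = ((h, 1) : H × G) • p.2
  iseqv :=
    { refl := fun p => ⟨1, (one_smul (K × H) p.1).symm, (one_smul (H × G) p.2).symm⟩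
      symm := by
        rintro p q ⟨h, h1, h2⟩
        refine ⟨h⁻¹, ?_, ?_⟩
        · rw [h1, smul_smul]
          simp only [Prod.mk_mul_mk, mul_one, inv_mul_cancel]
          exact (one_smul (K × H) p.1).symm
        · rw [h2, smul_smul]
          simp only [Prod.mk_mul_mk, mul_one, inv_mul_cancel]
          exact (one_smul (H × G) p.2).symm
      trans := by
        rintro p q r ⟨h, h1, h2⟩ ⟨k, k1, k2⟩
        refine ⟨k * h, ?_, ?_⟩
        · rw [k1, h1, smul_smul]; simp
        · rw [k2, h2, smul_smul]; simp }

/-- The composition `V ×_H U` of a `(K, H)`-biset and an `(H, G)`-biset: the set of `H`-orbits on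
`V × U`, with `k [v, u] g = [k v, u g]`. -/
def comp (V : Biset K H) (U : Biset H G) : Biset K G where
  carrier := Quotient (compSetoid V U)
  action :=
    { smul := fun a => Quotient.map
        (fun p => (((a.1, 1) : K × H) • p.1, ((1, a.2) : H × G) • p.2)) (by
          rintro p q ⟨h, h1, h2⟩
          refine ⟨h, ?_, ?_⟩
          · simp only [h1, smul_smul]; simp
          · simp only [h2, smul_smul]; simp)
      one_smul := by
        rintro ⟨p⟩
        exact congrArg (Quotient.mk _)
          (Prod.ext (one_smul (K × H) p.1) (one_smul (H × G) p.2))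
      mul_smul := by
        rintro a b ⟨p⟩
        refine congrArg (Quotient.mk _) (Prod.ext ?_ ?_)
        · simp only [smul_smul]; simp
        · simp only [smul_smul]; simp }
  finite := Quotient.finite _

/-- The element `[v, u]` of the composition. -/
def pair (V : Biset K H) (U : Biset H G) (p : V.carrier × U.carrier) : (comp V U).carrier :=
  Quotient.mk (compSetoid V U) p

theorem pair_surjective (V : Biset K H) (U : Biset H G) : Function.Surjective (pair V U) :=
  Quotient.mk_surjective

theorem smul_pair (V : Biset K H) (U : Biset H G) (k : K) (g : G) (p : V.carrier × U.carrier) :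
    ((k, g) : K × G) • pair V U p
      = pair V U (((k, 1) : K × H) • p.1, ((1, g) : H × G) • p.2) := rfl

theorem pair_eq_pair {V : Biset K H} {U : Biset H G} {p q : V.carrier × U.carrier} :
    pair V U p = pair V U q ↔
      ∃ h : H, q.1 = ((1, h) : K × H) • p.1 ∧ q.2 = ((h, 1) : H × G) • p.2 := Quotient.eq

theorem comp_congr {V V' : Biset K H} {U U' : Biset H G} :
    V.Iso V' → U.Iso U' → (comp V U).Iso (comp V' U') := by
  rintro ⟨e, he⟩ ⟨f, hf⟩
  refine GSet.iso_of_span (W := V.carrier × U.carrier) (pair V U)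
    (fun p => pair V' U' (e p.1, f p.2)) (pair_surjective _ _) ?_ ?_ ?_
  · rintro ⟨p, q⟩
    exact ⟨(e.symm p, f.symm q), by simp; rfl⟩
  · intro p q
    rw [pair_eq_pair, pair_eq_pair]
    simp only [← he, ← hf, e.injective.eq_iff, f.injective.eq_iff]
  · rintro ⟨k, g⟩ p
    refine ⟨_, (smul_pair V U k g p).symm, ?_⟩
    rw [smul_pair, he, hf]

theorem comp_empty_left (U : Biset H G) :
    (comp (GSet.empty (K × H)) U).Iso (GSet.empty (K × G)) := by
  refine GSet.iso_of_span (W := Empty) (fun w => w.elim) (fun w => w.elim) ?_ ?_ ?_ ?_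
  · rintro ⟨p, _⟩; exact Empty.elim p
  · intro p; exact Empty.elim p
  · intro p; exact p.elim
  · intro _ p; exact p.elim

theorem comp_empty_right (V : Biset K H) :
    (comp V (GSet.empty (H × G))).Iso (GSet.empty (K × G)) := by
  refine GSet.iso_of_span (W := Empty) (fun w => w.elim) (fun w => w.elim) ?_ ?_ ?_ ?_
  · rintro ⟨_, p⟩; exact Empty.elim p
  · intro p; exact Empty.elim p
  · intro p; exact p.elim
  · intro _ p; exact p.elim

theorem comp_sum_left (V V' : Biset K H) (U : Biset H G) :
    (comp (V.sum V') U).Iso ((comp V U).sum (comp V' U)) := by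
  refine GSet.iso_of_span (W := V.carrier × U.carrier ⊕ V'.carrier × U.carrier)
    (Sum.elim (fun p => pair (V.sum V') U (Sum.inl p.1, p.2))
      (fun p => pair (V.sum V') U (Sum.inr p.1, p.2)))
    (Sum.map (pair V U) (pair V' U)) ?_ ?_ ?_ ?_
  · rintro ⟨(p | p), q⟩
    · exact ⟨Sum.inl (p, q), rfl⟩
    · exact ⟨Sum.inr (p, q), rfl⟩
  · exact Sum.map_surjective.2 ⟨pair_surjective _ _, pair_surjective _ _⟩
  · rintro (p | p) (q | q)
    · refine Iff.trans pair_eq_pair (Iff.trans ?_ (Sum.inl_injective.eq_iff.trans pair_eq_pair).symm)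
      exact exists_congr fun h => and_congr_left' Sum.inl_injective.eq_iff
    · refine Iff.trans pair_eq_pair (iff_of_false ?_ Sum.inl_ne_inr)
      rintro ⟨h, h1, -⟩
      exact Sum.inr_ne_inl h1
    · refine Iff.trans pair_eq_pair (iff_of_false ?_ Sum.inr_ne_inl)
      rintro ⟨h, h1, -⟩
      exact Sum.inl_ne_inr h1
    · refine Iff.trans pair_eq_pair (Iff.trans ?_ (Sum.inr_injective.eq_iff.trans pair_eq_pair).symm)
      exact exists_congr fun h => and_congr_left' Sum.inr_injective.eq_iff
  · rintro ⟨k, g⟩ (p | p)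
    · exact ⟨Sum.inl (((k, 1) : K × H) • p.1, ((1, g) : H × G) • p.2), rfl, rfl⟩
    · exact ⟨Sum.inr (((k, 1) : K × H) • p.1, ((1, g) : H × G) • p.2), rfl, rfl⟩

theorem comp_sum_right (V : Biset K H) (U U' : Biset H G) :
    (comp V (U.sum U')).Iso ((comp V U).sum (comp V U')) := by
  refine GSet.iso_of_span (W := V.carrier × U.carrier ⊕ V.carrier × U'.carrier)
    (Sum.elim (fun p => pair V (U.sum U') (p.1, Sum.inl p.2))
      (fun p => pair V (U.sum U') (p.1, Sum.inr p.2)))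
    (Sum.map (pair V U) (pair V U')) ?_ ?_ ?_ ?_
  · rintro ⟨p, (q | q)⟩
    · exact ⟨Sum.inl (p, q), rfl⟩
    · exact ⟨Sum.inr (p, q), rfl⟩
  · exact Sum.map_surjective.2 ⟨pair_surjective _ _, pair_surjective _ _⟩
  · rintro (p | p) (q | q)
    · refine Iff.trans pair_eq_pair (Iff.trans ?_ (Sum.inl_injective.eq_iff.trans pair_eq_pair).symm)
      exact exists_congr fun h => and_congr_right' Sum.inl_injective.eq_iff
    · refine Iff.trans pair_eq_pair (iff_of_false ?_ Sum.inl_ne_inr)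
      rintro ⟨h, -, h1⟩
      exact Sum.inr_ne_inl h1
    · refine Iff.trans pair_eq_pair (iff_of_false ?_ Sum.inr_ne_inl)
      rintro ⟨h, -, h1⟩
      exact Sum.inl_ne_inr h1
    · refine Iff.trans pair_eq_pair (Iff.trans ?_ (Sum.inr_injective.eq_iff.trans pair_eq_pair).symm)
      exact exists_congr fun h => and_congr_right' Sum.inr_injective.eq_iff
  · rintro ⟨k, g⟩ (p | p)
    · exact ⟨Sum.inl (((k, 1) : K × H) • p.1, ((1, g) : H × G) • p.2), rfl, rfl⟩
    · exact ⟨Sum.inr (((k, 1) : K × H) • p.1, ((1, g) : H × G) • p.2), rfl, rfl⟩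

/-- For a group isomorphism `φ : H → G`, the `(G, H)`-biset `Iso(φ)`: the set `G`, with `G` acting
by left multiplication and `h` acting by right multiplication by `φ h`. -/
def iso [Finite G] (φ : H ≃* G) : Biset G H where
  carrier := G
  action :=
    { smul := fun a x => a.1 * x * (φ a.2)⁻¹
      one_smul := fun x => show 1 * x * (φ 1)⁻¹ = x by simp
      mul_smul := fun a b x => show (a.1 * b.1) * x * (φ (a.2 * b.2))⁻¹
          = a.1 * (b.1 * x * (φ b.2)⁻¹) * (φ a.2)⁻¹ by simp [mul_assoc] }

/-- The `(G, G)`-biset `G`. -/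
def id (G : Type) [Group G] [Finite G] : Biset G G := iso (MulEquiv.refl G)

/-- The opposite of `G`, viewed as a `(G × G, 1)`-biset by `(g, h) x = g x h⁻¹`, is a
`(1, G × G)`-biset: the set `G` with `x · (g, h) = g⁻¹ x h`. This is the product
`H × G × K` of it with the bisets `H` and `K`, an `(H × K, (H × G) × (G × K))`-biset. -/
def contract (H G K : Type) [Group H] [Group G] [Group K] [Finite H] [Finite G] [Finite K] :
    Biset (H × K) ((H × G) × (G × K)) where
  carrier := H × G × K
  action :=
    { smul := fun a x =>
        (a.1.1 * x.1 * a.2.1.1⁻¹, a.2.1.2 * x.2.1 * a.2.2.1⁻¹, a.1.2 * x.2.2 * a.2.2.2⁻¹)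
      one_smul := fun x => show (1 * x.1 * 1⁻¹, 1 * x.2.1 * 1⁻¹, 1 * x.2.2 * 1⁻¹) = x by simp
      mul_smul := fun a b x => by
        refine Prod.ext ?_ (Prod.ext ?_ ?_)
        · show a.1.1 * b.1.1 * x.1 * (a.2.1.1 * b.2.1.1)⁻¹
            = a.1.1 * (b.1.1 * x.1 * b.2.1.1⁻¹) * a.2.1.1⁻¹
          simp [mul_assoc]
        · show a.2.1.2 * b.2.1.2 * x.2.1 * (a.2.2.1 * b.2.2.1)⁻¹
            = a.2.1.2 * (b.2.1.2 * x.2.1 * b.2.2.1⁻¹) * a.2.2.1⁻¹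
          simp [mul_assoc]
        · show a.1.2 * b.1.2 * x.2.2 * (a.2.2.2 * b.2.2.2)⁻¹
            = a.1.2 * (b.1.2 * x.2.2 * b.2.2.2⁻¹) * a.2.2.2⁻¹
          simp [mul_assoc] }

/-- The product of the `(G, G)`-biset `G` and of the same `(1, H × H)`-biset for `H`, a
`(G, (G × H) × H)`-biset. -/
def evaluate (G H : Type) [Group G] [Group H] [Finite G] [Finite H] :
    Biset G ((G × H) × H) where
  carrier := G × H
  action :=
    { smul := fun a x => (a.1 * x.1 * a.2.1.1⁻¹, a.2.1.2 * x.2 * a.2.2⁻¹)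
      one_smul := fun x => show (1 * x.1 * 1⁻¹, 1 * x.2 * 1⁻¹) = x by simp
      mul_smul := fun a b x => by
        refine Prod.ext ?_ ?_
        · show a.1 * b.1 * x.1 * (a.2.1.1 * b.2.1.1)⁻¹ = a.1 * (b.1 * x.1 * b.2.1.1⁻¹) * a.2.1.1⁻¹
          simp [mul_assoc]
        · show a.2.1.2 * b.2.1.2 * x.2 * (a.2.2 * b.2.2)⁻¹
            = a.2.1.2 * (b.2.1.2 * x.2 * b.2.2⁻¹) * a.2.2⁻¹
          simp [mul_assoc] }

end Biset

namespace GSet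

variable {G H : Type} [Group G] [Group H]

theorem res_congr (f : G →* H) {X X' : GSet H} : X.Iso X' → (res f X).Iso (res f X') := by
  rintro ⟨e, he⟩
  exact ⟨e, fun g x => he (f g) x⟩

theorem res_empty (f : G →* H) : (res f (empty H)).Iso (empty G) :=
  ⟨Equiv.refl Empty, fun _ x => Empty.elim x⟩

theorem res_sum (f : G →* H) (X Y : GSet H) : (res f (X.sum Y)).Iso ((res f X).sum (res f Y)) :=
  ⟨Equiv.refl (X.carrier ⊕ Y.carrier), by rintro g (x | x) <;> rfl⟩

theorem prod_congr {X X' : GSet G} {Y Y' : GSet H} :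
    X.Iso X' → Y.Iso Y' → (prod X Y).Iso (prod X' Y') := by
  rintro ⟨e, he⟩ ⟨f, hf⟩
  exact ⟨Equiv.prodCongr e f, fun g x => Prod.ext (he g.1 x.1) (hf g.2 x.2)⟩

theorem prod_empty_left (Y : GSet H) : (prod (empty G) Y).Iso (empty (G × H)) :=
  ⟨Equiv.equivOfIsEmpty (Empty × Y.carrier) Empty, fun _ x => Empty.elim x.1⟩

theorem prod_empty_right (X : GSet G) : (prod X (empty H)).Iso (empty (G × H)) :=
  ⟨Equiv.equivOfIsEmpty (X.carrier × Empty) Empty, fun _ x => Empty.elim x.2⟩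

theorem prod_sum_left (X X' : GSet G) (Y : GSet H) :
    (prod (X.sum X') Y).Iso ((prod X Y).sum (prod X' Y)) :=
  ⟨Equiv.sumProdDistrib X.carrier X'.carrier Y.carrier, by rintro g ⟨x | x, y⟩ <;> rfl⟩

theorem prod_sum_right (X : GSet G) (Y Y' : GSet H) :
    (prod X (Y.sum Y')).Iso ((prod X Y).sum (prod X Y')) :=
  ⟨Equiv.prodSumDistrib X.carrier Y.carrier Y'.carrier, by rintro g ⟨x, y | y⟩ <;> rfl⟩

end GSet

namespace RB

variable {R : Type u} [CommRing R]
variable {G H K G' H' : Type} [Group G] [Group H] [Group K] [Group G'] [Group H']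

/-- The map on Burnside groups that lets `G` act through `f : G → H`. -/
noncomputable def res (f : G →* H) : RB R H →ₗ[R] RB R G :=
  lift₁ (IsoClass.map (GSet.res f) (fun _ _ => GSet.res_congr f) (GSet.res_empty f)
    (GSet.res_sum f))

/-- The external product `RB(G) × RB(H) → RB(G × H)` induced by the product of sets. -/
noncomputable def ext : RB R G →ₗ[R] RB R H →ₗ[R] RB R (G × H) :=
  lift₂ (IsoClass.map₂ GSet.prod (fun _ _ _ _ => GSet.prod_congr) GSet.prod_empty_left
    GSet.prod_sum_left GSet.prod_empty_right GSet.prod_sum_right)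

/-- The composition of `RB(K, H) = RB(K × H)` and `RB(H, G) = RB(H × G)` in the biset category. -/
noncomputable def comp : RB R (K × H) →ₗ[R] RB R (H × G) →ₗ[R] RB R (K × G) :=
  lift₂ (IsoClass.map₂ Biset.comp (fun _ _ _ _ => Biset.comp_congr) Biset.comp_empty_left
    Biset.comp_sum_left Biset.comp_empty_right Biset.comp_sum_right)

theorem res_cls (f : G →* H) (X : GSet H) : res f (cls R X) = cls R (GSet.res f X) := by
  rw [res, lift₁_cls, IsoClass.map_mk, cls]

theorem ext_cls (X : GSet G) (Y : GSet H) : ext (cls R X) (cls R Y) = cls R (GSet.prod X Y) := by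
  rw [ext, lift₂_cls, IsoClass.map₂_mk, cls]

theorem comp_cls (V : Biset K H) (U : Biset H G) :
    comp (cls R V) (cls R U) = cls R (Biset.comp V U) := by
  rw [comp, lift₂_cls, IsoClass.map₂_mk, cls]

/-- The action of bisets on the Burnside functor: `RB(H, G) × RB(G) → RB(H)` sends the classes of
`U` and `X` to the class of `U ×_G X`, where a `G`-set is viewed as a `(G, 1)`-biset. -/
noncomputable def act : RB R (H × G) →ₗ[R] RB R G →ₗ[R] RB R H :=
  (comp.compl₂ (res (MonoidHom.fst G Unit))).compr₂ (res (MonoidHom.inl H Unit))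

/-- The product `RB(H, G) × RB(H', G') → RB(H × H', G × G')` induced by the product of bisets. -/
noncomputable def bisetProd :
    RB R (H × G) →ₗ[R] RB R (H' × G') →ₗ[R] RB R ((H × H') × (G × G')) :=
  ext.compr₂ (res (MulEquiv.prodProdProdComm H H' G G').toMonoidHom)

end RB

/-- The value at `G` of the Yoneda-Dress construction `RB_C` of the Burnside functor. -/
abbrev RBC (R : Type u) [CommRing R] (C G : Type) [Group C] [Group G] : Type u := RB R (G × C)

namespace RBC

variable {R : Type u} [CommRing R] {C : Type} [Group C]
variable {G H K L : Type} [Group G] [Group H] [Group K] [Group L]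

/-- The biset functor structure of `RB_C`: an element `φ` of `RB(H, G)` acts as `φ × C`. -/
noncomputable def map [Finite C] : RB R (H × G) →ₗ[R] RBC R C G →ₗ[R] RBC R C H :=
  RB.act.comp (RB.bisetProd.flip (RB.cls R (Biset.id C)))

/-- The homomorphism `(g, h, c) ↦ (g, c, h, c)`. -/
def diagonal (G H C : Type) [Group G] [Group H] [Group C] : (G × H) × C →* (G × C) × (H × C) where
  toFun a := ((a.1.1, a.2), (a.1.2, a.2))
  map_one' := rfl
  map_mul' _ _ := rfl

/-- The product `RB_C(G) × RB_C(H) → RB_C(G × H)`: the product of the Burnside functor, restricted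
along the diagonal of `C`. -/
noncomputable def mul : RBC R C G →ₗ[R] RBC R C H →ₗ[R] RBC R C (G × H) :=
  RB.ext.compr₂ (RB.res (diagonal G H C))

/-- The identity element `ε` of `RB_C`, in `RB_C(1)`. -/
noncomputable def unit (R : Type u) [CommRing R] (C : Type) [Group C] : RBC R C Unit :=
  RB.cls R (GSet.point (Unit × C))

/-- The composition `RB_C(H × G) × RB_C(G × K) → RB_C(H × K)` of the category associated to the
Green biset functor `RB_C`. -/
noncomputable def comp [Finite C] [Finite H] [Finite G] [Finite K] :
    RBC R C (H × G) →ₗ[R] RBC R C (G × K) →ₗ[R] RBC R C (H × K) :=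
  mul.compr₂ (map (RB.cls R (Biset.contract H G K)))

/-- The image of `ε` under a `(G, H)`-biset `X` viewed as a `(G × H, 1)`-biset. -/
noncomputable def ofBiset (R : Type u) [CommRing R] (C : Type) [Group C] [Finite C]
    (X : Biset G H) : RBC R C (G × H) :=
  map (RB.cls R (GSet.res (MonoidHom.fst (G × H) Unit) X)) (unit R C)

/-- The element of `RB_C(G × H)` attached to a group isomorphism `φ : H → G`. -/
noncomputable def ofIso (R : Type u) [CommRing R] (C : Type) [Group C] [Finite C] [Finite G]
    (φ : H ≃* G) : RBC R C (G × H) := ofBiset R C (Biset.iso φ)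

end RBC

/-! The composition in terms of sets, which is needed to see that the endomorphism algebras of the
category associated to `RB_C` are rings. -/

namespace GSet

variable {C : Type} [Group C]
variable {G H K L : Type} [Group G] [Group H] [Group K] [Group L]

/-- The orbit relation of `G` on `X × Y`. -/
def diagSetoid (X : GSet ((H × G) × C)) (Y : GSet ((G × K) × C)) :
    Setoid (X.carrier × Y.carrier) where
  r p q := ∃ g : G, q.1 = (((1, g), 1) : (H × G) × C) • p.1 ∧
    q.2 = (((g, 1), 1) : (G × K) × C) • p.2
  iseqv :=
    { refl := fun p => ⟨1, (one_smul ((H × G) × C) p.1).symm, (one_smul ((G × K) × C) p.2).symm⟩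
      symm := by
        rintro p q ⟨h, h1, h2⟩
        refine ⟨h⁻¹, ?_, ?_⟩
        · rw [h1, smul_smul]
          simp only [Prod.mk_mul_mk, mul_one, inv_mul_cancel]
          exact (one_smul ((H × G) × C) p.1).symm
        · rw [h2, smul_smul]
          simp only [Prod.mk_mul_mk, mul_one, inv_mul_cancel]
          exact (one_smul ((G × K) × C) p.2).symm
      trans := by
        rintro p q r ⟨h, h1, h2⟩ ⟨k, k1, k2⟩
        refine ⟨k * h, ?_, ?_⟩
        · rw [k1, h1, smul_smul]; simp
        · rw [k2, h2, smul_smul]; simp }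

/-- The set of `G`-orbits on `X × Y`, with the diagonal action of `C`. -/
def diagComp (X : GSet ((H × G) × C)) (Y : GSet ((G × K) × C)) : GSet ((H × K) × C) where
  carrier := Quotient (diagSetoid X Y)
  action :=
    { smul := fun a => Quotient.map
        (fun p => ((((a.1.1, 1), a.2) : (H × G) × C) • p.1,
          (((1, a.1.2), a.2) : (G × K) × C) • p.2)) (by
          rintro p q ⟨h, h1, h2⟩
          refine ⟨h, ?_, ?_⟩
          · simp only [h1, smul_smul]; simp
          · simp only [h2, smul_smul]; simp)
      one_smul := by
        rintro ⟨p⟩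
        exact congrArg (Quotient.mk _)
          (Prod.ext (one_smul ((H × G) × C) p.1) (one_smul ((G × K) × C) p.2))
      mul_smul := by
        rintro a b ⟨p⟩
        refine congrArg (Quotient.mk _) (Prod.ext ?_ ?_)
        · simp only [smul_smul]; simp
        · simp only [smul_smul]; simp }
  finite := Quotient.finite _

/-- The orbit of an element of `X × Y`. -/
def orbit (X : GSet ((H × G) × C)) (Y : GSet ((G × K) × C)) (p : X.carrier × Y.carrier) :
    (diagComp X Y).carrier := Quotient.mk (diagSetoid X Y) p

theorem orbit_surjective (X : GSet ((H × G) × C)) (Y : GSet ((G × K) × C)) :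
    Function.Surjective (orbit X Y) := Quotient.mk_surjective

theorem smul_orbit (X : GSet ((H × G) × C)) (Y : GSet ((G × K) × C)) (h : H) (k : K) (c : C)
    (p : X.carrier × Y.carrier) : (((h, k), c) : (H × K) × C) • orbit X Y p
      = orbit X Y ((((h, 1), c) : (H × G) × C) • p.1, (((1, k), c) : (G × K) × C) • p.2) := rfl

theorem orbit_eq_orbit {X : GSet ((H × G) × C)} {Y : GSet ((G × K) × C)}
    {p q : X.carrier × Y.carrier} : orbit X Y p = orbit X Y q ↔
      ∃ g : G, q.1 = (((1, g), 1) : (H × G) × C) • p.1 ∧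
        q.2 = (((g, 1), 1) : (G × K) × C) • p.2 := Quotient.eq

theorem one_one_one_smul (X : GSet ((H × G) × C)) (x : X.carrier) :
    (((1, 1), 1) : (H × G) × C) • x = x := one_smul _ x

theorem diagComp_assoc (X : GSet ((H × G) × C)) (Y : GSet ((G × K) × C))
    (Z : GSet ((K × L) × C)) :
    (diagComp (diagComp X Y) Z).Iso (diagComp X (diagComp Y Z)) := by
  refine iso_of_span (W := X.carrier × Y.carrier × Z.carrier)
    (fun w => orbit (diagComp X Y) Z (orbit X Y (w.1, w.2.1), w.2.2))
    (fun w => orbit X (diagComp Y Z) (w.1, orbit Y Z w.2)) ?_ ?_ ?_ ?_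
  · intro a
    obtain ⟨⟨b, z⟩, rfl⟩ := orbit_surjective _ _ a
    obtain ⟨⟨x, y⟩, rfl⟩ := orbit_surjective _ _ b
    exact ⟨(x, y, z), rfl⟩
  · intro a
    obtain ⟨⟨x, b⟩, rfl⟩ := orbit_surjective _ _ a
    obtain ⟨⟨y, z⟩, rfl⟩ := orbit_surjective _ _ b
    exact ⟨(x, y, z), rfl⟩
  · rintro ⟨x, y, z⟩ ⟨x', y', z'⟩
    simp only [orbit_eq_orbit, smul_orbit, one_one_one_smul]
    constructor
    · rintro ⟨k, ⟨g, hx, hy⟩, hz⟩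
      refine ⟨g⁻¹, ?_, k⁻¹, ?_, ?_⟩
      · rw [hx, smul_smul]
        simp [one_one_one_smul]
      · have hy' := congrArg (fun t => (((g⁻¹, k⁻¹), 1) : (G × K) × C) • t) hy
        simpa [smul_smul, one_one_one_smul] using hy'
      · rw [hz, smul_smul]
        simp [one_one_one_smul]
    · rintro ⟨g, hx, k, hy, hz⟩
      refine ⟨k⁻¹, ⟨g⁻¹, ?_, ?_⟩, ?_⟩
      · rw [hx, smul_smul]
        simp [one_one_one_smul]
      · have hy' := congrArg (fun t => (((g⁻¹, k⁻¹), 1) : (G × K) × C) • t) hy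
        simpa [smul_smul, one_one_one_smul] using hy'
      · rw [hz, smul_smul]
        simp [one_one_one_smul]
  · rintro ⟨⟨h, l⟩, c⟩ ⟨x, y, z⟩
    refine ⟨((((h, 1), c) : (H × G) × C) • x, (((1, 1), c) : (G × K) × C) • y,
      (((1, l), c) : (K × L) × C) • z), ?_, ?_⟩
    · rfl
    · rfl

end GSet

namespace RBC

variable {R : Type u} [CommRing R] {C : Type} [Group C]
variable {G H K L : Type} [Group G] [Group H] [Group K] [Group L]

theorem map_cls [Finite C] (U : Biset H G) (X : GSet (G × C)) :
    map (RB.cls R U) (RB.cls R X) = RB.cls R (GSet.res (MonoidHom.inl (H × C) Unit)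
      (Biset.comp (GSet.res (MulEquiv.prodProdProdComm H C G C).toMonoidHom
        (GSet.prod U (Biset.id C))) (GSet.res (MonoidHom.fst (G × C) Unit) X))) := by
  simp only [map, RB.act, RB.bisetProd, LinearMap.comp_apply, LinearMap.flip_apply,
    LinearMap.compr₂_apply, LinearMap.compl₂_apply, RB.res_cls, RB.ext_cls, RB.comp_cls]

theorem mul_cls (X : GSet (G × C)) (Y : GSet (H × C)) :
    mul (RB.cls R X) (RB.cls R Y) = RB.cls R (GSet.res (diagonal G H C) (GSet.prod X Y)) := by
  simp only [mul, LinearMap.compr₂_apply, RB.res_cls, RB.ext_cls]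

theorem comp_cls [Finite C] [Finite H] [Finite G] [Finite K]
    (X : GSet ((H × G) × C)) (Y : GSet ((G × K) × C)) :
    comp (RB.cls R X) (RB.cls R Y) = RB.cls R (GSet.diagComp X Y) := by
  rw [comp, LinearMap.compr₂_apply, mul_cls, map_cls]
  apply RB.cls_congr
  refine GSet.iso_of_span
    (W := ((H × G × K) × C) × (X.carrier × Y.carrier))
    (fun w => Biset.pair (GSet.res (MulEquiv.prodProdProdComm (H × K) C ((H × G) × (G × K)) C).toMonoidHom
        (GSet.prod (Biset.contract H G K) (Biset.id C)))
        (GSet.res (MonoidHom.fst (((H × G) × (G × K)) × C) Unit)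
          (GSet.res (diagonal (H × G) (G × K) C) (GSet.prod X Y))) w)
    (fun w => GSet.orbit X Y ((((w.1.1.1, 1), w.1.2) : (H × G) × C) • w.2.1,
      (((w.1.1.2.1, w.1.1.2.2), w.1.2) : (G × K) × C) • w.2.2))
    (Biset.pair_surjective _ _) ?_ ?_ ?_
  · intro p
    obtain ⟨⟨x, y⟩, rfl⟩ := GSet.orbit_surjective _ _ p
    exact ⟨(((1, 1, 1), 1), (x, y)), by simp only [GSet.one_one_one_smul]⟩
  · rintro ⟨⟨⟨x, y, z⟩, c⟩, a, b⟩ ⟨⟨⟨x', y', z'⟩, c'⟩, a', b'⟩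
    refine Biset.pair_eq_pair.trans (Iff.trans ?_ GSet.orbit_eq_orbit.symm)
    constructor
    · rintro ⟨⟨⟨⟨h, g⟩, ⟨g', k⟩⟩, d⟩, h1, h2⟩
      have e1 : ((x', y', z'), c') = ((1 * x * h⁻¹, g * y * g'⁻¹, 1 * z * k⁻¹), 1 * c * d⁻¹) := h1
      have e2 : (a', b') = ((((h, g), d) : (H × G) × C) • a, (((g', k), d) : (G × K) × C) • b) := h2
      simp only [Prod.mk.injEq] at e1 e2
      obtain ⟨⟨rfl, rfl, rfl⟩, rfl⟩ := e1
      obtain ⟨rfl, rfl⟩ := e2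
      refine ⟨g, ?_, ?_⟩ <;> simp [smul_smul]
    · rintro ⟨g, h1, h2⟩
      have h1' := congrArg (fun t => (((x'⁻¹, 1), c'⁻¹) : (H × G) × C) • t) h1
      have h2' := congrArg (fun t => (((y'⁻¹, z'⁻¹), c'⁻¹) : (G × K) × C) • t) h2
      simp [smul_smul, GSet.one_one_one_smul] at h1' h2'
      refine ⟨(((x'⁻¹ * x, g), (y'⁻¹ * (g * y), z'⁻¹ * z)), c'⁻¹ * c), ?_, ?_⟩
      · show ((x', y', z'), c') = ((1 * x * (x'⁻¹ * x)⁻¹, g * y * (y'⁻¹ * (g * y))⁻¹,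
          1 * z * (z'⁻¹ * z)⁻¹), 1 * c * (c'⁻¹ * c)⁻¹)
        simp [mul_assoc]
      · exact Prod.ext h1' h2'
  · rintro ⟨⟨h, k⟩, c⟩ ⟨⟨⟨x, y, z⟩, d⟩, a, b⟩
    refine ⟨(((h * x, y, k * z), c * d), (a, b)), ?_, ?_⟩
    · refine congrArg (Biset.pair _ _) (Prod.ext (Prod.ext (Prod.ext ?_ (Prod.ext ?_ ?_)) ?_)
        (Prod.ext ?_ ?_))
      · show h * x = h * x * 1⁻¹
        simp
      · show y = 1 * y * 1⁻¹
        simp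
      · show k * z = k * z * 1⁻¹
        simp
      · show c * d = c * d * 1⁻¹
        simp
      · exact (one_smul _ a).symm
      · exact (one_smul _ b).symm
    · simp [GSet.smul_orbit, smul_smul]

theorem ofBiset_eq [Finite C] (X : Biset G H) :
    ofBiset R C X = RB.cls R (GSet.res (MonoidHom.fst (G × H) C) X) := by
  rw [ofBiset, unit, map_cls]
  apply RB.cls_congr
  refine GSet.iso_of_span (W := (X.carrier × C) × Unit) (Biset.pair
      (GSet.res (MulEquiv.prodProdProdComm (G × H) C Unit C).toMonoidHom
        (GSet.prod (GSet.res (MonoidHom.fst (G × H) Unit) X) (Biset.id C)))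
      (GSet.res (MonoidHom.fst (Unit × C) Unit) (GSet.point (Unit × C))))
    (fun w => w.1.1) (Biset.pair_surjective _ _) (fun x => ⟨((x, 1), ()), rfl⟩) ?_ ?_
  · rintro ⟨⟨x, c⟩, ⟨⟩⟩ ⟨⟨x', c'⟩, ⟨⟩⟩
    refine Biset.pair_eq_pair.trans ?_
    constructor
    · rintro ⟨⟨⟨⟩, d⟩, h1, -⟩
      have e1 : (x', c') = ((1 : G × H) • x, 1 * c * d⁻¹) := h1
      rw [one_smul, Prod.mk.injEq] at e1
      exact e1.1.symm
    · intro h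
      have h' : x = x' := h
      subst h'
      refine ⟨((), c'⁻¹ * c), ?_, rfl⟩
      show (x, c') = ((1 : G × H) • x, 1 * c * (c'⁻¹ * c)⁻¹)
      simp
  · rintro ⟨g, c⟩ ⟨⟨x, d⟩, ⟨⟩⟩
    refine ⟨((g • x, c * d), ()), ?_, rfl⟩
    refine congrArg (Biset.pair _ _) (Prod.ext (Prod.ext rfl ?_) rfl)
    show c * d = c * d * 1⁻¹
    simp

theorem comp_assoc [Finite C] [Finite G] [Finite H] [Finite K] [Finite L]
    (a : RBC R C (H × G)) (b : RBC R C (G × K)) (c : RBC R C (K × L)) :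
    comp (comp a b) c = comp a (comp b c) := by
  have h : (comp (R := R) (C := C) (H := H) (G := G) (K := K)).compr₂ comp
      = (LinearMap.llcomp R (RBC R C (K × L)) (RBC R C (G × L)) (RBC R C (H × L)) ∘ₗ
          comp).compl₂ comp := by
    refine RB.hom_ext₂ fun X Y => RB.hom_ext fun Z => ?_
    simp only [LinearMap.compr₂_apply, LinearMap.compl₂_apply, LinearMap.comp_apply,
      LinearMap.llcomp_apply, comp_cls]
    exact RB.cls_congr (GSet.diagComp_assoc X Y Z)
  exact LinearMap.congr_fun (LinearMap.congr_fun (LinearMap.congr_fun h a) b) c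

/-- Left composition with the element attached to `φ` amounts to transport of structure. -/
theorem ofIso_comp [Finite C] [Finite G] [Finite L] [Finite K] (φ : G ≃* L)
    (a : RBC R C (G × K)) :
    comp (ofIso R C φ) a =
      RB.res ((φ.symm.toMonoidHom.prodMap (MonoidHom.id K)).prodMap (MonoidHom.id C)) a := by
  refine LinearMap.congr_fun (RB.hom_ext fun Y => ?_) a
  rw [ofIso, ofBiset_eq, comp_cls, RB.res_cls]
  apply RB.cls_congr
  refine GSet.iso_of_span (W := L × Y.carrier)
    (GSet.orbit (GSet.res (MonoidHom.fst (L × G) C) (Biset.iso φ)) Y)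
    (fun w => (((φ.symm w.1, 1), 1) : (G × K) × C) • w.2) (GSet.orbit_surjective _ _) ?_ ?_ ?_
  · intro y
    refine ⟨(1, y), ?_⟩
    show (((φ.symm 1, 1), 1) : (G × K) × C) • (show Y.carrier from y) = y
    rw [map_one]
    exact GSet.one_one_one_smul Y y
  · rintro ⟨l, y⟩ ⟨l', y'⟩
    refine GSet.orbit_eq_orbit.trans ?_
    constructor
    · rintro ⟨g, h1, h2⟩
      have e1 : l' = 1 * l * (φ g)⁻¹ := h1
      have e2 : y' = (((g, 1), 1) : (G × K) × C) • y := h2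
      subst e1 e2
      show (((φ.symm l, 1), 1) : (G × K) × C) • y
        = (((φ.symm (1 * l * (φ g)⁻¹), 1), 1) : (G × K) × C) • (((g, 1), 1) : (G × K) × C) • y
      simp [smul_smul]
    · intro h
      have h0 : (((φ.symm l, 1), 1) : (G × K) × C) • y
        = (((φ.symm l', 1), 1) : (G × K) × C) • y' := h
      have h' := congrArg (fun t => (((φ.symm l'⁻¹, 1), 1) : (G × K) × C) • t) h0
      simp [smul_smul, GSet.one_one_one_smul] at h'
      refine ⟨φ.symm (l'⁻¹ * l), ?_, ?_⟩
      · show l' = 1 * l * (φ (φ.symm (l'⁻¹ * l)))⁻¹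
        simp
      · simp [h']
  · rintro ⟨⟨m, k⟩, c⟩ ⟨l, y⟩
    refine ⟨(m * l, (((1, k), c) : (G × K) × C) • y), ?_, ?_⟩
    · refine congrArg (GSet.orbit _ _) (Prod.ext ?_ rfl)
      show m * l = m * l * (φ 1)⁻¹
      simp
    · show (((φ.symm (m * l), 1), 1) : (G × K) × C) • (((1, k), c) : (G × K) × C) • y
        = (((φ.symm m, k), c) : (G × K) × C) • (((φ.symm l, 1), 1) : (G × K) × C) • y
      simp [smul_smul]

theorem comp_ofIso_refl [Finite C] [Finite G] [Finite H] (a : RBC R C (H × G)) :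
    comp a (ofIso R C (MulEquiv.refl G)) = a := by
  have h : (comp (R := R) (C := C) (H := H) (G := G) (K := G)).flip
      (ofIso R C (MulEquiv.refl G)) = LinearMap.id := by
    refine RB.hom_ext fun X => ?_
    rw [LinearMap.flip_apply, ofIso, ofBiset_eq, comp_cls, LinearMap.id_apply]
    apply RB.cls_congr
    refine GSet.iso_of_span (W := X.carrier × G)
      (GSet.orbit X (GSet.res (MonoidHom.fst (G × G) C) (Biset.iso (MulEquiv.refl G))))
      (fun w => (((1, w.2⁻¹), 1) : (H × G) × C) • w.1) (GSet.orbit_surjective _ _) ?_ ?_ ?_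
    · intro x
      exact ⟨(x, 1), by simp [GSet.one_one_one_smul]⟩
    · rintro ⟨x, l⟩ ⟨x', l'⟩
      refine GSet.orbit_eq_orbit.trans ?_
      constructor
      · rintro ⟨g, h1, h2⟩
        have e1 : x' = (((1, g), 1) : (H × G) × C) • x := h1
        have e2 : l' = g * l * 1⁻¹ := h2
        subst e1 e2
        simp [smul_smul]
      · intro h
        have h' := congrArg (fun t => (((1, l'), 1) : (H × G) × C) • t) h
        simp [smul_smul, GSet.one_one_one_smul] at h'
        refine ⟨l' * l⁻¹, ?_, ?_⟩
        · simp [h']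
        · show l' = (l' * l⁻¹) * l * 1⁻¹
          simp
    · rintro ⟨⟨m, k⟩, c⟩ ⟨x, l⟩
      refine ⟨((((m, 1), c) : (H × G) × C) • x, l * k⁻¹), ?_, ?_⟩
      · refine congrArg (GSet.orbit _ _) (Prod.ext rfl ?_)
        show l * k⁻¹ = 1 * l * k⁻¹
        simp
      · simp [smul_smul]
  exact LinearMap.congr_fun h a

theorem res_id (a : RBC R C G) : RB.res (MonoidHom.id (G × C)) a = a :=
  LinearMap.congr_fun (RB.hom_ext (f := RB.res (MonoidHom.id (G × C))) (g := LinearMap.id)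
    fun X => by rw [RB.res_cls]; rfl) a

theorem ofIso_refl_comp [Finite C] [Finite G] [Finite H] (a : RBC R C (G × H)) :
    comp (ofIso R C (MulEquiv.refl G)) a = a :=
  (ofIso_comp _ _).trans (res_id a)

theorem ofIso_comp_ofIso [Finite C] [Finite G] [Finite H] [Finite L] (φ : G ≃* L) (ψ : H ≃* G) :
    comp (ofIso R C φ) (ofIso R C ψ) = ofIso R C (ψ.trans φ) := by
  rw [ofIso_comp, ofIso, ofIso, ofBiset_eq, ofBiset_eq, RB.res_cls]
  apply RB.cls_congr
  refine ⟨φ.toEquiv, ?_⟩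
  rintro ⟨⟨l, h⟩, c⟩ x
  have key : ∀ y : G, φ (φ.symm l * y * (ψ h)⁻¹) = l * φ y * (φ (ψ h))⁻¹ := fun y => by simp
  exact key x

end RBC

/-- The `R`-module `RB_C(H × H)`, as the endomorphism algebra of `H` in the category associated to
`RB_C`. -/
def EndAlg (R : Type u) [CommRing R] (C H : Type) [Group C] [Group H] : Type u := RBC R C (H × H)

namespace EndAlg

variable (R : Type u) [CommRing R] (C H : Type) [Group C] [Group H]

noncomputable instance : AddCommGroup (EndAlg R C H) :=
  inferInstanceAs (AddCommGroup (RBC R C (H × H)))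

noncomputable instance : Module R (EndAlg R C H) :=
  inferInstanceAs (Module R (RBC R C (H × H)))

variable [Finite C] [Finite H]

/-- The product is the composition `∘`, and the identity is the image of `ε` under the
`(H, H)`-biset `H`. -/
noncomputable instance : Ring (EndAlg R C H) where
  __ := (inferInstance : AddCommGroup (EndAlg R C H))
  mul a b := RBC.comp a b
  one := RBC.ofBiset R C (Biset.id H)
  left_distrib a b c := map_add (RBC.comp a) b c
  right_distrib a b c := (RBC.comp (R := R) (C := C) (H := H) (G := H) (K := H)).map_add₂ a b c
  zero_mul a := (RBC.comp (R := R) (C := C) (H := H) (G := H) (K := H)).map_zero₂ a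
  mul_zero a := map_zero (RBC.comp a)
  mul_assoc a b c := RBC.comp_assoc a b c
  one_mul a := RBC.ofIso_refl_comp a
  mul_one a := RBC.comp_ofIso_refl a

theorem mul_def (a b : EndAlg R C H) : a * b = RBC.comp a b := rfl

/-- The submodule of `RB_C(H × H)` generated by the elements `a ∘ b` with `a` in `RB_C(H × K)` and
`b` in `RB_C(K × H)`, for the groups `K` of order smaller than the order of `H`. -/
noncomputable def factorSubmodule : Submodule R (EndAlg R C H) :=
  Submodule.span R {x | ∃ (K : Type) (_ : Group K) (_ : Finite K), Nat.card K < Nat.card H ∧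
    ∃ (a : RBC R C (H × K)) (b : RBC R C (K × H)), x = RBC.comp a b}

theorem mul_mem_factorSubmodule (c : EndAlg R C H) {x : EndAlg R C H}
    (hx : x ∈ factorSubmodule R C H) : c * x ∈ factorSubmodule R C H := by
  induction hx using Submodule.span_induction with
  | mem x hx =>
    obtain ⟨K, _, _, hK, a, b, rfl⟩ := hx
    exact Submodule.subset_span ⟨K, _, ‹_›, hK, RBC.comp c a, b, (RBC.comp_assoc c a b).symm⟩
  | zero => rw [mul_zero]; exact zero_mem _
  | add x y _ _ hx hy => rw [mul_add]; exact add_mem hx hy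
  | smul r x _ hx =>
    have h : c * r • x = r • (c * x) := map_smul (RBC.comp c) r x
    rw [h]; exact Submodule.smul_mem _ r hx

theorem factorSubmodule_mul_mem (c : EndAlg R C H) {x : EndAlg R C H}
    (hx : x ∈ factorSubmodule R C H) : x * c ∈ factorSubmodule R C H := by
  induction hx using Submodule.span_induction with
  | mem x hx =>
    obtain ⟨K, _, _, hK, a, b, rfl⟩ := hx
    exact Submodule.subset_span ⟨K, _, ‹_›, hK, a, RBC.comp b c, RBC.comp_assoc a b c⟩
  | zero => rw [zero_mul]; exact zero_mem _
  | add x y _ _ hx hy => rw [add_mul]; exact add_mem hx hy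
  | smul r x _ hx =>
    have h : r • x * c = r • (x * c) :=
      (RBC.comp (R := R) (C := C) (H := H) (G := H) (K := H)).map_smul₂ r x c
    rw [h]; exact Submodule.smul_mem _ r hx

/-- The two-sided ideal `I(H)` of `RB_C(H × H)`: the same submodule. -/
noncomputable def factorIdeal : Ideal (EndAlg R C H) where
  carrier := factorSubmodule R C H
  add_mem' := add_mem
  zero_mem' := zero_mem _
  smul_mem' c _ hx := mul_mem_factorSubmodule R C H c hx

instance : (factorIdeal R C H).IsTwoSided :=
  ⟨fun c hx => factorSubmodule_mul_mem R C H c hx⟩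

end EndAlg

/-- The quotient algebra of `RB_C` at `H`, the quotient of `RB_C(H × H)` by `I(H)`. -/
abbrev HatRBC (R : Type u) [CommRing R] (C H : Type) [Group C] [Group H] [Finite C] [Finite H] :
    Type u := EndAlg R C H ⧸ EndAlg.factorIdeal R C H

/-- The class in the quotient algebra of an element of `RB_C(H × H)`. -/
noncomputable def HatRBC.mk {R : Type u} [CommRing R] {C H : Type} [Group C] [Group H] [Finite C] [Finite H]
    (a : RBC R C (H × H)) : HatRBC R C H := Ideal.Quotient.mk (EndAlg.factorIdeal R C H) a

/-- An `RB_C`-module: a biset functor `M` (an `R`-linear functor to `R`-modules from the biset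
category, whose objects are the finite groups and whose morphisms from `G` to `H` are the elements
of `RB(H, G) = RB(H × G)`), with bilinear products `RB_C(G) × M(H) → M(G × H)` that are associative,
unital and functorial. -/
structure RBCModule (R : Type u) [CommRing R] (C : Type) [Group C] [Finite C] where
  obj : ∀ (G : Type) [Group G] [Finite G], Type w
  [addCommGroup : ∀ (G : Type) [Group G] [Finite G], AddCommGroup (obj G)]
  [module : ∀ (G : Type) [Group G] [Finite G], Module R (obj G)]
  map : ∀ {G H : Type} [Group G] [Finite G] [Group H] [Finite H],
    RB R (H × G) →ₗ[R] obj G →ₗ[R] obj H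
  map_id : ∀ {G : Type} [Group G] [Finite G] (m : obj G), map (RB.cls R (Biset.id G)) m = m
  map_comp : ∀ {G H K : Type} [Group G] [Finite G] [Group H] [Finite H] [Group K] [Finite K]
    (β : RB R (K × H)) (α : RB R (H × G)) (m : obj G), map (RB.comp β α) m = map β (map α m)
  mul : ∀ {G H : Type} [Group G] [Finite G] [Group H] [Finite H],
    RBC R C G →ₗ[R] obj H →ₗ[R] obj (G × H)
  mul_assoc : ∀ {G H K : Type} [Group G] [Finite G] [Group H] [Finite H] [Group K] [Finite K]
    (a : RBC R C G) (b : RBC R C H) (m : obj K),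
    mul (RBC.mul a b) m
      = map (RB.cls R (Biset.iso (MulEquiv.prodAssoc (M := G) (N := H) (P := K)).symm))
          (mul a (mul b m))
  unit_mul : ∀ {G : Type} [Group G] [Finite G] (m : obj G),
    map (RB.cls R (Biset.iso (MulEquiv.uniqueProd (M := G) (N := Unit))))
      (mul (RBC.unit R C) m) = m
  map_mul : ∀ {G G' H H' : Type} [Group G] [Finite G] [Group G'] [Finite G'] [Group H] [Finite H]
    [Group H'] [Finite H'] (φ : RB R (G' × G)) (ψ : RB R (H' × H)) (a : RBC R C G) (m : obj H),
    map (RB.bisetProd φ ψ) (mul a m) = mul (RBC.map φ a) (map ψ m)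

attribute [instance] RBCModule.addCommGroup RBCModule.module

namespace RBCModule

variable {R : Type u} [CommRing R] {C : Type} [Group C] [Finite C]

/-- The action `RB_C(G × H) × M(H) → M(G)` that makes `M` a functor on the category associated to
`RB_C`. For `G = H` it is the structure of `RB_C(H × H)`-module of `M(H)`. -/
noncomputable def act (M : RBCModule.{u, w} R C) {G H : Type} [Group G] [Finite G] [Group H]
    [Finite H] : RBC R C (G × H) →ₗ[R] M.obj H →ₗ[R] M.obj G :=
  M.mul.compr₂ (M.map (RB.cls R (Biset.evaluate G H)))

/-- A family of `R`-submodules of the `M(G)` is a submodule of `M` when it is stable under the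
action of bisets and under products with elements of `RB_C`. -/
def IsSubmodule (M : RBCModule.{u, w} R C)
    (T : ∀ (G : Type) [Group G] [Finite G], Submodule R (M.obj G)) : Prop :=
  (∀ (G H : Type) [Group G] [Finite G] [Group H] [Finite H] (φ : RB R (H × G)) (m : M.obj G),
    m ∈ T G → M.map φ m ∈ T H) ∧
  (∀ (G H : Type) [Group G] [Finite G] [Group H] [Finite H] (a : RBC R C G) (m : M.obj H),
    m ∈ T H → M.mul a m ∈ T (G × H))

/-- `M` is simple when it is nonzero and its only submodules are zero and `M`. -/
def IsSimple (M : RBCModule.{u, w} R C) : Prop :=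
  (∃ (G : Type) (_ : Group G) (_ : Finite G), Nontrivial (M.obj G)) ∧
  ∀ T : (∀ (G : Type) [Group G] [Finite G], Submodule R (M.obj G)), M.IsSubmodule T →
    (∀ (G : Type) [Group G] [Finite G], T G = ⊥) ∨ (∀ (G : Type) [Group G] [Finite G], T G = ⊤)

/-- The group `H` is minimal for `M` when `M(H) ≠ 0` and `M(K) = 0` for all groups `K` of order
smaller than the order of `H`. -/
def IsMinimal (M : RBCModule.{u, w} R C) (H : Type) [Group H] [Finite H] : Prop :=
  Nontrivial (M.obj H) ∧
  ∀ (K : Type) [Group K] [Finite K], Nat.card K < Nat.card H → Subsingleton (M.obj K)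

/-- An isomorphism of `RB_C`-modules. -/
structure Iso (M N : RBCModule.{u, w} R C) where
  equiv : ∀ (G : Type) [Group G] [Finite G], M.obj G ≃ₗ[R] N.obj G
  equiv_map : ∀ {G H : Type} [Group G] [Finite G] [Group H] [Finite H] (φ : RB R (H × G))
    (m : M.obj G), equiv H (M.map φ m) = N.map φ (equiv G m)
  equiv_mul : ∀ {G H : Type} [Group G] [Finite G] [Group H] [Finite H] (a : RBC R C G)
    (m : M.obj H), equiv (G × H) (M.mul a m) = N.mul a (equiv H m)

end RBCModule

/-- A simple `RB_C`-module. -/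
structure SimpleRBCModule (R : Type u) [CommRing R] (C : Type) [Group C] [Finite C] where
  toModule : RBCModule.{u, w} R C
  isSimple : toModule.IsSimple

/-- Isomorphism of simple `RB_C`-modules. -/
instance SimpleRBCModule.isoSetoid (R : Type u) [CommRing R] (C : Type) [Group C] [Finite C] :
    Setoid (SimpleRBCModule.{u, w} R C) where
  r S T := Nonempty (S.toModule.Iso T.toModule)
  iseqv :=
    { refl := fun _ => ⟨⟨fun _ _ _ => LinearEquiv.refl R _, fun _ _ => rfl, fun _ _ => rfl⟩⟩
      symm := fun ⟨e⟩ => ⟨⟨fun G _ _ => (e.equiv G).symm,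
        fun φ m => by rw [LinearEquiv.symm_apply_eq, e.equiv_map, LinearEquiv.apply_symm_apply],
        fun a m => by rw [LinearEquiv.symm_apply_eq, e.equiv_mul, LinearEquiv.apply_symm_apply]⟩⟩
      trans := fun ⟨e⟩ ⟨f⟩ => ⟨⟨fun G _ _ => (e.equiv G).trans (f.equiv G),
        fun φ m => by simp only [LinearEquiv.trans_apply, e.equiv_map, f.equiv_map],
        fun a m => by simp only [LinearEquiv.trans_apply, e.equiv_mul, f.equiv_mul]⟩⟩ }

/-- A couple `(H, V)`, where `H` is a finite group and `V` is a simple module over the quotient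
algebra of `RB_C` at `H`. -/
structure RBCSeed (R : Type u) [CommRing R] (C : Type) [Group C] [Finite C] where
  H : Type
  [group : Group H]
  [finite : Finite H]
  V : Type w
  [addCommGroup : AddCommGroup V]
  [module : Module (HatRBC R C H) V]
  [isSimple : IsSimpleModule (HatRBC R C H) V]

attribute [instance] RBCSeed.group RBCSeed.finite RBCSeed.addCommGroup RBCSeed.module
  RBCSeed.isSimple

namespace RBCSeed

variable {R : Type u} [CommRing R] {C : Type} [Group C] [Finite C]

/-- For a group isomorphism `φ : H → G`, the element `α₁ ∘ a ∘ α₂` of `RB_C(G × G)`, where `α₁` and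
`α₂` are attached to `φ` and to `φ⁻¹`. -/
noncomputable def conj {G H : Type} [Group G] [Group H] [Finite G] [Finite H] (φ : H ≃* G)
    (a : RBC R C (H × H)) : RBC R C (G × G) :=
  RBC.comp (RBC.comp (RBC.ofIso R C φ) a) (RBC.ofIso R C φ.symm)

theorem conj_refl {H : Type} [Group H] [Finite H] (a : RBC R C (H × H)) :
    conj (MulEquiv.refl H) a = a := by
  rw [conj, RBC.ofIso_refl_comp]
  exact RBC.comp_ofIso_refl a

theorem conj_conj {G H K : Type} [Group G] [Group H] [Group K] [Finite G] [Finite H] [Finite K]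
    (φ : G ≃* K) (ψ : H ≃* G) (a : RBC R C (H × H)) :
    conj φ (conj ψ a) = conj (ψ.trans φ) a := by
  have h : (ψ.trans φ).symm = φ.symm.trans ψ.symm := rfl
  simp only [conj, h, ← RBC.ofIso_comp_ofIso, RBC.comp_assoc]

/-- The couples `(H, V)` and `(G, W)` are equivalent when there is a group isomorphism `φ : H → G`
such that `V` is isomorphic to `W` with the action of `a` in `RB_C(H × H)` on `w` in `W` given by
`(α₁ ∘ a ∘ α₂) w`. (Additive bijections that commute with this action are `R`-linear.) -/
def Equivalent (X Y : RBCSeed.{u, w} R C) : Prop :=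
  ∃ (φ : X.H ≃* Y.H) (e : X.V ≃+ Y.V), ∀ (a : RBC R C (X.H × X.H)) (v : X.V),
    e (HatRBC.mk a • v) = HatRBC.mk (conj φ a) • e v

instance setoid (R : Type u) [CommRing R] (C : Type) [Group C] [Finite C] :
    Setoid (RBCSeed.{u, w} R C) where
  r := Equivalent
  iseqv :=
    { refl := fun X => ⟨MulEquiv.refl _, AddEquiv.refl _, fun a v => by rw [conj_refl]; rfl⟩
      symm := fun {X Y} ⟨φ, e, h⟩ => ⟨φ.symm, e.symm, fun a v => by
        rw [AddEquiv.symm_apply_eq, h, conj_conj, MulEquiv.symm_trans_self, conj_refl,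
          AddEquiv.apply_symm_apply]⟩
      trans := fun {X Y Z} ⟨φ, e, h⟩ ⟨ψ, f, k⟩ => ⟨φ.trans ψ, e.trans f, fun a v => by
        rw [AddEquiv.trans_apply, h, k, conj_conj, AddEquiv.trans_apply]⟩ }

/-- The simple module `S` belongs to the couple `(H, V)` when `H` is minimal for `S` and `S(H)` is
isomorphic to `V` as an `RB_C(H × H)`-module. -/
def Belongs (X : RBCSeed.{u, w} R C) (S : RBCModule.{u, w} R C) : Prop :=
  S.IsMinimal X.H ∧ ∃ e : S.obj X.H ≃+ X.V,
    ∀ (a : RBC R C (X.H × X.H)) (m : S.obj X.H), e (S.act a m) = HatRBC.mk a • e m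

end RBCSeed

/-!
A module over `RB_C` is the same thing as an `R`-linear functor on the category whose objects are
the finite groups and whose morphisms from `H` to `G` are the elements of `RB_C(G × H)`. In one
direction a morphism acts by `RBCModule.act`; in the other, a biset acts through the morphism
`RBC.ofRB`, and the product with `a` in `RB_C(G)` is the action of the morphism `a × H`, which is
`RBC.adjoin`. The two directions are mutually inverse (`RBCModule.map_eq_act`,
`RBCModule.mul_eq_act`, `RBCModule.exists_of_functor`), because `H` is its own dual: composing the
evaluation biset with the coevaluation biset gives an identity.

With this, the correspondence is the usual one for functor categories. If `H` is minimal for a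
simple module `S`, then morphisms through smaller groups act as zero on `S(H)`, and `S(H)` is a
simple module over the quotient algebra (`RBCModule.IsSimple.hatModule_isSimple`). Conversely, a
couple `(H, V)` gives the subfunctor of `G ↦ Hom(RB_C(H × G), V)` generated by the functions
`y ↦ (y ∘ a) v`. It is simple, its value at `H` is `V`, and it vanishes at the groups smaller than
`H`. Every simple module `S` to which `(H, V)` belongs embeds in this functor of functions by
`s ↦ (y ↦ y s)`, with this image (`RBCSeed.Belongs.iso`).

The prime order of `C` serves to show that the minimal group is unique up to isomorphism
(`RBCModule.IsSimple.nonempty_mulEquiv`). If `G` and `H` are both minimal for `S`, some transitive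
`(G × H × C)`-set acts by a nonzero map, so it does not factor through a smaller group. This forces
its point stabilizers `D` to project onto `G` and onto `H` and to meet each of them trivially. The
kernel of `D → G` then embeds in `C`. If it is trivial, `D → G` and `D → H` are isomorphisms;
otherwise it maps onto `C`, and `D ∩ (G × H)` is the graph of an isomorphism.

Finally, the quotient algebra is not zero because a point of a composition through a group of order
less than that of `H` never has a stabilizer that meets `H × H` exactly in the diagonal. Counting
the orbits with such a stabilizer is a linear form that vanishes on the ideal and takes the value
`1` at the identity.
-/

/-! ### Compositions of the bisets that occur in the products -/

namespace Biset

variable {G H K : Type} [Group G] [Group H] [Group K]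

/-- A composition of bisets is isomorphic to `T` when there is an equivariant map `f` to `T` that is
constant on the `H`-orbits, with a section `s` that meets every orbit. -/
theorem comp_iso_of_section {V : Biset K H} {U : Biset H G} {T : Biset K G}
    (f : V.carrier → U.carrier → T.carrier) (s : T.carrier → V.carrier × U.carrier)
    (hs : ∀ t, f (s t).1 (s t).2 = t)
    (hinv : ∀ (h : H) v u, f (((1, h) : K × H) • v) (((h, 1) : H × G) • u) = f v u)
    (hex : ∀ v u, ∃ h : H, v = ((1, h) : K × H) • (s (f v u)).1 ∧
      u = ((h, 1) : H × G) • (s (f v u)).2)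
    (hact : ∀ (k : K) (g : G) v u,
      f (((k, 1) : K × H) • v) (((1, g) : H × G) • u) = ((k, g) : K × G) • f v u) :
    (comp V U).Iso T := by
  refine GSet.iso_of_span (W := V.carrier × U.carrier) (pair V U) (fun p => f p.1 p.2)
    (pair_surjective _ _) (fun t => ⟨s t, hs t⟩) ?_ ?_
  · rintro ⟨v, u⟩ ⟨v', u'⟩
    constructor
    · intro h
      obtain ⟨h, h1, h2⟩ := pair_eq_pair.1 h
      simp only at h1 h2
      simp only [h1, h2, hinv]
    · intro h
      have h' : f v u = f v' u' := h
      have key : ∀ v u, pair V U (s (f v u)) = pair V U (v, u) := fun v u =>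
        pair_eq_pair.2 (hex v u)
      exact (key v u).symm.trans ((congrArg (fun t => pair V U (s t)) h').trans (key v' u'))
  · rintro ⟨k, g⟩ ⟨v, u⟩
    exact ⟨(((k, 1) : K × H) • v, ((1, g) : H × G) • u), (smul_pair V U k g (v, u)).symm,
      hact k g v u⟩

/-- Composition with the biset of an isomorphism is restriction along it. -/
theorem comp_iso [Finite H] (V : Biset K H) (φ : G ≃* H) :
    (comp V (iso φ)).Iso (GSet.res ((MonoidHom.id K).prodMap φ.toMonoidHom) V) := by
  refine comp_iso_of_section (T := GSet.res ((MonoidHom.id K).prodMap φ.toMonoidHom) V)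
    (fun v (x : H) => ((1, x⁻¹) : K × H) • v) (fun t => (t, (1 : H))) ?_ ?_ ?_ ?_
  · intro t
    change ((1, 1⁻¹) : K × H) • (show V.carrier from t) = t
    rw [inv_one]; exact one_smul _ _
  · intro h v (x : H)
    change ((1, (h * x * (φ 1)⁻¹)⁻¹) : K × H) • ((1, h) : K × H) • v = ((1, x⁻¹) : K × H) • v
    simp [smul_smul]
  · intro v (x : H)
    refine ⟨x, ?_, ?_⟩
    · change v = ((1, x) : K × H) • ((1, x⁻¹) : K × H) • v
      rw [smul_smul]; simp only [Prod.mk_mul_mk, mul_inv_cancel, mul_one]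
      exact (one_smul _ _).symm
    · change x = x * 1 * (φ 1)⁻¹
      simp
  · intro k g v (x : H)
    change ((1, (1 * x * (φ g)⁻¹)⁻¹) : K × H) • ((k, 1) : K × H) • v
      = ((k, φ g) : K × H) • ((1, x⁻¹) : K × H) • v
    simp [smul_smul]

/-- The `((G × H) × H, G)`-biset `G × H`, on which `G` acts on both sides of the first factor and
the two copies of `H` act on the left and on the right of the second one. -/
def coevaluate (G H : Type) [Group G] [Group H] [Finite G] [Finite H] : Biset ((G × H) × H) G where
  carrier := G × H
  action :=
    { smul := fun a x => (a.1.1.1 * x.1 * a.2⁻¹, a.1.1.2 * x.2 * a.1.2⁻¹)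
      one_smul := fun x => show (1 * x.1 * 1⁻¹, 1 * x.2 * 1⁻¹) = x by simp
      mul_smul := fun a b x => by
        refine Prod.ext ?_ ?_
        · show a.1.1.1 * b.1.1.1 * x.1 * (a.2 * b.2)⁻¹ = a.1.1.1 * (b.1.1.1 * x.1 * b.2⁻¹) * a.2⁻¹
          simp [mul_assoc]
        · show a.1.1.2 * b.1.1.2 * x.2 * (a.1.2 * b.1.2)⁻¹
            = a.1.1.2 * (b.1.1.2 * x.2 * b.1.2⁻¹) * a.1.2⁻¹
          simp [mul_assoc] }

/-- The product of an `(H, G)`-biset and an `(H', G')`-biset, as an `(H × H', G × G')`-biset. -/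
def times {G H G' H' : Type} [Group G] [Group H] [Group G'] [Group H'] (U : Biset H G)
    (U' : Biset H' G') : Biset (H × H') (G × G') :=
  GSet.res (MulEquiv.prodProdProdComm H H' G G').toMonoidHom (GSet.prod U U')

/-- The triangle identity that makes `H` its own dual in the biset category. -/
theorem evaluate_comp_coevaluate [Finite G] [Finite H] :
    (comp (evaluate (G × H) H) (times (coevaluate G H) (id H))).Iso (id (G × H)) := by
  refine comp_iso_of_section (V := evaluate (G × H) H) (U := times (coevaluate G H) (id H))
    (T := id (G × H))
    (fun (x : (G × H) × H) (y : (G × H) × H) => (x.1.1 * y.1.1, x.1.2 * (y.1.2 * x.2 * y.2)))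
    (fun (t : G × H) => (((t, (1 : H)) : (G × H) × H), (((1 : G), (1 : H)), (1 : H)))) ?_ ?_ ?_ ?_
  · rintro ⟨x, y⟩
    simp only [mul_one]
    rfl
  · rintro ⟨⟨⟨g, h⟩, h1⟩, h2⟩ ⟨⟨x1, x2⟩, x3⟩ ⟨⟨y1, y2⟩, (y3 : H)⟩
    change (1 * x1 * g⁻¹ * (g * y1 * 1⁻¹),
      1 * x2 * h⁻¹ * (h * y2 * h1⁻¹ * (h1 * x3 * h2⁻¹) * (h2 * y3 * 1⁻¹)))
      = (x1 * y1, x2 * (y2 * x3 * y3))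
    simp [mul_assoc]
  · rintro ⟨⟨x1, x2⟩, x3⟩ ⟨⟨y1, y2⟩, (y3 : H)⟩
    refine ⟨(((y1, y2 * x3 * y3), x3 * y3), y3), ?_, ?_⟩
    · change ((x1, x2), x3) = ((1 * (x1 * y1) * y1⁻¹,
        1 * (x2 * (y2 * x3 * y3)) * (y2 * x3 * y3)⁻¹), x3 * y3 * 1 * y3⁻¹)
      simp [mul_assoc]
    · change ((y1, y2), y3) = ((y1 * 1 * 1⁻¹, y2 * x3 * y3 * 1 * (x3 * y3)⁻¹), y3 * 1 * 1⁻¹)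
      simp [mul_assoc]
  · rintro ⟨k1, k2⟩ ⟨g1, g2⟩ ⟨⟨x1, x2⟩, x3⟩ ⟨⟨y1, y2⟩, (y3 : H)⟩
    change (k1 * x1 * 1⁻¹ * (1 * y1 * g1⁻¹),
      k2 * x2 * 1⁻¹ * (1 * y2 * 1⁻¹ * (1 * x3 * 1⁻¹) * (1 * y3 * g2⁻¹)))
      = (k1 * (x1 * y1) * g1⁻¹, k2 * (x2 * (y2 * x3 * y3)) * g2⁻¹)
    simp [mul_assoc]

/-- Evaluation turns `U`, viewed as an `(H × G, 1)`-biset, back into an `(H, G)`-biset. -/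
theorem evaluate_comp_times_id [Finite G] [Finite H] (U : Biset H G) :
    (comp (evaluate H G) (times (GSet.res (MonoidHom.fst (H × G) Unit) U) (id G))).Iso
      (comp U (iso (MulEquiv.uniqueProd (M := G) (N := Unit)))) := by
  refine GSet.Iso.trans (comp_iso_of_section (V := evaluate H G)
    (U := times (GSet.res (MonoidHom.fst (H × G) Unit) U) (id G))
    (T := GSet.res ((MonoidHom.id H).prodMap
      (MulEquiv.uniqueProd (M := G) (N := Unit)).toMonoidHom) U)
    (fun (x : H × G) (y : U.carrier × G) => ((x.1, (x.2 * y.2)⁻¹) : H × G) • y.1)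
    (fun (t : U.carrier) => (((1 : H), (1 : G)), (t, (1 : G)))) ?_ ?_ ?_ ?_) (comp_iso _ _).symm
  · intro t
    change ((1, (1 * 1)⁻¹) : H × G) • (show U.carrier from t) = t
    simp only [mul_one, inv_one]; exact one_smul _ _
  · rintro ⟨⟨h, g⟩, g'⟩ ⟨x1, x2⟩ ⟨(y1 : U.carrier), (y2 : G)⟩
    change ((1 * x1 * h⁻¹, (g * x2 * g'⁻¹ * (g' * y2 * 1⁻¹))⁻¹) : H × G) • ((h, g) : H × G) • y1
      = ((x1, (x2 * y2)⁻¹) : H × G) • y1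
    simp [smul_smul, mul_assoc]
  · rintro ⟨x1, x2⟩ ⟨(y1 : U.carrier), (y2 : G)⟩
    refine ⟨((x1⁻¹, x2 * y2), y2), ?_, ?_⟩
    · change (x1, x2) = (1 * 1 * x1⁻¹⁻¹, x2 * y2 * 1 * y2⁻¹)
      simp
    · change (y1, y2) = (((x1⁻¹, x2 * y2) : H × G) • ((x1, (x2 * y2)⁻¹) : H × G) • y1, y2 * 1 * 1⁻¹)
      rw [smul_smul]
      simp only [Prod.mk_mul_mk, mul_inv_cancel, inv_mul_cancel]
      refine Prod.ext (one_smul (H × G) y1).symm ?_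
      simp
  · rintro k ⟨⟨⟩, g⟩ ⟨x1, x2⟩ ⟨(y1 : U.carrier), (y2 : G)⟩
    change ((k * x1 * 1⁻¹, (1 * x2 * 1⁻¹ * (1 * y2 * g⁻¹))⁻¹) : H × G) • ((1, 1) : H × G) • y1
      = ((k, g) : H × G) • ((x1, (x2 * y2)⁻¹) : H × G) • y1
    simp [smul_smul, mul_assoc]

/-- The `(H, (H × G) × ((G × K) × K))`-biset `H × G × K`, which performs two evaluations at
once. -/
def contractEvaluate (H G K : Type) [Group H] [Group G] [Group K] [Finite H] [Finite G] [Finite K] :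
    Biset H ((H × G) × ((G × K) × K)) where
  carrier := H × G × K
  action :=
    { smul := fun a x => (a.1 * x.1 * a.2.1.1⁻¹, a.2.1.2 * x.2.1 * a.2.2.1.1⁻¹,
        a.2.2.1.2 * x.2.2 * a.2.2.2⁻¹)
      one_smul := fun x => show (1 * x.1 * 1⁻¹, 1 * x.2.1 * 1⁻¹, 1 * x.2.2 * 1⁻¹) = x by simp
      mul_smul := fun a b x => by
        refine Prod.ext ?_ (Prod.ext ?_ ?_)
        · show a.1 * b.1 * x.1 * (a.2.1.1 * b.2.1.1)⁻¹ = a.1 * (b.1 * x.1 * b.2.1.1⁻¹) * a.2.1.1⁻¹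
          simp [mul_assoc]
        · show a.2.1.2 * b.2.1.2 * x.2.1 * (a.2.2.1.1 * b.2.2.1.1)⁻¹
            = a.2.1.2 * (b.2.1.2 * x.2.1 * b.2.2.1.1⁻¹) * a.2.2.1.1⁻¹
          simp [mul_assoc]
        · show a.2.2.1.2 * b.2.2.1.2 * x.2.2 * (a.2.2.2 * b.2.2.2)⁻¹
            = a.2.2.1.2 * (b.2.2.1.2 * x.2.2 * b.2.2.2⁻¹) * a.2.2.2⁻¹
          simp [mul_assoc] }

theorem evaluate_comp_evaluate [Finite G] [Finite H] [Finite K] :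
    (comp (evaluate H G) (times (id (H × G)) (evaluate G K))).Iso (contractEvaluate H G K) := by
  refine comp_iso_of_section (V := evaluate H G) (U := times (id (H × G)) (evaluate G K))
    (T := contractEvaluate H G K)
    (fun (x : H × G) (y : (H × G) × (G × K)) => (x.1 * y.1.1, y.1.2⁻¹ * x.2 * y.2.1, y.2.2))
    (fun (t : H × G × K) => ((t.1, t.2.1), (((1 : H), (1 : G)), ((1 : G), t.2.2)))) ?_ ?_ ?_ ?_
  · rintro ⟨x, y, z⟩
    simp only [one_mul, mul_one, inv_one]
    rfl
  · rintro ⟨⟨h, g⟩, g'⟩ ⟨x1, x2⟩ ⟨⟨y1, y2⟩, ⟨y3, y4⟩⟩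
    change (1 * x1 * h⁻¹ * (h * y1 * 1⁻¹), (g * y2 * 1⁻¹)⁻¹ * (g * x2 * g'⁻¹) * (g' * y3 * 1⁻¹),
      1 * y4 * 1⁻¹) = (x1 * y1, y2⁻¹ * x2 * y3, y4)
    simp [mul_assoc]
  · rintro ⟨x1, x2⟩ ⟨⟨y1, y2⟩, ⟨y3, y4⟩⟩
    refine ⟨((y1, y2), y3), ?_, ?_⟩
    · change (x1, x2) = (1 * (x1 * y1) * y1⁻¹, y2 * (y2⁻¹ * x2 * y3) * y3⁻¹)
      simp [mul_assoc]
    · change ((y1, y2), (y3, y4)) = ((y1 * 1 * 1⁻¹, y2 * 1 * 1⁻¹), (y3 * 1 * 1⁻¹, 1 * y4 * 1⁻¹))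
      simp
  · rintro k ⟨⟨h, g⟩, ⟨⟨g', l⟩, l'⟩⟩ ⟨x1, x2⟩ ⟨⟨y1, y2⟩, ⟨y3, y4⟩⟩
    change (k * x1 * 1⁻¹ * (1 * y1 * h⁻¹), (1 * y2 * g⁻¹)⁻¹ * (1 * x2 * 1⁻¹) * (1 * y3 * g'⁻¹),
      l * y4 * l'⁻¹) = (k * (x1 * y1) * h⁻¹, g * (y2⁻¹ * x2 * y3) * g'⁻¹, l * y4 * l'⁻¹)
    simp [mul_assoc]

/-- Contracting the two copies of `G` before or after the evaluation at `K` gives the same biset. -/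
theorem evaluate_comp_contract [Finite G] [Finite H] [Finite K] :
    (comp (comp (evaluate H K) (times (contract H G K) (id K)))
      (iso (MulEquiv.prodAssoc (M := H × G) (N := G × K) (P := K)).symm)).Iso
        (contractEvaluate H G K) := by
  have h : (comp (evaluate H K) (times (contract H G K) (id K))).Iso
      (GSet.res ((MonoidHom.id H).prodMap
        (MulEquiv.prodAssoc (M := H × G) (N := G × K) (P := K)).toMonoidHom)
        (contractEvaluate H G K)) := by
    refine comp_iso_of_section (V := evaluate H K) (U := times (contract H G K) (id K))
      (T := GSet.res ((MonoidHom.id H).prodMap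
        (MulEquiv.prodAssoc (M := H × G) (N := G × K) (P := K)).toMonoidHom)
        (contractEvaluate H G K))
      (fun (x : H × K) (y : (H × G × K) × K) =>
        (x.1 * y.1.1, y.1.2.1, y.1.2.2⁻¹ * x.2 * y.2))
      (fun (t : H × G × K) => ((t.1, (1 : K)), (((1 : H), t.2.1, t.2.2⁻¹), (1 : K)))) ?_ ?_ ?_ ?_
    · rintro ⟨x, y, z⟩
      simp only [mul_one, inv_inv]
      rfl
    · rintro ⟨⟨h, k⟩, k'⟩ ⟨x1, x2⟩ ⟨⟨y1, y2, y3⟩, (y4 : K)⟩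
      change (1 * x1 * h⁻¹ * (h * y1 * 1⁻¹), 1 * y2 * 1⁻¹, (k * y3 * 1⁻¹)⁻¹ * (k * x2 * k'⁻¹) *
        (k' * y4 * 1⁻¹)) = (x1 * y1, y2, y3⁻¹ * x2 * y4)
      simp [mul_assoc]
    · rintro ⟨x1, x2⟩ ⟨⟨y1, y2, y3⟩, (y4 : K)⟩
      refine ⟨((y1, x2 * y4), y4), ?_, ?_⟩
      · change (x1, x2) = (1 * (x1 * y1) * y1⁻¹, x2 * y4 * 1 * y4⁻¹)
        simp [mul_assoc]
      · change ((y1, y2, y3), y4) = ((y1 * 1 * 1⁻¹, 1 * y2 * 1⁻¹,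
          x2 * y4 * (y3⁻¹ * x2 * y4)⁻¹ * 1⁻¹), y4 * 1 * 1⁻¹)
        simp [mul_assoc]
    · rintro k ⟨⟨⟨h, g⟩, ⟨g', l⟩⟩, l'⟩ ⟨x1, x2⟩ ⟨⟨y1, y2, y3⟩, (y4 : K)⟩
      change (k * x1 * 1⁻¹ * (1 * y1 * h⁻¹), g * y2 * g'⁻¹, (1 * y3 * l⁻¹)⁻¹ * (1 * x2 * 1⁻¹) *
        (1 * y4 * l'⁻¹)) = (k * (x1 * y1) * h⁻¹, g * y2 * g'⁻¹, l * (y3⁻¹ * x2 * y4) * l'⁻¹)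
      simp [mul_assoc]
  refine (comp_congr h (GSet.Iso.refl _)).trans ((comp_iso _ _).trans ?_)
  exact ⟨Equiv.refl _, fun g x => rfl⟩

end Biset

/-! ### Compositions in the category associated to `RB_C`, in terms of sets -/

namespace GSet

variable {C : Type} [Group C]
variable {G H K L : Type} [Group G] [Group H] [Group K] [Group L]

/-- The analogue of `Biset.comp_iso_of_section` for the composition of sets on which `C` acts. -/
theorem diagComp_iso_of_section {X : GSet ((H × G) × C)} {Y : GSet ((G × K) × C)}
    {T : GSet ((H × K) × C)}
    (f : X.carrier → Y.carrier → T.carrier) (s : T.carrier → X.carrier × Y.carrier)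
    (hs : ∀ t, f (s t).1 (s t).2 = t)
    (hinv : ∀ (g : G) x y,
      f ((((1, g), 1) : (H × G) × C) • x) ((((g, 1), 1) : (G × K) × C) • y) = f x y)
    (hex : ∀ x y, ∃ g : G, x = (((1, g), 1) : (H × G) × C) • (s (f x y)).1 ∧
      y = (((g, 1), 1) : (G × K) × C) • (s (f x y)).2)
    (hact : ∀ (h : H) (k : K) (c : C) x y,
      f ((((h, 1), c) : (H × G) × C) • x) ((((1, k), c) : (G × K) × C) • y)
        = (((h, k), c) : (H × K) × C) • f x y) :
    (diagComp X Y).Iso T := by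
  refine iso_of_span (W := X.carrier × Y.carrier) (orbit X Y) (fun p => f p.1 p.2)
    (orbit_surjective _ _) (fun t => ⟨s t, hs t⟩) ?_ ?_
  · rintro ⟨x, y⟩ ⟨x', y'⟩
    constructor
    · intro h
      obtain ⟨h, h1, h2⟩ := orbit_eq_orbit.1 h
      simp only at h1 h2
      simp only [h1, h2, hinv]
    · intro h
      have h' : f x y = f x' y' := h
      have key : ∀ x y, orbit X Y (s (f x y)) = orbit X Y (x, y) := fun x y =>
        orbit_eq_orbit.2 (hex x y)
      exact (key x y).symm.trans ((congrArg (fun t => orbit X Y (s t)) h').trans (key x' y'))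
  · rintro ⟨⟨h, k⟩, c⟩ ⟨x, y⟩
    exact ⟨((((h, 1), c) : (H × G) × C) • x, (((1, k), c) : (G × K) × C) • y),
      (smul_orbit X Y h k c (x, y)).symm, hact h k c x y⟩

/-- The set `X × H`, for a `(G × C)`-set `X`: the two copies of `H` act on the left and on the right
of the second factor. -/
def adjoin (H : Type) [Group H] [Finite H] (X : GSet (G × C)) : GSet (((G × H) × H) × C) where
  carrier := X.carrier × H
  action :=
    { smul := fun a x => (((a.1.1.1, a.2) : G × C) • x.1, a.1.1.2 * x.2 * a.1.2⁻¹)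
      one_smul := fun x => Prod.ext (one_smul (G × C) x.1) (show 1 * x.2 * 1⁻¹ = x.2 by simp)
      mul_smul := fun a b x => by
        refine Prod.ext (mul_smul ((a.1.1.1, a.2) : G × C) (b.1.1.1, b.2) x.1) ?_
        change a.1.1.2 * b.1.1.2 * x.2 * (a.1.2 * b.1.2)⁻¹
            = a.1.1.2 * (b.1.1.2 * x.2 * b.1.2⁻¹) * a.1.2⁻¹
        simp [mul_assoc] }

/-- The `(H × C)`-set that represents the action of `U × C` on the class of `X`, as spelled out in
`RBC.map_cls`. Its elements are the orbits `[u, c, x]`. -/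
def mapSet [Finite C] (U : Biset H G) (X : GSet (G × C)) : GSet (H × C) :=
  GSet.res (MonoidHom.inl (H × C) Unit)
      (Biset.comp (Biset.times U (Biset.id C)) (GSet.res (MonoidHom.fst (G × C) Unit) X))

/-- The element `[u, c, x]` of `mapSet U X`. -/
def mapPair [Finite C] (U : Biset H G) (X : GSet (G × C)) (w : (U.carrier × C) × X.carrier) :
    (mapSet U X).carrier :=
  Biset.pair (Biset.times U (Biset.id C)) (GSet.res (MonoidHom.fst (G × C) Unit) X) w

theorem mapPair_surjective [Finite C] (U : Biset H G) (X : GSet (G × C)) :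
    Function.Surjective (mapPair U X) := Biset.pair_surjective _ _

theorem mapPair_eq_mapPair [Finite C] {U : Biset H G} {X : GSet (G × C)} {u u' : U.carrier}
    {c c' : C} {x x' : X.carrier} : mapPair U X ((u, c), x) = mapPair U X ((u', c'), x') ↔
      ∃ g : G, u' = ((1, g) : H × G) • u ∧ x' = ((g, c'⁻¹ * c) : G × C) • x := by
  refine Biset.pair_eq_pair.trans ?_
  constructor
  · rintro ⟨⟨g, d⟩, h1, h2⟩
    have e1 : (u', c') = (((1, g) : H × G) • u, 1 * c * d⁻¹) := h1
    have e2 : x' = ((g, d) : G × C) • x := h2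
    simp only [Prod.mk.injEq] at e1
    obtain ⟨rfl, rfl⟩ := e1
    exact ⟨g, rfl, by simpa using e2⟩
  · rintro ⟨g, rfl, rfl⟩
    refine ⟨(g, c'⁻¹ * c), ?_, rfl⟩
    change (((1, g) : H × G) • u, c') = (((1, g) : H × G) • u, 1 * c * (c'⁻¹ * c)⁻¹)
    simp

theorem smul_mapPair [Finite C] (U : Biset H G) (X : GSet (G × C)) (h : H) (d c : C)
    (u : U.carrier) (x : X.carrier) : ((h, d) : H × C) • mapPair U X ((u, c), x)
      = mapPair U X ((((h, 1) : H × G) • u, d * c), x) := by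
  refine congrArg (Biset.pair _ _) (Prod.ext (Prod.ext rfl ?_) ?_)
  · change d * c * 1⁻¹ = d * c
    simp
  · exact one_smul (G × C) x

theorem mapSet_coevaluate [Finite C] [Finite G] [Finite H] (X : GSet (G × C)) :
    (mapSet (Biset.coevaluate G H) X).Iso (adjoin H X) := by
  refine iso_of_span (W := ((G × H) × C) × X.carrier) (mapPair (Biset.coevaluate G H) X)
    (fun w => (((w.1.1.1, w.1.2) : G × C) • w.2, w.1.1.2)) (mapPair_surjective _ _) ?_ ?_ ?_
  · rintro ⟨x, h⟩
    exact ⟨(((1, h), 1), x), Prod.ext (one_smul (G × C) x) rfl⟩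
  · rintro ⟨⟨⟨g, h⟩, c⟩, x⟩ ⟨⟨⟨g', h'⟩, c'⟩, x'⟩
    refine (mapPair_eq_mapPair (U := Biset.coevaluate G H)).trans ?_
    constructor
    · rintro ⟨a, h1, rfl⟩
      have e1 : (g', h') = (1 * g * a⁻¹, 1 * h * 1⁻¹) := h1
      simp only [Prod.mk.injEq] at e1
      obtain ⟨rfl, rfl⟩ := e1
      refine Prod.ext ?_ ?_
      · change ((g, c) : G × C) • x
          = ((1 * g * a⁻¹, c') : G × C) • ((a, c'⁻¹ * c) : G × C) • x
        simp [smul_smul]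
      · change h = 1 * h * 1⁻¹
        simp
    · intro h0
      have h1 : ((g, c) : G × C) • x = ((g', c') : G × C) • x' := congrArg Prod.fst h0
      have h2 : h = h' := congrArg Prod.snd h0
      subst h2
      refine ⟨g'⁻¹ * g, ?_, ?_⟩
      · change (g', h) = (1 * g * (g'⁻¹ * g)⁻¹, 1 * h * 1⁻¹)
        simp
      · have := congrArg (fun t => ((g'⁻¹, c'⁻¹) : G × C) • t) h1
        simp only [smul_smul, Prod.mk_mul_mk, inv_mul_cancel] at this
        exact ((one_smul (G × C) x').symm.trans this.symm)
  · rintro ⟨⟨⟨g, h⟩, h'⟩, c⟩ ⟨⟨⟨a, b⟩, d⟩, x⟩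
    refine ⟨(((g * a, h * b * h'⁻¹), c * d), x), ?_, ?_⟩
    · refine Eq.trans ?_ (smul_mapPair _ _ _ _ _ _ _).symm
      refine congrArg (mapPair _ _) (Prod.ext (Prod.ext (Prod.ext ?_ rfl) rfl) rfl)
      change g * a = g * a * 1⁻¹
      simp
    · refine Prod.ext ?_ rfl
      change ((g * a, c * d) : G × C) • x = ((g, c) : G × C) • ((a, d) : G × C) • x
      rw [smul_smul]; rfl

theorem mapSet_id [Finite C] [Finite G] (X : GSet (G × C)) :
    (mapSet (Biset.id G) X).Iso X := by
  refine iso_of_span (W := (G × C) × X.carrier) (mapPair (Biset.id G) X)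
    (fun w => w.1 • w.2) (mapPair_surjective _ _) ?_ ?_ ?_
  · intro x
    exact ⟨(1, x), one_smul (G × C) x⟩
  · rintro ⟨⟨g, c⟩, x⟩ ⟨⟨g', c'⟩, x'⟩
    refine (mapPair_eq_mapPair (U := Biset.id G)).trans ?_
    constructor
    · rintro ⟨a, h1, rfl⟩
      have e1 : g' = 1 * g * a⁻¹ := h1
      subst e1
      simp [smul_smul]
    · intro h1
      refine ⟨g'⁻¹ * g, ?_, ?_⟩
      · change g' = 1 * g * (g'⁻¹ * g)⁻¹
        simp
      · have := congrArg (fun t => ((g', c') : G × C)⁻¹ • t) h1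
        simp only [smul_smul, inv_mul_cancel, one_smul] at this
        exact this.symm
  · rintro ⟨g, c⟩ ⟨⟨a, d⟩, x⟩
    refine ⟨((g * a, c * d), x), ?_, ?_⟩
    · refine Eq.trans ?_ (smul_mapPair _ _ _ _ _ _ _).symm
      refine congrArg (mapPair _ _) (Prod.ext (Prod.ext ?_ rfl) rfl)
      change g * a = g * a * 1⁻¹
      simp
    · simp [smul_smul]

/-- Taking the product with `X` and evaluating is composing with `X`. -/
theorem evaluate_diagComp_adjoin [Finite G] [Finite H] (X : GSet ((G × H) × C)) :
    (diagComp (res (MonoidHom.fst (G × ((G × H) × H)) C) (Biset.evaluate G H)) (adjoin H X)).Iso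
      X := by
  refine diagComp_iso_of_section
    (X := res (MonoidHom.fst (G × ((G × H) × H)) C) (Biset.evaluate G H)) (Y := adjoin H X) (T := X)
    (fun (x : G × H) (y : X.carrier × H) => (((x.1, (x.2 * y.2)⁻¹), 1) : (G × H) × C) • y.1)
    (fun t => (((1 : G), (1 : H)), (t, (1 : H)))) ?_ ?_ ?_ ?_
  · intro t
    simp only [mul_one, inv_one]; exact one_one_one_smul _ _
  · rintro ⟨⟨g, h⟩, h'⟩ ⟨x1, x2⟩ ⟨y1, y2⟩
    change (((1 * x1 * g⁻¹, (h * x2 * h'⁻¹ * (h' * y2 * 1⁻¹))⁻¹), 1) : (G × H) × C) •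
        (((g, h), 1) : (G × H) × C) • y1 = (((x1, (x2 * y2)⁻¹), 1) : (G × H) × C) • y1
    simp [smul_smul, mul_assoc]
  · rintro ⟨x1, x2⟩ ⟨y1, y2⟩
    refine ⟨((x1⁻¹, x2 * y2), y2), ?_, ?_⟩
    · change (x1, x2) = (1 * 1 * x1⁻¹⁻¹, x2 * y2 * 1 * y2⁻¹)
      simp
    · change (y1, y2) = ((((x1⁻¹, x2 * y2), 1) : (G × H) × C) •
        (((x1, (x2 * y2)⁻¹), 1) : (G × H) × C) • y1, y2 * 1 * 1⁻¹)
      rw [smul_smul]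
      simp only [Prod.mk_mul_mk, mul_inv_cancel, inv_mul_cancel, mul_one]
      exact Prod.ext (one_one_one_smul X y1).symm (by simp)
  · rintro g h c ⟨x1, x2⟩ ⟨y1, y2⟩
    change (((g * x1 * 1⁻¹, (1 * x2 * 1⁻¹ * (1 * y2 * h⁻¹))⁻¹), 1) : (G × H) × C) •
        (((1, 1), c) : (G × H) × C) • y1
      = (((g, h), c) : (G × H) × C) • (((x1, (x2 * y2)⁻¹), 1) : (G × H) × C) • y1
    simp [smul_smul, mul_assoc]

theorem adjoin_prod [Finite K] [Finite H] (X : GSet (G × C)) (Y : GSet (H × C)) :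
    (diagComp (adjoin (H × K) X) (adjoin K Y)).Iso
      (res (((MulEquiv.prodAssoc (M := G) (N := H) (P := K)).symm.toMonoidHom.prodMap
        (MonoidHom.id K)).prodMap (MonoidHom.id C))
          (adjoin K (res (RBC.diagonal G H C) (prod X Y)))) := by
  refine diagComp_iso_of_section
    (X := adjoin (H × K) X) (Y := adjoin K Y)
    (T := res (((MulEquiv.prodAssoc (M := G) (N := H) (P := K)).symm.toMonoidHom.prodMap
        (MonoidHom.id K)).prodMap (MonoidHom.id C))
          (adjoin K (res (RBC.diagonal G H C) (prod X Y))))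
    (fun (x : X.carrier × (H × K)) (y : Y.carrier × K) =>
      ((x.1, ((x.2.1, 1) : H × C) • y.1), x.2.2 * y.2))
    (fun (t : (X.carrier × Y.carrier) × K) =>
      ((t.1.1, ((1 : H), (1 : K))), (t.1.2, t.2))) ?_ ?_ ?_ ?_
  · rintro ⟨⟨x, y⟩, k⟩
    simp only [one_mul]
    exact Prod.ext (Prod.ext rfl (one_smul (H × C) y)) rfl
  · rintro ⟨h, k⟩ ⟨x1, x2, x3⟩ ⟨y1, y2⟩
    refine Prod.ext (Prod.ext (one_smul (G × C) x1) ?_) ?_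
    · change ((1 * x2 * h⁻¹, 1) : H × C) • ((h, 1) : H × C) • y1 = ((x2, 1) : H × C) • y1
      simp [smul_smul]
    · change (1 * x3 * k⁻¹) * (k * y2 * 1⁻¹) = x3 * y2
      simp
  · rintro ⟨x1, x2, x3⟩ ⟨y1, y2⟩
    refine ⟨(x2⁻¹, x3⁻¹), ?_, ?_⟩
    · refine Prod.ext (one_smul (G × C) x1).symm ?_
      change (x2, x3) = (1 * 1 * x2⁻¹⁻¹, 1 * 1 * x3⁻¹⁻¹)
      simp
    · refine Prod.ext ?_ ?_
      · change y1 = ((x2⁻¹, 1) : H × C) • ((x2, 1) : H × C) • y1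
        rw [smul_smul, Prod.mk_mul_mk, inv_mul_cancel, one_mul]
        exact (one_smul (H × C) y1).symm
      · change y2 = x3⁻¹ * (x3 * y2) * 1⁻¹
        simp
  · rintro ⟨g, h, k⟩ k' c ⟨x1, x2, x3⟩ ⟨y1, y2⟩
    refine Prod.ext (Prod.ext rfl ?_) ?_
    · change ((h * x2 * 1⁻¹, 1) : H × C) • ((1, c) : H × C) • y1
        = ((h, c) : H × C) • ((x2, 1) : H × C) • y1
      simp [smul_smul]
    · change k * x3 * 1⁻¹ * (1 * y2 * k'⁻¹) = k * (x3 * y2) * k'⁻¹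
      simp [mul_assoc]

/-- Both sides are quotients of `U × V × X × H`; on the right, the last component is absorbed into
`V`. -/
theorem times_diagComp_adjoin {G' H' : Type} [Group G'] [Group H'] [Finite C] [Finite H]
    [Finite H'] (U : Biset G' G) (V : Biset H' H) (X : GSet (G × C)) :
    (diagComp (res (MonoidHom.fst ((G' × H') × (G × H)) C) (Biset.times U V)) (adjoin H X)).Iso
      (diagComp (adjoin H' (mapSet U X)) (res (MonoidHom.fst (H' × H) C) V)) := by
  refine iso_of_span (W := (U.carrier × V.carrier) × X.carrier × H)
    (orbit (res (MonoidHom.fst ((G' × H') × (G × H)) C) (Biset.times U V)) (adjoin H X))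
    (fun w => orbit (adjoin H' (mapSet U X)) (res (MonoidHom.fst (H' × H) C) V)
      ((mapPair U X ((w.1.1, 1), w.2.1), (1 : H')), ((1, w.2.2⁻¹) : H' × H) • w.1.2))
    (orbit_surjective _ _) ?_ ?_ ?_
  · intro t
    obtain ⟨⟨⟨m, h'⟩, (v : V.carrier)⟩, rfl⟩ := orbit_surjective _ _ t
    obtain ⟨⟨⟨u, c⟩, x⟩, rfl⟩ := mapPair_surjective _ _ m
    refine ⟨((u, ((h', 1) : H' × H) • v), (((1, c) : G × C) • x, 1)), ?_⟩
    refine orbit_eq_orbit.2 ⟨h'⁻¹, Prod.ext ?_ ?_, ?_⟩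
    · refine Eq.trans ?_ (smul_mapPair _ _ _ _ _ _ _).symm
      refine mapPair_eq_mapPair.2 ⟨1, ?_, ?_⟩
      · rfl
      · simp
    · change h' = 1 * 1 * h'⁻¹⁻¹
      simp
    · change v = ((h'⁻¹, 1) : H' × H) • ((1, 1⁻¹) : H' × H) • ((h', 1) : H' × H) • v
      rw [smul_smul, smul_smul]; simp; exact (one_smul (H' × H) v).symm
  · rintro ⟨⟨u, v⟩, x, h⟩ ⟨⟨u', v'⟩, x', h'⟩
    refine orbit_eq_orbit.trans (Iff.trans ?_ orbit_eq_orbit.symm)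
    constructor
    · rintro ⟨⟨g, k⟩, h1, h2⟩
      have e1 : (u', v') = (((1, g) : G' × G) • u, ((1, k) : H' × H) • v) := h1
      have e2 : (x', h') = (((g, 1) : G × C) • x, k * h * 1⁻¹) := h2
      simp only [Prod.mk.injEq] at e1 e2
      obtain ⟨rfl, rfl⟩ := e1
      obtain ⟨rfl, rfl⟩ := e2
      refine ⟨1, Prod.ext ?_ ?_, ?_⟩
      · refine Eq.trans ?_ (smul_mapPair _ _ _ _ _ _ _).symm
        refine (mapPair_eq_mapPair.2 ⟨g, ?_, ?_⟩).symm
        · rw [smul_smul]; simp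
        · simp
      · change (1 : H') = 1 * 1 * 1⁻¹
        simp
      · change ((1, (k * h * 1⁻¹)⁻¹) : H' × H) • ((1, k) : H' × H) • v
          = ((1, 1) : H' × H) • ((1, h⁻¹) : H' × H) • v
        simp [smul_smul]
    · rintro ⟨k, h1, h2⟩
      have e1 := congrArg Prod.fst h1
      have e2 : (1 : H') = 1 * 1 * k⁻¹ := congrArg Prod.snd h1
      have e2' : k = 1 := by simpa using e2
      subst e2'
      have e3 : mapPair U X ((u', 1), x') = mapPair U X ((((1, 1) : G' × G) • u, 1 * 1), x) :=
        e1.trans (smul_mapPair _ _ _ _ _ _ _)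
      obtain ⟨g, h3, h4⟩ := mapPair_eq_mapPair.1 e3.symm
      have e4 : ((1, h'⁻¹) : H' × H) • v' = ((1, 1) : H' × H) • ((1, h⁻¹) : H' × H) • v := h2
      refine ⟨(g, h' * h⁻¹), Prod.ext ?_ ?_, Prod.ext ?_ ?_⟩
      · change u' = ((1, g) : G' × G) • u
        rw [h3, smul_smul]; simp
      · change v' = ((1, h' * h⁻¹) : H' × H) • v
        have := congrArg (fun t => ((1, h') : H' × H) • t) e4
        simp only [smul_smul, Prod.mk_mul_mk, mul_inv_cancel, mul_one, one_mul] at this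
        exact (one_smul (H' × H) v').symm.trans this
      · change x' = ((g, 1) : G × C) • x
        rw [h4]; simp
      · change h' = h' * h⁻¹ * h * 1⁻¹
        simp
  · rintro ⟨⟨⟨g', k'⟩, k⟩, c⟩ ⟨⟨u, v⟩, x, h⟩
    refine ⟨((((g', 1) : G' × G) • u, ((k', 1) : H' × H) • v),
      (((1, c) : G × C) • x, h * k⁻¹)), ?_, ?_⟩
    · refine congrArg (orbit _ _) (Prod.ext rfl (Prod.ext rfl ?_))
      change h * k⁻¹ = 1 * h * k⁻¹
      simp
    · refine orbit_eq_orbit.2 ⟨k'⁻¹, Prod.ext ?_ ?_, ?_⟩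
      · refine (smul_mapPair _ _ _ _ _ _ _).trans (Eq.trans ?_ (smul_mapPair _ _ _ _ _ _ _).symm)
        refine mapPair_eq_mapPair.2 ⟨1, ?_, ?_⟩
        · simp [smul_smul]
        · simp
      · change k' * 1 * 1⁻¹ = 1 * 1 * k'⁻¹⁻¹
        simp
      · change ((1, k) : H' × H) • ((1, h⁻¹) : H' × H) • v
          = ((k'⁻¹, 1) : H' × H) • ((1, (h * k⁻¹)⁻¹) : H' × H) • ((k', 1) : H' × H) • v
        simp [smul_smul]

end GSet

/-! ### Modules as functors on the category associated to `RB_C` -/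

theorem RB.bisetProd_cls {R : Type u} [CommRing R] {G H G' H' : Type} [Group G] [Group H]
    [Group G'] [Group H'] (U : Biset H G) (V : Biset H' G') :
    RB.bisetProd (RB.cls R U) (RB.cls R V) = RB.cls R (Biset.times U V) := by
  rw [RB.bisetProd, LinearMap.compr₂_apply, RB.ext_cls, RB.res_cls, Biset.times]

namespace RBC

variable {R : Type u} [CommRing R] {C : Type} [Group C]
variable {G H K : Type} [Group G] [Group H] [Group K]

/-- The element of `RB_C(H × G)` defined by an element of `RB(H, G)`: the group `C` is made to act
trivially. -/
noncomputable def ofRB : RB R (H × G) →ₗ[R] RBC R C (H × G) := RB.res (MonoidHom.fst (H × G) C)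

theorem ofRB_cls (U : Biset H G) :
    ofRB (R := R) (C := C) (RB.cls R U) = RB.cls R (GSet.res (MonoidHom.fst (H × G) C) U) :=
  RB.res_cls _ _

variable [Finite C]

theorem map_id [Finite G] (a : RBC R C G) : map (RB.cls R (Biset.id G)) a = a := by
  have h : map (RB.cls R (Biset.id G)) = (LinearMap.id : RBC R C G →ₗ[R] _) :=
    RB.hom_ext fun X => (map_cls _ _).trans (RB.cls_congr (GSet.mapSet_id X))
  exact LinearMap.congr_fun h a

theorem ofRB_iso [Finite G] (φ : H ≃* G) : ofRB (RB.cls R (Biset.iso φ)) = ofIso R C φ :=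
  (ofRB_cls _).trans (ofBiset_eq _).symm

theorem ofRB_comp [Finite G] [Finite H] [Finite K] (β : RB R (K × H)) (α : RB R (H × G)) :
    ofRB (C := C) (RB.comp β α) = comp (ofRB β) (ofRB α) := by
  have h : (RB.comp (R := R) (K := K) (H := H) (G := G)).compr₂ (ofRB (C := C))
      = comp.compl₁₂ ofRB ofRB := by
    refine RB.hom_ext₂ fun V U => ?_
    simp only [LinearMap.compr₂_apply, LinearMap.compl₁₂_apply, RB.comp_cls, ofRB_cls, comp_cls]
    refine RB.cls_congr ?_
    refine GSet.iso_of_span (W := V.carrier × U.carrier) (Biset.pair V U)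
      (GSet.orbit (GSet.res (MonoidHom.fst (K × H) C) V) (GSet.res (MonoidHom.fst (H × G) C) U))
      (Biset.pair_surjective _ _) (GSet.orbit_surjective _ _) ?_ ?_
    · intro p q
      exact Biset.pair_eq_pair.trans (GSet.orbit_eq_orbit
        (X := GSet.res (MonoidHom.fst (K × H) C) V)
        (Y := GSet.res (MonoidHom.fst (H × G) C) U)).symm
    · rintro ⟨⟨k, g⟩, c⟩ ⟨v, u⟩
      exact ⟨(((k, 1) : K × H) • v, ((1, g) : H × G) • u), rfl, rfl⟩
  exact LinearMap.congr_fun₂ h β α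

/-- The morphism attached to `φ` is the image of `ε` under `φ`, viewed as an element of
`RB(H × G, 1)`. -/
theorem map_unit (φ : RB R (H × G)) :
    map (RB.res (MonoidHom.fst (H × G) Unit) φ) (unit R C) = ofRB φ := by
  have h : (map.flip (unit R C)).comp (RB.res (MonoidHom.fst (H × G) Unit))
      = ofRB (R := R) (C := C) (H := H) (G := G) := by
    refine RB.hom_ext fun U => ?_
    rw [LinearMap.comp_apply, LinearMap.flip_apply, RB.res_cls, ofRB_cls]
    exact ofBiset_eq U
  exact LinearMap.congr_fun h φ

/-- The map `a ↦ a × H` on `RB_C(G)`, where `H` stands for the identity of `H`. As a morphism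
from `H` to `G × H`, the result acts on `M(H)` as the product with `a` does. -/
noncomputable def adjoin (H : Type) [Group H] [Finite H] [Finite G] :
    RBC R C G →ₗ[R] RBC R C ((G × H) × H) :=
  map (RB.cls R (Biset.coevaluate G H))

theorem adjoin_cls [Finite G] [Finite H] (X : GSet (G × C)) :
    adjoin H (RB.cls R X) = RB.cls R (GSet.adjoin H X) :=
  (map_cls _ _).trans (RB.cls_congr (GSet.mapSet_coevaluate X))

theorem adjoin_mul [Finite G] [Finite H] [Finite K] (a : RBC R C G) (b : RBC R C H) :
    adjoin K (mul a b) = comp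
      (ofRB (RB.cls R (Biset.iso (MulEquiv.prodAssoc (M := G) (N := H) (P := K)).symm)))
      (comp (adjoin (H × K) a) (adjoin K b)) := by
  have h : (mul (R := R) (C := C) (G := G) (H := H)).compr₂ (adjoin K)
      = (comp.compl₁₂ (adjoin (H × K)) (adjoin K)).compr₂
        (comp (ofRB (RB.cls R
          (Biset.iso (MulEquiv.prodAssoc (M := G) (N := H) (P := K)).symm)))) := by
    refine RB.hom_ext₂ fun X Y => ?_
    simp only [LinearMap.compr₂_apply, LinearMap.compl₁₂_apply, ofRB_iso, ofIso_comp, mul_cls,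
      adjoin_cls, comp_cls, RB.res_cls]
    obtain ⟨e, he⟩ := GSet.adjoin_prod (K := K) X Y
    refine RB.cls_congr (GSet.Iso.symm ?_)
    refine (GSet.res_congr _ ⟨e, he⟩).trans ⟨Equiv.refl _, ?_⟩
    rintro ⟨⟨⟨⟨g, h⟩, k⟩, k'⟩, c⟩ x
    rfl
  exact LinearMap.congr_fun₂ h a b

theorem adjoin_unit [Finite G] :
    comp (ofRB (RB.cls R (Biset.iso (MulEquiv.uniqueProd (M := G) (N := Unit)))))
      (adjoin G (unit R C)) = ofRB (RB.cls R (Biset.id G)) := by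
  rw [ofRB_iso, ofIso_comp, unit, adjoin_cls, RB.res_cls, ofRB_cls]
  refine RB.cls_congr ⟨Equiv.uniqueProd G Unit, ?_⟩
  rintro ⟨⟨g, g'⟩, c⟩ ⟨x, y⟩
  rfl

theorem bisetProd_comp_adjoin {G' H' : Type} [Group G'] [Group H'] [Finite G] [Finite H]
    [Finite G'] [Finite H'] (φ : RB R (G' × G)) (ψ : RB R (H' × H)) (a : RBC R C G) :
    comp (ofRB (RB.bisetProd φ ψ)) (adjoin H a) = comp (adjoin H' (map φ a)) (ofRB ψ) := by
  have h : (RB.bisetProd (R := R) (H := G') (G := G) (H' := H') (G' := H)).compr₂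
      ((comp.flip (adjoin H a)).comp ofRB)
      = comp.compl₁₂ ((adjoin H').comp (map.flip a)) ofRB := by
    refine RB.hom_ext₂ fun U V => ?_
    simp only [LinearMap.compr₂_apply, LinearMap.compl₁₂_apply, LinearMap.comp_apply,
      LinearMap.flip_apply, RB.bisetProd, RB.ext_cls, RB.res_cls, ofRB_cls]
    have h' : (comp (RB.cls R (GSet.res (MonoidHom.fst ((G' × H') × (G × H)) C)
          (Biset.times U V)))).comp (adjoin H)
        = (comp.flip (RB.cls R (GSet.res (MonoidHom.fst (H' × H) C) V))).comp
          ((adjoin H').comp (map (RB.cls R U))) := by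
      refine RB.hom_ext fun X => ?_
      simp only [LinearMap.comp_apply, LinearMap.flip_apply, adjoin_cls, map_cls, comp_cls]
      refine RB.cls_congr ((GSet.times_diagComp_adjoin U V X).trans ?_)
      exact GSet.Iso.refl _
    exact LinearMap.congr_fun h' a
  exact LinearMap.congr_fun₂ h φ ψ

theorem evaluate_comp_adjoin [Finite G] [Finite H] (a : RBC R C (G × H)) :
    comp (ofRB (RB.cls R (Biset.evaluate G H))) (adjoin H a) = a := by
  have h : (comp (ofRB (RB.cls R (Biset.evaluate G H)))).comp (adjoin H)
      = (LinearMap.id : RBC R C (G × H) →ₗ[R] _) := by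
    refine RB.hom_ext fun X => ?_
    simp only [LinearMap.comp_apply, ofRB_cls, adjoin_cls, comp_cls, LinearMap.id_apply]
    exact RB.cls_congr (GSet.evaluate_diagComp_adjoin X)
  exact LinearMap.congr_fun h a

/-- The identity of `H` in the category associated to `RB_C`. -/
theorem ofRB_id [Finite H] : ofRB (RB.cls R (Biset.id H)) = ofIso R C (MulEquiv.refl H) :=
  ofRB_iso _

end RBC

namespace RBCModule

variable {R : Type u} [CommRing R] {C : Type} [Group C] [Finite C]
variable {G H K : Type} [Group G] [Group H] [Group K] [Finite G] [Finite H] [Finite K]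
variable (M : RBCModule.{u, w} R C)

theorem act_apply (a : RBC R C (G × H)) (m : M.obj H) :
    M.act a m = M.map (RB.cls R (Biset.evaluate G H)) (M.mul a m) := rfl

theorem map_comp_cls (V : Biset K H) (U : Biset H G) (m : M.obj G) :
    M.map (RB.cls R V) (M.map (RB.cls R U) m) = M.map (RB.cls R (Biset.comp V U)) m := by
  rw [← M.map_comp, RB.comp_cls]

theorem mul_map_left {G' : Type} [Group G'] [Finite G'] (φ : RB R (G' × G)) (a : RBC R C G)
    (m : M.obj H) :
    M.mul (RBC.map φ a) m = M.map (RB.bisetProd φ (RB.cls R (Biset.id H))) (M.mul a m) := by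
  rw [M.map_mul, M.map_id]

/-- The actions of morphisms make `M` a functor on the category associated to `RB_C`. -/
theorem act_comp (a : RBC R C (H × G)) (b : RBC R C (G × K)) (m : M.obj K) :
    M.act (RBC.comp a b) m = M.act a (M.act b m) := by
  have h1 : M.act (RBC.comp a b) m = M.map (RB.cls R (Biset.evaluate H K))
      (M.map (RB.cls R (Biset.times (Biset.contract H G K) (Biset.id K)))
        (M.map (RB.cls R (Biset.iso
          (MulEquiv.prodAssoc (M := H × G) (N := G × K) (P := K)).symm))
            (M.mul a (M.mul b m)))) := by
    rw [act_apply, RBC.comp, LinearMap.compr₂_apply, mul_map_left, RB.bisetProd_cls, M.mul_assoc]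
  have h2 : M.act a (M.act b m) = M.map (RB.cls R (Biset.evaluate H G))
      (M.map (RB.cls R (Biset.times (Biset.id (H × G)) (Biset.evaluate G K)))
        (M.mul a (M.mul b m))) := by
    rw [act_apply, act_apply, ← RB.bisetProd_cls, M.map_mul, RBC.map_id]
  rw [h1, h2, map_comp_cls, map_comp_cls, map_comp_cls]
  rw [RB.cls_congr (Biset.evaluate_comp_contract.trans Biset.evaluate_comp_evaluate.symm)]

theorem map_eq_act (φ : RB R (H × G)) (m : M.obj G) : M.map φ m = M.act (RBC.ofRB φ) m := by
  have h : M.map (G := G) (H := H) = M.act.comp RBC.ofRB := by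
    refine RB.hom_ext fun U => LinearMap.ext fun m => ?_
    rw [LinearMap.comp_apply, ← RBC.map_unit, RB.res_cls, act_apply, mul_map_left, RB.bisetProd_cls,
      map_comp_cls, RB.cls_congr (Biset.evaluate_comp_times_id U), ← map_comp_cls, M.unit_mul]
  exact LinearMap.congr_fun₂ h φ m

theorem mul_eq_act (a : RBC R C G) (m : M.obj H) : M.mul a m = M.act (RBC.adjoin H a) m := by
  rw [act_apply, RBC.adjoin, mul_map_left, RB.bisetProd_cls, map_comp_cls,
    RB.cls_congr Biset.evaluate_comp_coevaluate, M.map_id]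

theorem act_id (m : M.obj H) : M.act (RBC.ofIso R C (MulEquiv.refl H)) m = m := by
  rw [← RBC.ofRB_id, ← map_eq_act, M.map_id]

end RBCModule

/-! ### Submodules and evaluations of simple modules -/

namespace RBCModule

variable {R : Type u} [CommRing R] {C : Type} [Group C] [Finite C]

/-- The submodules of `M` are its subfunctors on the category associated to `RB_C`. -/
theorem isSubmodule_iff (M : RBCModule.{u, w} R C)
    (T : ∀ (G : Type) [Group G] [Finite G], Submodule R (M.obj G)) :
    M.IsSubmodule T ↔ ∀ (G H : Type) [Group G] [Finite G] [Group H] [Finite H]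
      (a : RBC R C (G × H)) (m : M.obj H), m ∈ T H → M.act a m ∈ T G := by
  constructor
  · rintro ⟨h1, h2⟩ G H _ _ _ _ a m hm
    exact h1 _ _ _ _ (h2 _ _ _ _ hm)
  · intro h
    refine ⟨fun G H _ _ _ _ φ m hm => ?_, fun G H _ _ _ _ a m hm => ?_⟩
    · rw [map_eq_act]; exact h _ _ _ _ hm
    · rw [mul_eq_act]; exact h _ _ _ _ hm

theorem Iso.equiv_act {M N : RBCModule.{u, w} R C} (e : M.Iso N) {G H : Type} [Group G] [Finite G]
    [Group H] [Finite H] (a : RBC R C (G × H)) (m : M.obj H) :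
    e.equiv G (M.act a m) = N.act a (e.equiv H m) := by
  rw [act_apply, act_apply, e.equiv_map, e.equiv_mul]

/-- A natural isomorphism of functors on the category associated to `RB_C` is an isomorphism of
`RB_C`-modules. -/
def Iso.ofAct {M N : RBCModule.{u, w} R C}
    (e : ∀ (G : Type) [Group G] [Finite G], M.obj G ≃ₗ[R] N.obj G)
    (he : ∀ {G H : Type} [Group G] [Finite G] [Group H] [Finite H] (a : RBC R C (G × H))
      (m : M.obj H), e G (M.act a m) = N.act a (e H m)) : M.Iso N where
  equiv := e
  equiv_map φ m := by rw [map_eq_act, map_eq_act, he]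
  equiv_mul a m := by rw [mul_eq_act, mul_eq_act, he]

/-- The `RB_C`-module given by an `R`-linear functor on the category associated to `RB_C`. -/
noncomputable def ofFunctor (obj : ∀ (G : Type) [Group G] [Finite G], Type w)
    [∀ (G : Type) [Group G] [Finite G], AddCommGroup (obj G)]
    [∀ (G : Type) [Group G] [Finite G], Module R (obj G)]
    (act : ∀ {G H : Type} [Group G] [Finite G] [Group H] [Finite H],
      RBC R C (G × H) →ₗ[R] obj H →ₗ[R] obj G)
    (act_id : ∀ {G : Type} [Group G] [Finite G] (m : obj G),
      act (RBC.ofIso R C (MulEquiv.refl G)) m = m)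
    (act_comp : ∀ {G H K : Type} [Group G] [Finite G] [Group H] [Finite H] [Group K] [Finite K]
      (a : RBC R C (G × H)) (b : RBC R C (H × K)) (m : obj K),
      act (RBC.comp a b) m = act a (act b m)) : RBCModule.{u, w} R C where
  obj := obj
  map := act.comp RBC.ofRB
  map_id m := by rw [LinearMap.comp_apply, RBC.ofRB_id, act_id]
  map_comp β α m := by simp only [LinearMap.comp_apply, RBC.ofRB_comp, act_comp]
  mul := act.comp (RBC.adjoin _)
  mul_assoc a b m := by simp only [LinearMap.comp_apply, RBC.adjoin_mul, act_comp]
  unit_mul m := by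
    simp only [LinearMap.comp_apply]
    rw [← act_comp, RBC.adjoin_unit, RBC.ofRB_id, act_id]
  map_mul φ ψ a m := by
    simp only [LinearMap.comp_apply]
    rw [← act_comp, RBC.bisetProd_comp_adjoin, act_comp]

/-- Every `R`-linear functor on the category associated to `RB_C` comes from an `RB_C`-module. -/
theorem exists_of_functor (obj : ∀ (G : Type) [Group G] [Finite G], Type w)
    [∀ (G : Type) [Group G] [Finite G], AddCommGroup (obj G)]
    [∀ (G : Type) [Group G] [Finite G], Module R (obj G)]
    (act : ∀ {G H : Type} [Group G] [Finite G] [Group H] [Finite H],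
      RBC R C (G × H) →ₗ[R] obj H →ₗ[R] obj G)
    (act_id : ∀ {G : Type} [Group G] [Finite G] (m : obj G),
      act (RBC.ofIso R C (MulEquiv.refl G)) m = m)
    (act_comp : ∀ {G H K : Type} [Group G] [Finite G] [Group H] [Finite H] [Group K] [Finite K]
      (a : RBC R C (G × H)) (b : RBC R C (H × K)) (m : obj K),
      act (RBC.comp a b) m = act a (act b m)) :
    ∃ (M : RBCModule.{u, w} R C) (e : ∀ (G : Type) [Group G] [Finite G], M.obj G ≃ₗ[R] obj G),
      ∀ {G H : Type} [Group G] [Finite G] [Group H] [Finite H] (a : RBC R C (G × H))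
        (m : M.obj H), e G (M.act a m) = act a (e H m) := by
  refine ⟨ofFunctor obj act act_id act_comp, fun G _ _ => LinearEquiv.refl R (obj G), ?_⟩
  intro G H _ _ _ _ a m
  exact (act_comp _ _ _).symm.trans (by rw [RBC.evaluate_comp_adjoin]; rfl)

variable {M : RBCModule.{u, w} R C}

/-- The values at the groups `G` of the submodule generated by a submodule `W` of `M(H)` are spanned
by the elements `a w`, with `a` in `RB_C(G × H)` and `w` in `W`. -/
theorem isSubmodule_generated {H : Type} [Group H] [Finite H] (W : Submodule R (M.obj H)) :
    M.IsSubmodule fun G _ _ => Submodule.map₂ (M.act (G := G)) ⊤ W := by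
  rw [isSubmodule_iff]
  intro G K _ _ _ _ a m hm
  suffices h : Submodule.map₂ (M.act (G := K)) ⊤ W
      ≤ (Submodule.map₂ (M.act (G := G)) ⊤ W).comap (M.act a) from h hm
  refine Submodule.map₂_le.2 ?_
  intro b _ w hw
  rw [Submodule.mem_comap, ← act_comp]
  exact Submodule.apply_mem_map₂ _ trivial hw

theorem le_generated {H : Type} [Group H] [Finite H] (W : Submodule R (M.obj H)) :
    W ≤ Submodule.map₂ M.act ⊤ W := fun m hm => by
  rw [← M.act_id m]
  exact Submodule.apply_mem_map₂ _ trivial hm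

theorem IsSimple.generated_eq_top (hM : M.IsSimple) {H : Type} [Group H] [Finite H]
    {W : Submodule R (M.obj H)} (hW : W ≠ ⊥) (G : Type) [Group G] [Finite G] :
    Submodule.map₂ (M.act (G := G)) ⊤ W = ⊤ := by
  rcases hM.2 _ (isSubmodule_generated W) with h | h
  · exact absurd (le_bot_iff.1 ((le_generated W).trans_eq (h H))) hW
  · exact h G

/-- An element of a simple module that is annihilated by every morphism to a group at which the
module does not vanish is zero. -/
theorem IsSimple.eq_zero_of_act (hM : M.IsSimple) {H : Type} [Group H] [Finite H]
    [Nontrivial (M.obj H)] {G : Type} [Group G] [Finite G] {m : M.obj G}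
    (hm : ∀ a : RBC R C (H × G), M.act a m = 0) : m = 0 := by
  have hT : M.IsSubmodule fun G _ _ => ⨅ a : RBC R C (H × G), LinearMap.ker (M.act a) := by
    rw [isSubmodule_iff]
    intro G K _ _ _ _ a m hm
    simp only [Submodule.mem_iInf, LinearMap.mem_ker] at hm ⊢
    intro b
    rw [← act_comp, hm]
  rcases hM.2 _ hT with h | h
  · have : m ∈ ⨅ a : RBC R C (H × G), LinearMap.ker (M.act a) := by
      simpa only [Submodule.mem_iInf, LinearMap.mem_ker] using hm
    rw [h G] at this
    exact (Submodule.mem_bot R).1 this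
  · obtain ⟨x, hx⟩ := exists_ne (0 : M.obj H)
    have hx' : x ∈ ⨅ a : RBC R C (H × H), LinearMap.ker (M.act a) := by
      rw [h H]; trivial
    simp only [Submodule.mem_iInf, LinearMap.mem_ker] at hx'
    exact absurd ((M.act_id x).symm.trans (hx' _)) hx

theorem IsSimple.exists_isMinimal (hM : M.IsSimple) :
    ∃ (H : Type) (_ : Group H) (_ : Finite H), M.IsMinimal H := by
  classical
  have h : ∃ n, ∃ (H : Type) (_ : Group H) (_ : Finite H),
      Nontrivial (M.obj H) ∧ Nat.card H = n := by
    obtain ⟨G, i, j, hG⟩ := hM.1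
    exact ⟨_, G, i, j, hG, rfl⟩
  obtain ⟨H, i, j, hH, hn⟩ := Nat.find_spec h
  refine ⟨H, i, j, hH, fun K _ _ hK => ?_⟩
  rw [← not_nontrivial_iff_subsingleton]
  intro hK'
  exact Nat.find_min h (hn ▸ hK) ⟨K, _, ‹_›, hK', rfl⟩

section Evaluation

variable (M) (H : Type) [Group H] [Finite H]

/-- The action of `RB_C(H × H)` on `M(H)`, as a morphism of rings. -/
noncomputable def endHom : EndAlg R C H →+* AddMonoid.End (M.obj H) where
  toFun a := (M.act (G := H) (H := H) a).toAddMonoidHom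
  map_one' := by
    ext m
    change M.act (RBC.ofIso R C (MulEquiv.refl H)) m = m
    exact M.act_id m
  map_mul' a b := by
    ext m
    exact M.act_comp a b m
  map_zero' := by
    ext m
    change M.act 0 m = 0
    rw [map_zero, LinearMap.zero_apply]
  map_add' a b := by
    ext m
    exact LinearMap.map_add₂ M.act a b m

variable {M H}

theorem IsMinimal.endHom_eq_zero (hH : M.IsMinimal H) (a : EndAlg R C H)
    (ha : a ∈ EndAlg.factorIdeal R C H) : M.endHom H a = 0 := by
  ext m
  change M.act (G := H) (H := H) a m = 0
  have ha' : a ∈ EndAlg.factorSubmodule R C H := ha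
  refine Submodule.span_induction ?_ ?_ ?_ ?_ ha'
  · rintro x ⟨K, _, _, hK, b, c, rfl⟩
    have := hH.2 K hK
    rw [act_comp, Subsingleton.elim (M.act c m) 0, map_zero]
  · exact LinearMap.map_zero₂ M.act m
  · intro x y _ _ hx hy
    refine (LinearMap.map_add₂ M.act x y m).trans ?_
    rw [hx, hy, add_zero]
  · intro r x _ hx
    refine (LinearMap.map_smul₂ M.act r x m).trans ?_
    rw [hx, smul_zero]

/-- The evaluation at a minimal group is a module over the quotient algebra. -/
noncomputable abbrev IsMinimal.hatModule (hH : M.IsMinimal H) : Module (HatRBC R C H) (M.obj H) :=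
  Module.compHom (M.obj H)
    (Ideal.Quotient.lift (EndAlg.factorIdeal R C H) (M.endHom H) hH.endHom_eq_zero)

theorem IsMinimal.hatModule_smul (hH : M.IsMinimal H) (a : RBC R C (H × H)) (m : M.obj H) :
    (letI := hH.hatModule; HatRBC.mk a • m) = M.act a m := rfl

theorem IsSimple.hatModule_isSimple (hM : M.IsSimple) (hH : M.IsMinimal H) :
    letI := hH.hatModule
    IsSimpleModule (HatRBC R C H) (M.obj H) := by
  let _ := hH.hatModule
  have := hH.1
  have hr : ∀ (r : R) (m : M.obj H),
      HatRBC.mk (r • RBC.ofIso R C (MulEquiv.refl H)) • m = r • m := fun r m => by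
    refine (hH.hatModule_smul _ m).trans ?_
    rw [LinearMap.map_smul₂, act_id]
  rw [isSimpleModule_iff_toSpanSingleton_surjective]
  refine ⟨inferInstance, fun m hm x => ?_⟩
  have hx : x ∈ Submodule.map₂ (M.act (G := H)) ⊤ (Submodule.span R {m}) := by
    rw [hM.generated_eq_top (by simpa using hm)]; trivial
  rw [← Submodule.span_univ, Submodule.map₂_span_span] at hx
  refine Submodule.span_induction ?_ ?_ ?_ ?_ hx
  · rintro _ ⟨a, -, _, rfl, rfl⟩
    exact ⟨HatRBC.mk a, rfl⟩
  · exact ⟨0, zero_smul _ _⟩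
  · rintro _ _ - - ⟨a, rfl⟩ ⟨b, rfl⟩
    exact ⟨a + b, map_add _ _ _⟩
  · rintro r _ - ⟨a, rfl⟩
    refine ⟨HatRBC.mk (r • RBC.ofIso R C (MulEquiv.refl H)) * a, ?_⟩
    simp only [LinearMap.toSpanSingleton_apply, mul_smul, hr]

/-- The couple `(H, M(H))` for a minimal group `H` of a simple module `M`. -/
noncomputable def IsSimple.seed (hM : M.IsSimple) (hH : M.IsMinimal H) : RBCSeed.{u, w} R C :=
  letI := hH.hatModule
  letI := hM.hatModule_isSimple hH
  { H := H, V := M.obj H }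

theorem IsSimple.seed_belongs (hM : M.IsSimple) (hH : M.IsMinimal H) :
    (hM.seed hH).Belongs M :=
  ⟨hH, AddEquiv.refl (M.obj H), fun _ _ => rfl⟩

end Evaluation

end RBCModule

/-! ### The simple module attached to a couple -/

namespace EndAlg

variable (R : Type u) [CommRing R] (C H : Type) [Group C] [Group H] [Finite C] [Finite H]

/-- The structure morphism of the `R`-algebra `RB_C(H × H)`. -/
noncomputable def scalar : R →+* EndAlg R C H where
  toFun r := r • (1 : EndAlg R C H)
  map_one' := one_smul _ _
  map_mul' r s := by
    have h : r • (1 : EndAlg R C H) * s • (1 : EndAlg R C H)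
        = r • ((1 : EndAlg R C H) * s • (1 : EndAlg R C H)) :=
      LinearMap.map_smul₂ (RBC.comp (R := R) (C := C) (H := H) (G := H) (K := H)) r _ _
    rw [h, one_mul, mul_smul]
  map_zero' := zero_smul _ _
  map_add' r s := add_smul _ _ _

theorem scalar_mul (r : R) (a : EndAlg R C H) : scalar R C H r * a = r • a :=
  (LinearMap.map_smul₂ (RBC.comp (R := R) (C := C) (H := H) (G := H) (K := H)) r _ _).trans
    (congrArg (r • ·) (one_mul a))

theorem mul_scalar (r : R) (a : EndAlg R C H) : a * scalar R C H r = r • a :=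
  ((RBC.comp (R := R) (C := C) (H := H) (G := H) (K := H) a).map_smul r _).trans
    (congrArg (r • ·) (mul_one a))

end EndAlg

namespace RBCSeed

variable {R : Type u} [CommRing R] {C : Type} [Group C] [Finite C]

/-- The `R`-module structure of `V`. -/
noncomputable instance (X : RBCSeed.{u, w} R C) : Module R X.V :=
  Module.compHom X.V ((Ideal.Quotient.mk (EndAlg.factorIdeal R C X.H)).comp
    (EndAlg.scalar R C X.H))

theorem mk_mul (X : RBCSeed.{u, w} R C) (a b : RBC R C (X.H × X.H)) (v : X.V) :
    HatRBC.mk (RBC.comp a b) • v = HatRBC.mk a • HatRBC.mk b • v :=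
  mul_smul (HatRBC.mk a) (HatRBC.mk b) v

theorem mk_id (X : RBCSeed.{u, w} R C) (v : X.V) :
    (HatRBC.mk (RBC.ofIso R C (MulEquiv.refl X.H)) : HatRBC R C X.H) • v = v :=
  one_smul (HatRBC R C X.H) v

theorem mk_smul (X : RBCSeed.{u, w} R C) (r : R) (a : RBC R C (X.H × X.H)) (v : X.V) :
    HatRBC.mk (r • a) • v = r • (HatRBC.mk a • v) := by
  have h : r • a = RBC.comp (EndAlg.scalar R C X.H r) a :=
    (EndAlg.scalar_mul R C X.H r a).symm
  exact (congrArg (fun b => HatRBC.mk b • v) h).trans (X.mk_mul _ _ v)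

theorem mk_smul_smul (X : RBCSeed.{u, w} R C) (r : R) (a : RBC R C (X.H × X.H)) (v : X.V) :
    HatRBC.mk a • (r • v) = r • (HatRBC.mk a • v) := by
  have h : r • a = RBC.comp a (EndAlg.scalar R C X.H r) :=
    (EndAlg.mul_scalar R C X.H r a).symm
  exact ((X.mk_smul r a v).symm.trans ((congrArg (fun b => HatRBC.mk b • v) h).trans
    (X.mk_mul _ _ v))).symm

/-- The action of `RB_C(H × H)` on `V`, as an `R`-bilinear map. -/
noncomputable def action (X : RBCSeed.{u, w} R C) : RBC R C (X.H × X.H) →ₗ[R] X.V →ₗ[R] X.V :=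
  LinearMap.mk₂ R (fun a v => HatRBC.mk a • v)
    (fun a b v => add_smul (HatRBC.mk a) (HatRBC.mk b) v) (fun r a v => X.mk_smul r a v)
    (fun _ _ _ => smul_add _ _ _) (fun r a v => X.mk_smul_smul r a v)

variable (X : RBCSeed.{u, w} R C) {G K : Type} [Group G] [Finite G] [Group K] [Finite K]

/-- The action of a morphism from `K` to `G` on the functor `G ↦ Hom(RB_C(H × G), V)`, by
composition. -/
noncomputable def precomp : RBC R C (G × K) →ₗ[R] (RBC R C (X.H × K) →ₗ[R] X.V) →ₗ[R]
    (RBC R C (X.H × G) →ₗ[R] X.V) :=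
  LinearMap.mk₂ R (fun a f => f.comp (RBC.comp.flip a))
    (fun a b f => by rw [map_add, LinearMap.comp_add])
    (fun r a f => by rw [map_smul, LinearMap.comp_smul])
    (fun a f g => LinearMap.add_comp _ _ _) (fun r a f => LinearMap.smul_comp _ _ _)

theorem precomp_apply (a : RBC R C (G × K)) (f : RBC R C (X.H × K) →ₗ[R] X.V)
    (y : RBC R C (X.H × G)) : X.precomp a f y = f (RBC.comp y a) := rfl

/-- The function `y ↦ (y ∘ a) v` on `RB_C(H × G)`, for `a` in `RB_C(G × H)` and `v` in `V`. -/
noncomputable def elementary : RBC R C (G × X.H) →ₗ[R] X.V →ₗ[R] (RBC R C (X.H × G) →ₗ[R] X.V) :=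
  LinearMap.mk₂ R (fun a v => (X.action.flip v).comp (RBC.comp.flip a))
    (fun a b f => by rw [map_add, LinearMap.comp_add])
    (fun r a f => by rw [map_smul, LinearMap.comp_smul])
    (fun a f g => by rw [map_add, LinearMap.add_comp])
    (fun r a f => by rw [map_smul, LinearMap.smul_comp])

theorem elementary_apply (a : RBC R C (G × X.H)) (v : X.V) (y : RBC R C (X.H × G)) :
    X.elementary a v y = HatRBC.mk (RBC.comp y a) • v := rfl

theorem precomp_elementary (a : RBC R C (G × K)) (b : RBC R C (K × X.H)) (v : X.V) :
    X.precomp a (X.elementary b v) = X.elementary (RBC.comp a b) v :=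
  LinearMap.ext fun y => by
    rw [precomp_apply, elementary_apply, elementary_apply, RBC.comp_assoc]

/-- The value at `G` of the simple module attached to `(H, V)`: the module of functions generated by
the functions `y ↦ (y ∘ a) v`. -/
noncomputable def simpleObj (G : Type) [Group G] [Finite G] :
    Submodule R (RBC R C (X.H × G) →ₗ[R] X.V) :=
  Submodule.map₂ (X.elementary (G := G)) ⊤ ⊤

theorem precomp_mem_simpleObj (a : RBC R C (G × K)) {f : RBC R C (X.H × K) →ₗ[R] X.V}
    (hf : f ∈ X.simpleObj K) : X.precomp a f ∈ X.simpleObj G := by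
  suffices h : X.simpleObj K ≤ (X.simpleObj G).comap (X.precomp a) from h hf
  refine Submodule.map₂_le.2 fun b _ v _ => ?_
  rw [Submodule.mem_comap, precomp_elementary]
  exact Submodule.apply_mem_map₂ _ trivial trivial

/-- The functions in `simpleObj` are linear over `RB_C(H × H)`. -/
theorem apply_comp {f : RBC R C (X.H × G) →ₗ[R] X.V} (hf : f ∈ X.simpleObj G)
    (c : RBC R C (X.H × X.H)) (y : RBC R C (X.H × G)) :
    f (RBC.comp c y) = HatRBC.mk c • f y := by
  suffices h : X.simpleObj G ≤ LinearMap.ker ((LinearMap.lcomp R X.V (RBC.comp c)) -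
      LinearMap.llcomp R _ _ _ (X.action c)) by
    have := LinearMap.congr_fun (LinearMap.mem_ker.1 (h hf)) y
    exact sub_eq_zero.1 this
  refine Submodule.map₂_le.2 fun b _ v _ => LinearMap.mem_ker.2 (LinearMap.ext fun y => ?_)
  change X.elementary b v (RBC.comp c y) - HatRBC.mk c • X.elementary b v y = 0
  rw [elementary_apply, elementary_apply, RBC.comp_assoc, mk_mul, sub_self]

/-- The action of a morphism on the functions in `simpleObj`. -/
noncomputable def simpleAct : RBC R C (G × K) →ₗ[R] X.simpleObj K →ₗ[R] X.simpleObj G :=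
  LinearMap.mk₂ R (fun a f => ⟨X.precomp a f, X.precomp_mem_simpleObj a f.2⟩)
    (fun a b f => Subtype.ext (LinearMap.map_add₂ X.precomp a b f.1))
    (fun r a f => Subtype.ext (LinearMap.map_smul₂ X.precomp r a f.1))
    (fun a f g => Subtype.ext ((X.precomp a).map_add f.1 g.1))
    (fun r a f => Subtype.ext ((X.precomp a).map_smul r f.1))

theorem simpleAct_id (f : X.simpleObj G) :
    X.simpleAct (RBC.ofIso R C (MulEquiv.refl G)) f = f :=
  Subtype.ext (LinearMap.ext fun y => congrArg f.1 (RBC.comp_ofIso_refl y))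

theorem simpleAct_comp {L : Type} [Group L] [Finite L] (a : RBC R C (G × K))
    (b : RBC R C (K × L)) (f : X.simpleObj L) :
    X.simpleAct (RBC.comp a b) f = X.simpleAct a (X.simpleAct b f) :=
  Subtype.ext (LinearMap.ext fun y => congrArg f.1 (RBC.comp_assoc y a b).symm)

theorem exists_simpleModule :
    ∃ (M : RBCModule.{u, max u w} R C)
      (e : ∀ (G : Type) [Group G] [Finite G], M.obj G ≃ₗ[R] X.simpleObj G),
      ∀ {G H : Type} [Group G] [Finite G] [Group H] [Finite H] (a : RBC R C (G × H))
        (m : M.obj H), e G (M.act a m) = X.simpleAct a (e H m) :=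
  RBCModule.exists_of_functor (fun G _ _ => X.simpleObj G) X.simpleAct X.simpleAct_id
    X.simpleAct_comp

/-- The `RB_C`-module attached to `(H, V)`. It is chosen among the modules whose values are the
`simpleObj G`, with `simpleEquiv` for the identification. -/
noncomputable def simpleModule : RBCModule.{u, max u w} R C :=
  X.exists_simpleModule.choose

/-- The values of `simpleModule` as modules of functions. -/
noncomputable def simpleEquiv (G : Type) [Group G] [Finite G] :
    X.simpleModule.obj G ≃ₗ[R] X.simpleObj G :=
  X.exists_simpleModule.choose_spec.choose G

theorem simpleEquiv_act (a : RBC R C (G × K)) (f : X.simpleModule.obj K) :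
    X.simpleEquiv G (X.simpleModule.act a f) = X.simpleAct a (X.simpleEquiv K f) :=
  X.exists_simpleModule.choose_spec.choose_spec a f

/-- The function `y ↦ y v` on `RB_C(H × H)`, for `v` in `V`. -/
noncomputable def generator : X.V →ₗ[R] X.simpleObj X.H :=
  LinearMap.codRestrict (X.simpleObj X.H) (X.elementary (RBC.ofIso R C (MulEquiv.refl X.H)))
    fun _ => Submodule.apply_mem_map₂ _ trivial trivial

theorem simpleAct_generator (a : RBC R C (G × X.H)) (v : X.V) :
    (X.simpleAct a (X.generator v)).1 = X.elementary a v := by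
  refine (X.precomp_elementary a _ v).trans ?_
  rw [RBC.comp_ofIso_refl]

theorem generator_apply (f : X.simpleObj X.H) :
    X.generator (f.1 (RBC.ofIso R C (MulEquiv.refl X.H))) = f := by
  refine Subtype.ext (LinearMap.ext fun y => ?_)
  change HatRBC.mk (RBC.comp y (RBC.ofIso R C (MulEquiv.refl X.H))) •
    f.1 (RBC.ofIso R C (MulEquiv.refl X.H)) = f.1 y
  rw [RBC.comp_ofIso_refl, ← X.apply_comp f.2, RBC.comp_ofIso_refl]

theorem apply_generator (v : X.V) :
    (X.generator v).1 (RBC.ofIso R C (MulEquiv.refl X.H)) = v := by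
  change HatRBC.mk (RBC.comp (RBC.ofIso R C (MulEquiv.refl X.H))
    (RBC.ofIso R C (MulEquiv.refl X.H))) • v = v
  rw [RBC.comp_ofIso_refl, mk_id]

theorem generator_apply_of_act (y : RBC R C (X.H × G)) (f : X.simpleObj G) :
    X.generator (f.1 y) = X.simpleAct y f := by
  rw [← X.generator_apply (X.simpleAct y f)]
  change _ = X.generator (f.1 (RBC.comp (RBC.ofIso R C (MulEquiv.refl X.H)) y))
  rw [RBC.ofIso_refl_comp]

theorem subsingleton_simpleObj (hK : Nat.card K < Nat.card X.H) : Subsingleton (X.simpleObj K) := by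
  have key : X.simpleObj K ≤ ⊥ := by
    refine Submodule.map₂_le.2 fun b _ v _ => (Submodule.mem_bot R).2 (LinearMap.ext fun y => ?_)
    have hy : (HatRBC.mk (RBC.comp y b) : HatRBC R C X.H) = 0 :=
      Ideal.Quotient.eq_zero_iff_mem.2 (Submodule.subset_span ⟨K, _, ‹_›, hK, y, b, rfl⟩)
    rw [elementary_apply, hy, zero_smul, LinearMap.zero_apply]
  exact ⟨fun f g => Subtype.ext (((Submodule.mem_bot R).1 (key f.2)).trans
    ((Submodule.mem_bot R).1 (key g.2)).symm)⟩

theorem simpleModule_isMinimal : X.simpleModule.IsMinimal X.H := by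
  have hV : Nontrivial X.V := IsSimpleModule.nontrivial (HatRBC R C X.H) X.V
  refine ⟨?_, fun K _ _ hK => ?_⟩
  · have hinj : Function.Injective (fun v => (X.simpleEquiv X.H).symm (X.generator v)) :=
      (X.simpleEquiv X.H).symm.injective.comp
        fun v v' h => (X.apply_generator v).symm.trans
          ((congrArg (fun f => f.1 (RBC.ofIso R C (MulEquiv.refl X.H))) h).trans
            (X.apply_generator v'))
    exact hinj.nontrivial
  · have := X.subsingleton_simpleObj hK
    exact (X.simpleEquiv K).toEquiv.subsingleton

/-- The value at `H` of the functor `simpleObj` is `V`. -/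
noncomputable def simpleObjEquiv : X.simpleObj X.H ≃+ X.V where
  toFun f := f.1 (RBC.ofIso R C (MulEquiv.refl X.H))
  invFun := X.generator
  left_inv := X.generator_apply
  right_inv := X.apply_generator
  map_add' _ _ := rfl

theorem simpleObjEquiv_act (a : RBC R C (X.H × X.H)) (f : X.simpleObj X.H) :
    X.simpleObjEquiv (X.simpleAct a f) = HatRBC.mk a • X.simpleObjEquiv f := by
  change f.1 (RBC.comp (RBC.ofIso R C (MulEquiv.refl X.H)) a)
    = HatRBC.mk a • f.1 (RBC.ofIso R C (MulEquiv.refl X.H))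
  rw [← X.apply_comp f.2, RBC.comp_ofIso_refl, RBC.ofIso_refl_comp]

/-- The value at `H` of the module attached to `(H, V)` is `V`. -/
theorem simpleModule_exists_equiv : ∃ e : X.simpleModule.obj X.H ≃+ X.V,
    ∀ (a : RBC R C (X.H × X.H)) (m : X.simpleModule.obj X.H),
      e (X.simpleModule.act a m) = HatRBC.mk a • e m :=
  ⟨(X.simpleEquiv X.H).toAddEquiv.trans X.simpleObjEquiv, fun a f =>
    (congrArg X.simpleObjEquiv (X.simpleEquiv_act a f)).trans (X.simpleObjEquiv_act a _)⟩

/-- The functor `simpleObj` has no proper nonzero subfunctor: if such a subfunctor contains `f` with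
`f y ≠ 0`, it contains the generator given by `f y`, hence those given by all of `V`. -/
theorem simpleObj_eq_top (T : ∀ (G : Type) [Group G] [Finite G], Submodule R (X.simpleObj G))
    (hT : ∀ (G K : Type) [Group G] [Finite G] [Group K] [Finite K] (a : RBC R C (G × K))
      (f : X.simpleObj K), f ∈ T K → X.simpleAct a f ∈ T G)
    {G : Type} [Group G] [Finite G] (hG : T G ≠ ⊥) (K : Type) [Group K] [Finite K] : T K = ⊤ := by
  obtain ⟨f, hf, hf0⟩ := (Submodule.ne_bot_iff _).1 hG
  obtain ⟨y, hy⟩ : ∃ y, f.1 y ≠ 0 := by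
    by_contra! h
    exact hf0 (Subtype.ext (LinearMap.ext h))
  let W : Submodule (HatRBC R C X.H) X.V :=
    { carrier := {v | X.generator v ∈ T X.H}
      add_mem' := fun {v w} hv hw => by
        exact (congrArg (· ∈ T X.H) (map_add X.generator v w)).mpr (add_mem hv hw)
      zero_mem' := (congrArg (· ∈ T X.H) (map_zero X.generator)).mpr (zero_mem _)
      smul_mem' := fun c v hv => by
        obtain ⟨a, rfl⟩ : ∃ a : RBC R C (X.H × X.H), HatRBC.mk a = c :=
          Ideal.Quotient.mk_surjective c
        have h : X.generator (HatRBC.mk a • v) = X.simpleAct a (X.generator v) := by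
          rw [← generator_apply_of_act]
          refine congrArg X.generator ?_
          change _ = HatRBC.mk (RBC.comp a (RBC.ofIso R C (MulEquiv.refl X.H))) • v
          rw [RBC.comp_ofIso_refl]
        exact (congrArg (· ∈ T X.H) h).mpr (hT _ _ a _ hv) }
  have hW : W = ⊤ := by
    refine (eq_bot_or_eq_top W).resolve_left fun hW => hy ?_
    have : f.1 y ∈ W := by
      change X.generator (f.1 y) ∈ T X.H
      rw [generator_apply_of_act]
      exact hT _ _ _ _ hf
    rw [hW] at this
    exact (Submodule.mem_bot _).1 this
  rw [eq_top_iff]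
  rintro g -
  have key : X.simpleObj K ≤ (T K).map (X.simpleObj K).subtype := by
    refine Submodule.map₂_le.2 fun b _ v _ => ?_
    have hv : v ∈ W := hW ▸ trivial
    exact ⟨X.simpleAct b (X.generator v), hT _ _ _ _ hv, X.simpleAct_generator b v⟩
  obtain ⟨g', hg', h⟩ := key g.2
  have : g' = g := Subtype.ext h
  exact this ▸ hg'

theorem simpleModule_isSimple : X.simpleModule.IsSimple := by
  refine ⟨⟨X.H, _, _, X.simpleModule_isMinimal.1⟩, fun T hT => ?_⟩
  rw [RBCModule.isSubmodule_iff] at hT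
  rw [or_iff_not_imp_left]
  intro hne K _ _
  push Not at hne
  obtain ⟨G, _, _, hG⟩ := hne
  have h := X.simpleObj_eq_top (fun G _ _ => (T G).map (X.simpleEquiv G).toLinearMap) ?_
    (G := G) ?_ K
  · exact Submodule.map_injective_of_injective (X.simpleEquiv K).injective
      (h.trans (LinearMap.range_eq_top.2 (X.simpleEquiv K).surjective ▸ Submodule.map_top _).symm)
  · rintro G K _ _ _ _ a _ ⟨f, hf, rfl⟩
    exact ⟨_, hT _ _ a f hf, X.simpleEquiv_act a f⟩
  · intro h
    exact hG (Submodule.map_injective_of_injective (X.simpleEquiv G).injective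
      (h.trans (Submodule.map_bot _).symm))

/-- A simple module is determined by the couple it belongs to. -/
theorem Belongs.iso {X : RBCSeed.{u, max u w} R C} {S : RBCModule.{u, max u w} R C}
    (hX : X.Belongs S) (hS : S.IsSimple) : Nonempty (S.Iso X.simpleModule) := by
  obtain ⟨hmin, e, he⟩ := hX
  have := hmin.1
  let eR : S.obj X.H →ₗ[R] X.V :=
    { toFun := e
      map_add' := e.map_add
      map_smul' := fun r m => by
        have h : r • m = S.act (r • RBC.ofIso R C (MulEquiv.refl X.H)) m := by
          rw [LinearMap.map_smul₂, S.act_id]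
        rw [h, he, mk_smul, mk_id]
        rfl }
  let F : ∀ (G : Type) [Group G] [Finite G], S.obj G →ₗ[R] (RBC R C (X.H × G) →ₗ[R] X.V) :=
    fun G _ _ => (S.act (G := X.H) (H := G)).flip.compr₂ eR
  have hF : ∀ (G : Type) [Group G] [Finite G] (m : S.obj G) (y : RBC R C (X.H × G)),
      F G m y = e (S.act y m) := fun G _ _ m y => rfl
  have hgen : ∀ (G : Type) [Group G] [Finite G] (a : RBC R C (G × X.H)) (m : S.obj X.H),
      F G (S.act a m) = X.elementary a (e m) := fun G _ _ a m =>
    LinearMap.ext fun y => by rw [hF, ← S.act_comp, he, elementary_apply]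
  have hmem : ∀ (G : Type) [Group G] [Finite G] (m : S.obj G), F G m ∈ X.simpleObj G := by
    intro G _ _ m
    suffices h : Submodule.map₂ (S.act (G := G) (H := X.H)) ⊤ ⊤ ≤ (X.simpleObj G).comap (F G) from
      h (by rw [hS.generated_eq_top top_ne_bot]; trivial)
    refine Submodule.map₂_le.2 fun a _ m _ => ?_
    rw [Submodule.mem_comap, hgen]
    exact Submodule.apply_mem_map₂ _ trivial trivial
  let F' : ∀ (G : Type) [Group G] [Finite G], S.obj G →ₗ[R] X.simpleObj G :=
    fun G _ _ => LinearMap.codRestrict _ (F G) (hmem G)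
  have hbij : ∀ (G : Type) [Group G] [Finite G], Function.Bijective (F' G) := by
    intro G _ _
    constructor
    · refine (injective_iff_map_eq_zero (F' G)).2 fun m hm => ?_
      refine hS.eq_zero_of_act (H := X.H) fun y => e.injective ?_
      rw [map_zero]
      exact LinearMap.congr_fun (congrArg Subtype.val hm) y
    · rintro ⟨f, hf⟩
      suffices h : X.simpleObj G ≤ LinearMap.range (F G) by
        obtain ⟨m, hm⟩ := h hf
        exact ⟨m, Subtype.ext hm⟩
      refine Submodule.map₂_le.2 fun a _ v _ => ⟨S.act a (e.symm v), ?_⟩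
      rw [hgen, e.apply_symm_apply]
  refine ⟨RBCModule.Iso.ofAct (N := X.simpleModule)
    (fun G _ _ => (LinearEquiv.ofBijective (F' G) (hbij G)).trans (X.simpleEquiv G).symm) ?_⟩
  intro G K _ _ _ _ a m
  rw [LinearEquiv.trans_apply, LinearEquiv.symm_apply_eq, simpleEquiv_act, LinearEquiv.trans_apply,
    LinearEquiv.apply_symm_apply]
  refine Subtype.ext (LinearMap.ext fun y => ?_)
  change e (S.act y (S.act a m)) = e (S.act (RBC.comp y a) m)
  rw [S.act_comp]

end RBCSeed

/-! ### Uniqueness of the minimal group -/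

namespace GSet

variable {G : Type} [Group G]

/-- A `G`-set is transitive when it is a single orbit (and not empty). -/
def IsTransitive (X : GSet G) : Prop := ∃ x : X.carrier, ∀ y, ∃ g : G, y = g • x

/-- The `G`-set given by a stable subset. -/
def sub (X : GSet G) (s : Set X.carrier) (hs : ∀ (g : G), ∀ x ∈ s, g • x ∈ s) : GSet G where
  carrier := s
  action :=
    { smul := fun g x => ⟨g • x.1, hs g x.1 x.2⟩
      one_smul := fun x => Subtype.ext (one_smul G x.1)
      mul_smul := fun g h x => Subtype.ext (mul_smul g h x.1) }

theorem sum_sub_compl (X : GSet G) (s : Set X.carrier) (hs : ∀ (g : G), ∀ x ∈ s, g • x ∈ s)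
    (hs' : ∀ (g : G), ∀ x ∈ sᶜ, g • x ∈ sᶜ) : (((X.sub s hs).sum (X.sub sᶜ hs'))).Iso X := by
  classical
  refine ⟨Equiv.Set.sumCompl s, ?_⟩
  rintro g (x | x) <;> rfl

end GSet

namespace RB

variable {R : Type u} [CommRing R] {G : Type} [Group G]

theorem cls_sum (X Y : GSet G) : cls R (X.sum Y) = cls R X + cls R Y := by
  rw [cls, ← IsoClass.mk_add_mk, map_add]; rfl

theorem cls_of_isEmpty (X : GSet G) [IsEmpty X.carrier] : cls R X = 0 := by
  have h : X.Iso (GSet.empty G) :=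
    ⟨Equiv.equivOfIsEmpty X.carrier Empty, fun _ x => isEmptyElim x⟩
  rw [cls_congr h, cls, ← IsoClass.zero_def, map_zero]

/-- Linear maps out of the Burnside group are determined by their values on transitive sets. -/
theorem hom_ext_of_isTransitive {P : Type*} [AddCommGroup P] [Module R P] {f g : RB R G →ₗ[R] P}
    (h : ∀ X : GSet G, X.IsTransitive → f (cls R X) = g (cls R X)) : f = g := by
  refine hom_ext fun X => ?_
  induction hn : Nat.card X.carrier using Nat.strong_induction_on generalizing X with
  | _ n ih =>
    subst hn
    rcases isEmpty_or_nonempty X.carrier with hX | ⟨⟨x⟩⟩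
    · rw [cls_of_isEmpty, map_zero, map_zero]
    · have hs : ∀ (g : G), ∀ y ∈ MulAction.orbit G x, g • y ∈ MulAction.orbit G x := by
        rintro g _ ⟨k, rfl⟩
        exact ⟨g * k, mul_smul g k x⟩
      have hs' : ∀ (g : G), ∀ y ∈ (MulAction.orbit G x)ᶜ, g • y ∈ (MulAction.orbit G x)ᶜ := by
        intro g y hy hgy
        have := hs g⁻¹ _ hgy
        rw [inv_smul_smul] at this
        exact hy this
      rw [← cls_congr (X.sum_sub_compl _ hs hs'), cls_sum, map_add, map_add]
      congr 1
      · refine h _ ⟨⟨x, MulAction.mem_orbit_self x⟩, ?_⟩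
        rintro ⟨_, k, rfl⟩
        exact ⟨k, rfl⟩
      · refine ih _ ?_ _ rfl
        change Nat.card ((MulAction.orbit G x)ᶜ : Set X.carrier) < _
        rw [Nat.card_coe_set_eq, ← Set.ncard_univ]
        refine Set.ncard_lt_ncard ?_
        exact Set.ssubset_univ_iff.2 fun h =>
          (h ▸ Set.mem_univ x : x ∈ (MulAction.orbit G x)ᶜ) (MulAction.mem_orbit_self x)

end RB

theorem MonoidHom.nonempty_mulEquiv_of_bijective {E G H : Type*} [Group E] [Group G] [Group H]
    (p : E →* G) (hp : Function.Bijective p) (q : E →* H) (hq : Function.Bijective q) :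
    Nonempty (G ≃* H) :=
  ⟨(MulEquiv.ofBijective p hp).symm.trans (MulEquiv.ofBijective q hq)⟩

/-- Two groups of the same order are isomorphic as soon as, for a group `C` of prime order,
`G × H × C` has a subgroup that projects onto `G` and onto `H` and meets them trivially. Either the
projections of the subgroup to `G` and to `H` are both isomorphisms, or its elements with trivial
last component are the graph of an isomorphism from `G` to `H`. -/
theorem Subgroup.nonempty_mulEquiv_of_prime {C G H : Type*} [Group C] [Group G] [Group H]
    [Finite C] [Finite G] [Finite H] (hC : (Nat.card C).Prime) (hGH : Nat.card G = Nat.card H)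
    (D : Subgroup ((G × H) × C))
    (h1 : ∀ g, ∃ h c, ((g, h), c) ∈ D) (h2 : ∀ h, ∃ g c, ((g, h), c) ∈ D)
    (h3 : ∀ g, ((g, 1), 1) ∈ D → g = 1) (h4 : ∀ h, ((1, h), 1) ∈ D → h = 1) :
    Nonempty (G ≃* H) := by
  by_cases hD : ∃ h c, ((1, h), c) ∈ D ∧ c ≠ 1
  · obtain ⟨k, c, hk, hc⟩ := hD
    have : Fact (Nat.card C).Prime := ⟨hC⟩
    let F : Subgroup (G × H) := D.comap (MonoidHom.inl (G × H) C)
    let p : F →* G := (MonoidHom.fst G H).comp F.subtype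
    let q : F →* H := (MonoidHom.snd G H).comp F.subtype
    have hp : Function.Bijective p := by
      constructor
      · refine (injective_iff_map_eq_one p).2 ?_
        rintro ⟨⟨g, h⟩, hF⟩ hg
        have hg' : g = 1 := hg
        subst hg'
        have := h4 h hF
        subst this
        rfl
      · intro g
        obtain ⟨h, d, hd⟩ := h1 g
        -- `c` generates `C`, so a power of `(1, k, c)` removes the last component.
        obtain ⟨n, rfl⟩ := mem_zpowers_of_prime_card (g := c) (g' := d) rfl hc
        refine ⟨⟨(g, h * (k ^ n)⁻¹), ?_⟩, rfl⟩
        have := D.mul_mem hd (D.inv_mem (D.zpow_mem hk n))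
        simpa [F] using this
    have hq : Function.Injective q := by
      refine (injective_iff_map_eq_one q).2 ?_
      rintro ⟨⟨g, h⟩, hF⟩ hg
      have hg' : h = 1 := hg
      subst hg'
      have := h3 g hF
      subst this
      rfl
    refine MonoidHom.nonempty_mulEquiv_of_bijective p hp q
      ((Nat.bijective_iff_injective_and_card q).2 ⟨hq, ?_⟩)
    rw [← hGH]
    exact Nat.card_congr (Equiv.ofBijective p hp)
  · push Not at hD
    let p : D →* G := (MonoidHom.fst G H).comp ((MonoidHom.fst (G × H) C).comp D.subtype)
    let q : D →* H := (MonoidHom.snd G H).comp ((MonoidHom.fst (G × H) C).comp D.subtype)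
    have hp : Function.Bijective p := by
      constructor
      · refine (injective_iff_map_eq_one p).2 ?_
        rintro ⟨⟨⟨g, h⟩, c⟩, hF⟩ hg
        have hg' : g = 1 := hg
        subst hg'
        have := hD h c hF
        subst this
        have := h4 h hF
        subst this
        rfl
      · intro g
        obtain ⟨h, d, hd⟩ := h1 g
        exact ⟨⟨_, hd⟩, rfl⟩
    have hq : Function.Surjective q := by
      intro h
      obtain ⟨g, d, hd⟩ := h2 h
      exact ⟨⟨_, hd⟩, rfl⟩
    refine MonoidHom.nonempty_mulEquiv_of_bijective p hp q
      ((Nat.bijective_iff_surjective_and_card q).2 ⟨hq, ?_⟩)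
    rw [← hGH]
    exact Nat.card_congr (Equiv.ofBijective p hp)

namespace GSet

variable {C : Type} [Group C] {G H K : Type} [Group G] [Group H] [Group K]

/-- A `((G × H) × C)`-set factors below `n` when it is a composition through a group of order less
than `n`. -/
def FactorsBelow (n : ℕ) (X : GSet ((G × H) × C)) : Prop :=
  ∃ (K : Type) (_ : Group K) (_ : Finite K), Nat.card K < n ∧
    ∃ (V : GSet ((G × K) × C)) (Y : GSet ((K × H) × C)), (diagComp V Y).Iso X

/-- The opposite of a `((G × H) × C)`-set. -/
def swap (X : GSet ((G × H) × C)) : GSet ((H × G) × C) :=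
  res ((MulEquiv.prodComm (M := H) (N := G)).toMonoidHom.prodMap (MonoidHom.id C)) X

theorem swap_diagComp (V : GSet ((G × K) × C)) (Y : GSet ((K × H) × C)) :
    (diagComp Y.swap V.swap).Iso (diagComp V Y).swap := by
  refine iso_of_span (W := Y.carrier × V.carrier) (orbit Y.swap V.swap)
    (fun w => orbit V Y (w.2, w.1)) (orbit_surjective _ _) ?_ ?_ ?_
  · intro t
    obtain ⟨⟨v, y⟩, rfl⟩ := orbit_surjective V Y t
    exact ⟨(y, v), rfl⟩
  · rintro ⟨y, v⟩ ⟨y', v'⟩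
    refine (orbit_eq_orbit (X := Y.swap) (Y := V.swap)).trans (Iff.trans ?_ orbit_eq_orbit.symm)
    exact exists_congr fun k => and_comm
  · rintro ⟨⟨h, g⟩, c⟩ ⟨y, v⟩
    exact ⟨((((1, h), c) : (K × H) × C) • y, (((g, 1), c) : (G × K) × C) • v), rfl, rfl⟩

theorem FactorsBelow.swap {n : ℕ} {X : GSet ((G × H) × C)} (h : X.FactorsBelow n) :
    X.swap.FactorsBelow n := by
  obtain ⟨K, _, _, hK, V, Y, e⟩ := h
  exact ⟨K, _, ‹_›, hK, Y.swap, V.swap, (swap_diagComp V Y).trans (res_congr _ e)⟩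

/-- A transitive set is induced from the projection to `G` of a point stabilizer, so it factors
through a smaller group when this projection misses an element of `G`. -/
theorem factorsBelow_of_proj_ne_top [Finite G] (X : GSet ((G × H) × C)) {x : X.carrier}
    (hx : ∀ y, ∃ a : (G × H) × C, y = a • x) {g₀ : G}
    (hg₀ : ∀ h c, (((g₀, h), c) : (G × H) × C) • x ≠ x) : X.FactorsBelow (Nat.card G) := by
  let P : Subgroup G := ((MulAction.stabilizer ((G × H) × C) x).map (MonoidHom.fst (G × H) C)).map
    (MonoidHom.fst G H)
  have hP : ∀ g, g ∈ P ↔ ∃ h c, (((g, h), c) : (G × H) × C) • x = x := by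
    intro g
    simp [P, MulAction.mem_stabilizer_iff]
  have hcard : Nat.card P < Nat.card G := by
    have hne : P ≠ ⊤ := fun h => by
      obtain ⟨h, c, e⟩ := (hP g₀).1 (h ▸ trivial)
      exact hg₀ h c e
    refine lt_of_le_of_ne (Subgroup.card_le_card_group P) fun h => hne ?_
    exact P.eq_top_of_card_eq h
  let V : GSet ((G × P) × C) :=
    { carrier := G
      action :=
        { smul := fun a v => a.1.1 * v * (a.1.2 : G)⁻¹
          one_smul := fun v => show 1 * v * ((1 : P) : G)⁻¹ = v by simp
          mul_smul := fun a b v => show a.1.1 * b.1.1 * v * ((a.1.2 * b.1.2 : P) : G)⁻¹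
            = a.1.1 * (b.1.1 * v * (b.1.2 : G)⁻¹) * (a.1.2 : G)⁻¹ by simp [mul_assoc] } }
  let ι : (P × H) × C →* (G × H) × C :=
    (P.subtype.prodMap (MonoidHom.id H)).prodMap (MonoidHom.id C)
  -- `X` is induced from the orbit `Y` of `x` under `P × H × C`, and `V` is the `(G, P)`-biset `G`.
  let Y : GSet ((P × H) × C) := (res ι X).sub {y | ∃ a : (P × H) × C, y = ι a • x} (by
    rintro b _ ⟨a, rfl⟩
    refine ⟨b * a, ?_⟩
    rw [map_mul, mul_smul]
    rfl)
  let val : Y.carrier → X.carrier := fun y => y.1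
  have hval : ∀ y : Y.carrier, ∃ (p : P) (h : H) (c : C),
      val y = (((p : G), h), c) • x := by
    rintro ⟨_, ⟨⟨p, h⟩, c⟩, rfl⟩
    exact ⟨p, h, c, rfl⟩
  have hsmul : ∀ (p : P) (h : H) (c : C) (y : Y.carrier),
      val ((((p, h), c) : (P × H) × C) • y) = (((p : G), h), c) • val y := fun _ _ _ _ => rfl
  have hsec : ∀ t : X.carrier, ∃ s : G × Y.carrier,
      (((s.1, 1), 1) : (G × H) × C) • val s.2 = t := by
    intro t
    obtain ⟨⟨⟨g, h⟩, c⟩, rfl⟩ := hx t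
    refine ⟨(g, ⟨(((1, h), c) : (G × H) × C) • x, ((1, h), c), rfl⟩), ?_⟩
    change (((g, 1), 1) : (G × H) × C) • (((1, h), c) : (G × H) × C) • x = _
    simp [smul_smul]
  choose s hs using hsec
  refine ⟨P, inferInstance, inferInstance, hcard, V, Y, diagComp_iso_of_section (T := X)
    (fun (v : G) y => (((v, 1), 1) : (G × H) × C) • val y) s hs ?_ ?_ ?_⟩
  · intro p (v : G) y
    change (((1 * v * (p : G)⁻¹, 1), 1) : (G × H) × C) • (((p, 1), 1) : (G × H) × C) • val y
      = (((v, 1), 1) : (G × H) × C) • val y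
    simp [smul_smul]
  · intro (v : G) y
    have key := hs ((((v, 1), 1) : (G × H) × C) • val y)
    generalize s ((((v, 1), 1) : (G × H) × C) • val y) = st at key
    obtain ⟨g, z⟩ := st
    have hyz : val y = (((v⁻¹ * g, 1), 1) : (G × H) × C) • val z := by
      have := congrArg (fun t => (((v⁻¹, 1), 1) : (G × H) × C) • t) key
      simp only [smul_smul, Prod.mk_mul_mk, inv_mul_cancel, mul_one] at this
      exact (one_smul ((G × H) × C) _).symm.trans this.symm
    have hmem : v⁻¹ * g ∈ P := by
      obtain ⟨p, h, c, hy⟩ := hval y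
      obtain ⟨p', h', c', hz⟩ := hval z
      rw [hy, hz] at hyz
      have h2 : (p : G)⁻¹ * (v⁻¹ * g) * p' ∈ P := by
        refine (hP _).2 ⟨h⁻¹ * h', c⁻¹ * c', ?_⟩
        have := congrArg (fun t => ((((p : G), h), c) : (G × H) × C)⁻¹ • t) hyz
        simp only [smul_smul, inv_mul_cancel, one_smul] at this
        refine Eq.trans ?_ this.symm
        congr 1
        simp [mul_assoc]
      have h3 := P.mul_mem (P.mul_mem p.2 h2) (P.inv_mem p'.2)
      simpa [mul_assoc] using h3
    refine ⟨⟨v⁻¹ * g, hmem⟩, ?_, ?_⟩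
    · change v = 1 * g * (v⁻¹ * g)⁻¹
      simp
    · exact Subtype.ext hyz
  · intro g h c (v : G) y
    change (((g * v * ((1 : P) : G)⁻¹, 1), 1) : (G × H) × C) • ((((1 : P) : G), h), c) • val y
      = (((g, h), c) : (G × H) × C) • (((v, 1), 1) : (G × H) × C) • val y
    simp [smul_smul]

/-- A set on which a nontrivial normal subgroup of `G` acts trivially is inflated from a proper
quotient of `G`. -/
theorem factorsBelow_of_normal [Finite G] (X : GSet ((G × H) × C)) (N : Subgroup G) [N.Normal]
    (hN : N ≠ ⊥) (hX : ∀ g ∈ N, ∀ x : X.carrier, (((g, 1), 1) : (G × H) × C) • x = x) :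
    X.FactorsBelow (Nat.card G) := by
  have hcard : Nat.card (G ⧸ N) < Nat.card G := by
    rw [Subgroup.card_eq_card_quotient_mul_card_subgroup N]
    exact lt_mul_of_one_lt_right Nat.card_pos ((Subgroup.one_lt_card_iff_ne_bot N).2 hN)
  have hind : ∀ {g g' : G}, (g : G ⧸ N) = g' → ∀ (h : H) (c : C) (x : X.carrier),
      (((g, h), c) : (G × H) × C) • x = (((g', h), c) : (G × H) × C) • x := by
    intro g g' hgg' h c x
    have := hX _ (QuotientGroup.eq.1 hgg') x
    have h' : (((g', h), c) : (G × H) × C) = ((g, h), c) * ((g⁻¹ * g', 1), 1) := by simp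
    rw [h', mul_smul, this]
  have hout : ∀ k : G ⧸ N, ((Quotient.out k : G) : G ⧸ N) = k := QuotientGroup.out_eq'
  let V : GSet ((G × (G ⧸ N)) × C) :=
    { carrier := G ⧸ N
      action :=
        { smul := fun a v => (a.1.1 : G ⧸ N) * v * a.1.2⁻¹
          one_smul := fun v => show ((1 : G) : G ⧸ N) * v * 1⁻¹ = v by simp
          mul_smul := fun a b v => show ((a.1.1 * b.1.1 : G) : G ⧸ N) * v * (a.1.2 * b.1.2)⁻¹
            = a.1.1 * (b.1.1 * v * (b.1.2)⁻¹) * (a.1.2)⁻¹ by simp [mul_assoc] } }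
  let Y : GSet (((G ⧸ N) × H) × C) :=
    { carrier := X.carrier
      action :=
        { smul := fun a y => (((Quotient.out a.1.1, a.1.2), a.2) : (G × H) × C) • y
          one_smul := fun y => (hind (g' := 1) (hout 1) 1 1 y).trans (one_smul ((G × H) × C) y)
          mul_smul := fun a b y => by
            refine (hind (g' := Quotient.out a.1.1 * Quotient.out b.1.1) ?_ _ _ y).trans
              (mul_smul (((Quotient.out a.1.1, a.1.2), a.2) : (G × H) × C)
                (((Quotient.out b.1.1, b.1.2), b.2) : (G × H) × C) y)
            rw [hout, QuotientGroup.mk_mul, hout, hout]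
            rfl } }
  have hY : ∀ (g : G) (h : H) (c : C) (y : X.carrier),
      ((((g : G ⧸ N), h), c) : ((G ⧸ N) × H) × C) • (show Y.carrier from y)
        = (show Y.carrier from (((g, h), c) : (G × H) × C) • y) := fun g h c y =>
    hind (hout g) h c y
  refine ⟨G ⧸ N, inferInstance, inferInstance, hcard, V, Y, diagComp_iso_of_section (T := X)
    (fun v y => ((((show G ⧸ N from v), 1), 1) : ((G ⧸ N) × H) × C) • y)
    (fun t => ((1 : G ⧸ N), t))
    (fun t => one_smul (((G ⧸ N) × H) × C) (show Y.carrier from t)) ?_ ?_ ?_⟩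
  · intro k (v : G ⧸ N) y
    change ((((1 : G) : G ⧸ N) * v * k⁻¹, 1), 1) • (((k, 1), 1) : ((G ⧸ N) × H) × C) • y
      = (((v, 1), 1) : ((G ⧸ N) × H) × C) • y
    simp [smul_smul]
  · intro (v : G ⧸ N) y
    refine ⟨v⁻¹, ?_, ?_⟩
    · change v = ((1 : G) : G ⧸ N) * 1 * v⁻¹⁻¹
      simp
    · change y = (((v⁻¹, 1), 1) : ((G ⧸ N) × H) × C) • (((v, 1), 1) : ((G ⧸ N) × H) × C) • y
      rw [smul_smul]; simp only [Prod.mk_mul_mk, inv_mul_cancel, mul_one]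
      exact (one_smul _ y).symm
  · intro g h c (v : G ⧸ N) y
    refine Eq.trans ?_ (hY g h c _)
    change ((((g : G ⧸ N) * v * 1⁻¹, 1), 1) : ((G ⧸ N) × H) × C) •
      (((1, h), c) : ((G ⧸ N) × H) × C) • y = ((((g : G ⧸ N), h), c) : ((G ⧸ N) × H) × C) •
        (((v, 1), 1) : ((G ⧸ N) × H) × C) • y
    simp [smul_smul]

theorem FactorsBelow.of_swap {n : ℕ} {X : GSet ((G × H) × C)} (h : X.swap.FactorsBelow n) :
    X.FactorsBelow n := h.swap

theorem exists_eq_smul_swap {X : GSet ((G × H) × C)} {x : X.carrier}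
    (hx : ∀ y, ∃ a : (G × H) × C, y = a • x) :
    ∀ y : X.swap.carrier, ∃ a : (H × G) × C, y = a • (show X.swap.carrier from x) := by
  intro y
  obtain ⟨⟨⟨g, h⟩, c⟩, ha⟩ := hx y
  exact ⟨((h, g), c), ha⟩

/-- In a transitive set that does not factor through a group of order less than that of `G`, a
point stabilizer meets `G` trivially and projects onto `G`. -/
theorem stabilizer_of_not_factorsBelow [Finite G] {X : GSet ((G × H) × C)} {x : X.carrier}
    (hx : ∀ y, ∃ a : (G × H) × C, y = a • x) (hX : ¬ X.FactorsBelow (Nat.card G)) :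
    (∀ g, ∃ h c, (((g, h), c) : (G × H) × C) • x = x) ∧
      ∀ g, (((g, 1), 1) : (G × H) × C) • x = x → g = 1 := by
  have h1 : ∀ g, ∃ h c, (((g, h), c) : (G × H) × C) • x = x := by
    intro g
    by_contra! h
    exact hX (factorsBelow_of_proj_ne_top X hx h)
  refine ⟨h1, fun g hg => ?_⟩
  by_contra hg1
  let ι : G →* (G × H) × C := (MonoidHom.inl (G × H) C).comp (MonoidHom.inl G H)
  let N : Subgroup G := (MulAction.stabilizer ((G × H) × C) x).comap ι
  have hN : ∀ g, g ∈ N ↔ (((g, 1), 1) : (G × H) × C) • x = x := fun g => Iff.rfl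
  have hconj : ∀ g ∈ N, ∀ k, k * g * k⁻¹ ∈ N := by
    intro g hg k
    obtain ⟨h, c, e⟩ := h1 k
    have h2 : (((k * g * k⁻¹, 1), 1) : (G × H) × C)
        = ((k, h), c) * (((g, 1), 1) * ((k, h), c)⁻¹) := by simp [mul_assoc]
    have e' : (((k, h), c) : (G × H) × C)⁻¹ • x = x := inv_smul_eq_iff.2 e.symm
    rw [hN, h2, mul_smul, mul_smul, e', (hN g).1 hg, e]
  have : N.Normal := ⟨hconj⟩
  refine hX (factorsBelow_of_normal X N ?_ ?_)
  · exact fun h => hg1 ((Subgroup.mem_bot).1 (h ▸ (hN g).2 hg))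
  · intro g hg y
    obtain ⟨⟨⟨k, h⟩, c⟩, rfl⟩ := hx y
    have h2 : (((g, 1), 1) : (G × H) × C) * ((k, h), c) = ((k, h), c) * ((k⁻¹ * g * k, 1), 1) := by
      simp [mul_assoc]
    have h3 : k⁻¹ * g * k ∈ N := by simpa using hconj g hg k⁻¹
    rw [smul_smul, h2, mul_smul, (hN _).1 h3]

/-- A transitive `((G × H) × C)`-set that does not factor through a smaller group only exists when
`G` and `H` are isomorphic. -/
theorem nonempty_mulEquiv_of_not_factorsBelow [Finite C] [Finite G] [Finite H]
    (hC : (Nat.card C).Prime) (hGH : Nat.card G = Nat.card H) {X : GSet ((G × H) × C)}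
    (hX : X.IsTransitive) (hX' : ¬ X.FactorsBelow (Nat.card G)) : Nonempty (G ≃* H) := by
  obtain ⟨x, hx⟩ := hX
  obtain ⟨h1, h3⟩ := stabilizer_of_not_factorsBelow hx hX'
  obtain ⟨h2, h4⟩ := stabilizer_of_not_factorsBelow (exists_eq_smul_swap hx)
    (fun h => hX' (hGH ▸ h.of_swap))
  exact Subgroup.nonempty_mulEquiv_of_prime hC hGH (MulAction.stabilizer ((G × H) × C) x) h1
    (fun h => h2 h) h3 h4

end GSet

namespace RBCModule

variable {R : Type u} [CommRing R] {C : Type} [Group C] [Finite C] {M : RBCModule.{u, w} R C}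

/-- Two minimal groups of a simple module are isomorphic. -/
theorem IsSimple.nonempty_mulEquiv (hC : (Nat.card C).Prime) (hM : M.IsSimple)
    {G H : Type} [Group G] [Finite G] [Group H] [Finite H] (hG : M.IsMinimal G)
    (hH : M.IsMinimal H) : Nonempty (G ≃* H) := by
  have := hG.1
  have := hH.1
  have hGH : Nat.card G = Nat.card H := by
    refine le_antisymm (le_of_not_gt fun h => ?_) (le_of_not_gt fun h => ?_)
    · have := hG.2 H h
      exact not_subsingleton (M.obj H) this
    · have := hH.2 G h
      exact not_subsingleton (M.obj G) this
  by_contra hne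
  have h0 : M.act (G := G) (H := H) = 0 := by
    refine RB.hom_ext_of_isTransitive fun X hX => ?_
    have hX' : X.FactorsBelow (Nat.card G) := by
      by_contra h
      exact hne (GSet.nonempty_mulEquiv_of_not_factorsBelow hC hGH hX h)
    obtain ⟨K, _, _, hK, V, Y, e⟩ := hX'
    have := hG.2 K hK
    rw [← RB.cls_congr e, ← RBC.comp_cls]
    refine LinearMap.ext fun m => ?_
    rw [act_comp, Subsingleton.elim (M.act (RB.cls R Y) m) 0, map_zero]
    rfl
  have h1 := hM.generated_eq_top (H := H) (W := ⊤) top_ne_bot G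
  rw [h0] at h1
  refine top_ne_bot (α := Submodule R (M.obj G)) (h1.symm.trans ?_)
  exact le_bot_iff.1 (Submodule.map₂_le.2 fun _ _ _ _ => (Submodule.mem_bot R).2 rfl)

end RBCModule

/-! ### Nontriviality of the quotient algebras and the correspondence -/

namespace GSet

variable {G : Type} [Group G]

/-- The orbits of `X` that contain a point whose stabilizer has the property `p`. -/
def orbitsWith (p : Subgroup G → Prop) (X : GSet G) : Set (Set X.carrier) :=
  {s | ∃ x, s = MulAction.orbit G x ∧ p (MulAction.stabilizer G x)}

theorem ncard_orbitsWith_congr (p : Subgroup G → Prop) {X Y : GSet G} (h : X.Iso Y) :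
    (orbitsWith p X).ncard = (orbitsWith p Y).ncard := by
  have key : ∀ {X Y : GSet G}, X.Iso Y → (orbitsWith p X).ncard ≤ (orbitsWith p Y).ncard := by
    rintro X Y ⟨e, he⟩
    rw [← Set.ncard_image_of_injective _ (Set.image_injective.2 e.injective)]
    refine Set.ncard_le_ncard ?_
    rintro _ ⟨_, ⟨x, rfl, hx⟩, rfl⟩
    refine ⟨e x, ?_, ?_⟩
    · ext y
      simp only [Set.mem_image, MulAction.mem_orbit_iff, exists_exists_eq_and, he]
    · convert hx using 1
      ext g
      rw [MulAction.mem_stabilizer_iff, MulAction.mem_stabilizer_iff, ← he, e.injective.eq_iff]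
  exact le_antisymm (key h) (key h.symm)

theorem ncard_orbitsWith_sum (p : Subgroup G → Prop) (X Y : GSet G) :
    (orbitsWith p (X.sum Y)).ncard = (orbitsWith p X).ncard + (orbitsWith p Y).ncard := by
  let inl : X.carrier → (X.sum Y).carrier := Sum.inl
  let inr : Y.carrier → (X.sum Y).carrier := Sum.inr
  have hl : Function.Injective inl := Sum.inl_injective
  have hr : Function.Injective inr := Sum.inr_injective
  have hol : ∀ x, inl '' MulAction.orbit G x = MulAction.orbit G (inl x) := fun x =>
    (Set.range_comp inl fun g : G => g • x).symm
  have hor : ∀ x, inr '' MulAction.orbit G x = MulAction.orbit G (inr x) := fun x =>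
    (Set.range_comp inr fun g : G => g • x).symm
  have hsl : ∀ x, MulAction.stabilizer G (inl x) = MulAction.stabilizer G x := fun x =>
    Subgroup.ext fun g => hl.eq_iff (a := g • x) (b := x)
  have hsr : ∀ x, MulAction.stabilizer G (inr x) = MulAction.stabilizer G x := fun x =>
    Subgroup.ext fun g => hr.eq_iff (a := g • x) (b := x)
  have h : orbitsWith p (X.sum Y) = Set.image inl '' orbitsWith p X
      ∪ Set.image inr '' orbitsWith p Y := by
    ext s
    constructor
    · rintro ⟨x | x, rfl, hx⟩
      · exact Or.inl ⟨_, ⟨x, rfl, hsl x ▸ hx⟩, hol x⟩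
      · exact Or.inr ⟨_, ⟨x, rfl, hsr x ▸ hx⟩, hor x⟩
    · rintro (⟨_, ⟨x, rfl, hx⟩, rfl⟩ | ⟨_, ⟨x, rfl, hx⟩, rfl⟩)
      · exact ⟨inl x, hol x, (hsl x).symm ▸ hx⟩
      · exact ⟨inr x, hor x, (hsr x).symm ▸ hx⟩
  rw [h, Set.ncard_union_eq, Set.ncard_image_of_injective _ (Set.image_injective.2 hl),
    Set.ncard_image_of_injective _ (Set.image_injective.2 hr)]
  rw [Set.disjoint_left]
  rintro _ ⟨_, ⟨x, rfl, -⟩, rfl⟩ ⟨_, ⟨y, rfl, -⟩, h⟩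
  obtain ⟨z, -, hz⟩ := h.symm ▸ Set.mem_image_of_mem inl (MulAction.mem_orbit_self (M := G) x)
  exact Sum.inr_ne_inl hz

theorem orbitsWith_eq_empty {p : Subgroup G → Prop} {X : GSet G}
    (h : ∀ x : X.carrier, ¬ p (MulAction.stabilizer G x)) : orbitsWith p X = ∅ :=
  Set.eq_empty_of_forall_notMem fun _ ⟨x, _, hx⟩ => h x hx

end GSet

namespace RB

variable {R : Type u} [CommRing R] {G : Type} [Group G]

/-- The number of orbits whose stabilizers have a given property, as a linear form on the Burnside
group. -/
noncomputable def countOrbits (p : Subgroup G → Prop) : RB R G →ₗ[R] R :=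
  lift
    { toFun := fun a => ((a.rep.orbitsWith p).ncard : R)
      map_zero' := by
        have h := GSet.ncard_orbitsWith_congr p (IsoClass.rep_mk (GSet.empty G))
        rw [IsoClass.zero_def, h, GSet.orbitsWith_eq_empty (fun x => Empty.elim x),
          Set.ncard_empty, Nat.cast_zero]
      map_add' := fun a b => by
        have h : ((a + b).rep.orbitsWith p).ncard
            = (a.rep.orbitsWith p).ncard + (b.rep.orbitsWith p).ncard :=
          (GSet.ncard_orbitsWith_congr p (IsoClass.rep_mk (a.rep.sum b.rep))).trans
            (GSet.ncard_orbitsWith_sum p _ _)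
        rw [h, Nat.cast_add] }

theorem countOrbits_cls (p : Subgroup G → Prop) (X : GSet G) :
    countOrbits p (cls R X) = ((X.orbitsWith p).ncard : R) := by
  rw [countOrbits, cls, lift_ofClass, AddMonoidHom.coe_mk, ZeroHom.coe_mk,
    GSet.ncard_orbitsWith_congr p (IsoClass.rep_mk X)]

end RB

namespace EndAlg

variable {R : Type u} [CommRing R] {C H : Type} [Group C] [Group H]

/-- The elements with trivial last component form the diagonal of `H × H`. -/
def IsDiagonal (D : Subgroup ((H × H) × C)) : Prop := ∀ h k : H, ((h, k), 1) ∈ D ↔ h = k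

/-- No point stabilizer of a composition through a smaller group meets `H × H` in the diagonal. -/
theorem not_isDiagonal_of_card_lt {K : Type} [Group K] [Finite K] (hK : Nat.card K < Nat.card H)
    (X : GSet ((H × K) × C)) (Y : GSet ((K × H) × C)) (z : (GSet.diagComp X Y).carrier) :
    ¬ IsDiagonal (MulAction.stabilizer ((H × H) × C) z) := by
  intro hz
  obtain ⟨⟨x, y⟩, rfl⟩ := GSet.orbit_surjective X Y z
  have key : ∀ h k : H, ((((h, k), 1) : (H × H) × C) • GSet.orbit X Y (x, y) = GSet.orbit X Y (x, y)
      ↔ h = k) := hz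
  simp only [GSet.smul_orbit, GSet.orbit_eq_orbit, smul_smul, Prod.mk_mul_mk, mul_one,
    one_mul] at key
  -- Since `(h, h)` fixes the orbit of `(x, y)`, there is `k h` in `K` with `(h, k h)` fixing `x`
  -- and `(k h, h)` fixing `y`; the map `k` is injective as no `(h, h')` with `h ≠ h'`
  -- fixes the orbit.
  choose k hx hy using fun h => (key h h).2 rfl
  have hinj : Function.Injective k := fun h h' e => (key h h').1 ⟨k h, hx h, e ▸ hy h'⟩
  exact absurd (Nat.card_le_card_of_injective k hinj) (not_le_of_gt hK)

variable [Finite C] [Finite H]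

theorem countOrbits_of_mem_factorSubmodule {x : EndAlg R C H} (hx : x ∈ factorSubmodule R C H) :
    RB.countOrbits (R := R) (G := (H × H) × C) IsDiagonal x = 0 := by
  suffices h : factorSubmodule R C H
      ≤ LinearMap.ker (RB.countOrbits (R := R) (G := (H × H) × C) IsDiagonal) from h hx
  refine Submodule.span_le.2 ?_
  rintro _ ⟨K, _, _, hK, a, b, rfl⟩
  have h0 : (RBC.comp (R := R) (C := C) (H := H) (G := K) (K := H)).compr₂
      (RB.countOrbits IsDiagonal) = 0 := by
    refine RB.hom_ext₂ fun X Y => ?_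
    rw [LinearMap.compr₂_apply, RBC.comp_cls, RB.countOrbits_cls,
      GSet.orbitsWith_eq_empty (not_isDiagonal_of_card_lt hK X Y), Set.ncard_empty, Nat.cast_zero]
    rfl
  exact LinearMap.congr_fun₂ h0 a b

theorem countOrbits_one :
    RB.countOrbits (R := R) (G := (H × H) × C) IsDiagonal (1 : EndAlg R C H) = 1 := by
  have h1 : (1 : EndAlg R C H)
      = RB.cls R (GSet.res (MonoidHom.fst (H × H) C) (Biset.id H)) := RBC.ofBiset_eq _
  let X := GSet.res (MonoidHom.fst (H × H) C) (Biset.id H)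
  have h2 : X.orbitsWith IsDiagonal = {Set.univ} := by
    have htrans : ∀ x : H, MulAction.orbit ((H × H) × C) (show X.carrier from x) = Set.univ := by
      intro x
      refine Set.eq_univ_of_forall fun (y : H) => ⟨((y * x⁻¹, 1), 1), ?_⟩
      change y * x⁻¹ * x * 1⁻¹ = y
      simp
    refine Set.eq_singleton_iff_unique_mem.2 ⟨⟨(1 : H), (htrans 1).symm, fun h k => ?_⟩, ?_⟩
    · change h * 1 * k⁻¹ = 1 ↔ h = k
      rw [mul_one, mul_inv_eq_one]
    · rintro _ ⟨x, rfl, -⟩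
      exact htrans x
  rw [h1, RB.countOrbits_cls, h2, Set.ncard_singleton, Nat.cast_one]

theorem nontrivial_hatRBC [Nontrivial R] : Nontrivial (HatRBC R C H) := by
  refine Ideal.Quotient.nontrivial_iff.2 fun h => ?_
  have h1 : (1 : EndAlg R C H) ∈ factorSubmodule R C H :=
    (Ideal.eq_top_iff_one (factorIdeal R C H)).1 h
  exact zero_ne_one ((countOrbits_of_mem_factorSubmodule h1).symm.trans countOrbits_one)

end EndAlg

namespace RBCModule

variable {R : Type u} [CommRing R] {C : Type} [Group C] [Finite C] (M : RBCModule.{u, w} R C)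
variable {G H : Type} [Group G] [Finite G] [Group H] [Finite H]

/-- The action of a group isomorphism. -/
noncomputable def isoEquiv (φ : G ≃* H) : M.obj G ≃ₗ[R] M.obj H :=
  LinearEquiv.ofLinearMap (M.act (RBC.ofIso R C φ)) (M.act (RBC.ofIso R C φ.symm))
    (LinearMap.ext fun m => by
      rw [LinearMap.comp_apply, ← act_comp, RBC.ofIso_comp_ofIso, MulEquiv.symm_trans_self, act_id]
      rfl)
    (LinearMap.ext fun m => by
      rw [LinearMap.comp_apply, ← act_comp, RBC.ofIso_comp_ofIso, MulEquiv.self_trans_symm, act_id]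
      rfl)

theorem isoEquiv_apply (φ : G ≃* H) (m : M.obj G) :
    M.isoEquiv φ m = M.act (RBC.ofIso R C φ) m := rfl

theorem isoEquiv_act (φ : G ≃* H) (a : RBC R C (G × G)) (m : M.obj G) :
    M.isoEquiv φ (M.act a m) = M.act (RBCSeed.conj φ a) (M.isoEquiv φ m) := by
  rw [isoEquiv_apply, isoEquiv_apply, ← act_comp, ← act_comp, RBCSeed.conj, RBC.comp_assoc,
    RBC.ofIso_comp_ofIso, MulEquiv.self_trans_symm, RBC.comp_ofIso_refl]

variable {M}

theorem IsMinimal.of_mulEquiv (hG : M.IsMinimal G) (φ : G ≃* H) : M.IsMinimal H := by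
  have := hG.1
  refine ⟨(M.isoEquiv φ).symm.toEquiv.nontrivial, fun K _ _ hK => hG.2 K ?_⟩
  rwa [Nat.card_congr φ.toEquiv]

end RBCModule

namespace RBCSeed

variable {R : Type u} [CommRing R] {C : Type} [Group C] [Finite C]

theorem Belongs.equivalent {X Y : RBCSeed.{u, w} R C} {S : RBCModule.{u, w} R C}
    (hC : (Nat.card C).Prime) (hS : S.IsSimple) (hX : X.Belongs S) (hY : Y.Belongs S) :
    Equivalent X Y := by
  obtain ⟨φ⟩ := hS.nonempty_mulEquiv hC hX.1 hY.1
  obtain ⟨-, e, he⟩ := hX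
  obtain ⟨-, f, hf⟩ := hY
  refine ⟨φ, e.symm.trans ((S.isoEquiv φ).toAddEquiv.trans f), fun a v => ?_⟩
  obtain ⟨m, rfl⟩ := e.surjective v
  rw [← he]
  simp only [AddEquiv.trans_apply, AddEquiv.symm_apply_apply]
  exact (congrArg f (S.isoEquiv_act φ a m)).trans (hf _ _)

theorem Belongs.of_equivalent {X Y : RBCSeed.{u, w} R C} {S : RBCModule.{u, w} R C}
    (hX : X.Belongs S) (hXY : Equivalent X Y) : Y.Belongs S := by
  obtain ⟨hmin, e, he⟩ := hX
  obtain ⟨φ, f, hf⟩ := hXY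
  refine ⟨hmin.of_mulEquiv φ, (S.isoEquiv φ).symm.toAddEquiv.trans (e.trans f), fun a m => ?_⟩
  obtain ⟨m, rfl⟩ := (S.isoEquiv φ).surjective m
  have ha : a = conj φ (conj φ.symm a) := by
    rw [conj_conj, MulEquiv.symm_trans_self, conj_refl]
  generalize conj φ.symm a = b at ha
  subst ha
  rw [← S.isoEquiv_act]
  simp only [AddEquiv.trans_apply]
  change f (e ((S.isoEquiv φ).symm (S.isoEquiv φ _)))
    = HatRBC.mk (conj φ b) • f (e ((S.isoEquiv φ).symm (S.isoEquiv φ _)))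
  rw [LinearEquiv.symm_apply_apply, LinearEquiv.symm_apply_apply, he, hf]

theorem Belongs.of_iso {X : RBCSeed.{u, w} R C} {S T : RBCModule.{u, w} R C}
    (hX : X.Belongs S) (i : S.Iso T) : X.Belongs T := by
  obtain ⟨⟨hnt, hK⟩, e, he⟩ := hX
  refine ⟨⟨(i.equiv X.H).symm.toEquiv.nontrivial, fun K _ _ h => ?_⟩,
    (i.equiv X.H).symm.toAddEquiv.trans e, fun a m => ?_⟩
  · have := hK K h
    exact (i.equiv K).symm.toEquiv.subsingleton
  · obtain ⟨m, rfl⟩ := (i.equiv X.H).surjective m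
    rw [← i.equiv_act]
    change e ((i.equiv X.H).symm (i.equiv X.H _))
      = HatRBC.mk a • e ((i.equiv X.H).symm (i.equiv X.H _))
    rw [LinearEquiv.symm_apply_apply, LinearEquiv.symm_apply_apply, he]

theorem exists_belongs (S : SimpleRBCModule.{u, w} R C) :
    ∃ X : RBCSeed.{u, w} R C, X.Belongs S.toModule := by
  obtain ⟨H, _, _, hH⟩ := S.isSimple.exists_isMinimal
  exact ⟨_, S.isSimple.seed_belongs hH⟩

theorem exists_simple_belongs (X : RBCSeed.{u, max u w} R C) :
    ∃ S : SimpleRBCModule.{u, max u w} R C, X.Belongs S.toModule :=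
  ⟨⟨X.simpleModule, X.simpleModule_isSimple⟩, X.simpleModule_isMinimal, X.simpleModule_exists_equiv⟩

end RBCSeed

theorem proposition4p8 (R : Type u) [CommRing R] (C : Type) [Group C] [Finite C]
    (hC : (Nat.card C).Prime) :
    (∃ Φ : Quotient (SimpleRBCModule.isoSetoid.{u, max u w} R C) ≃
        Quotient (RBCSeed.setoid.{u, max u w} R C),
      ∀ (S : SimpleRBCModule.{u, max u w} R C) (X : RBCSeed.{u, max u w} R C),
        Φ (Quotient.mk _ S) = Quotient.mk _ X ↔ X.Belongs S.toModule) ∧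
    (Nontrivial R → ∀ (H : Type) [Group H] [Finite H], Nontrivial (HatRBC R C H)) := by
  refine ⟨?_, fun _ H _ _ => EndAlg.nontrivial_hatRBC⟩
  choose F hF using RBCSeed.exists_belongs.{u, max u w} (R := R) (C := C)
  have huniq : ∀ (S : SimpleRBCModule.{u, max u w} R C) (X : RBCSeed.{u, max u w} R C),
      RBCSeed.Equivalent (F S) X ↔ X.Belongs S.toModule := fun S X =>
    ⟨fun h => (hF S).of_equivalent h, fun h => (hF S).equivalent hC S.isSimple h⟩
  have hcongr : ∀ S T : SimpleRBCModule.{u, max u w} R C, Nonempty (S.toModule.Iso T.toModule) →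
      RBCSeed.Equivalent (F S) (F T) := fun S T ⟨i⟩ =>
    (hF S).of_iso i |>.equivalent hC T.isSimple (hF T)
  let Φ : Quotient (SimpleRBCModule.isoSetoid.{u, max u w} R C) →
      Quotient (RBCSeed.setoid.{u, max u w} R C) := Quotient.map F hcongr
  have hΦ : ∀ (S : SimpleRBCModule.{u, max u w} R C) (X : RBCSeed.{u, max u w} R C),
      Φ (Quotient.mk _ S) = Quotient.mk _ X ↔ X.Belongs S.toModule := fun S X =>
    Quotient.eq.trans (huniq S X)
  refine ⟨Equiv.ofBijective Φ ⟨?_, ?_⟩, hΦ⟩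
  · rintro ⟨S⟩ ⟨T⟩ h
    obtain ⟨i⟩ := ((hΦ S (F T)).1 h).iso S.isSimple
    obtain ⟨j⟩ := (hF T).iso T.isSimple
    exact Quotient.sound ((SimpleRBCModule.isoSetoid R C).trans
      (b := ⟨(F T).simpleModule, (F T).simpleModule_isSimple⟩) ⟨i⟩
      ((SimpleRBCModule.isoSetoid R C).symm ⟨j⟩))
  · rintro ⟨X⟩
    obtain ⟨S, hS⟩ := X.exists_simple_belongs
    exact ⟨Quotient.mk _ S, (hΦ S X).2 hS⟩
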